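/- **Setting.** Let $\Gamma=\pi_1(S^3\setminus 6^3_2)=\langle x,y,z \mid [x,[y^{-1},z]]=[y,[z^{-1},x]]=1\rangle$ be the Borromean rings group, where $[a,b]=aba^{-1}b^{-1}$ and $x,y,z$ are meridians of the three components. Let $\rho:\Gamma\to SO(3,1)\subset SL_4(\mathbb R)$ (for the form $J=\mathrm{diag}(-1,1,1,1)$) be the holonomy of the complete hyperbolic structure, given by $$\rho(x)=\begin{pmatrix}3&0&2&2\\0&1&0&0\\-2&0&-1&-2\\2&0&2&1\end{pmatrix},\quad \rho(y)=\begin{pmatrix}3&2&0&-2\\2&1&0&-2\\0&0&1&0\\2&2&0&-1\end{pmatrix},\quad \rho(z)=\begin{pmatrix}3&-2&-2&0\\2&-1&-2&0\\-2&2&1&0\\0&0&0&1\end{pmatrix}.$$ Let $\nu_4=\{V\in\mathfrak{sl}_4(\mathbb R) : V^{T}J=JV\}$, on which $\gamma\in\Gamma$ acts by $\mathrm{Ad}_\gamma V=\rho(\gamma)V\rho(\gamma)^{-1}$. Call $\gamma\in\Gamma$ parabolic if $\rho(\gamma)$ is a parabolic isometry of $\mathbb H^3$, that is, if $\rho(\gamma)\neq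 1$ is unipotent, and let $PH^1(\Gamma,\nu_4)\subseteq H^1(\Gamma,\nu_4)$ be the space of classes of those cocycles $c$ with $c(\gamma)\in\mathrm{im}(1-\mathrm{Ad}_\gamma)$ for every parabolic $\gamma$. The six thrice-punctured spheres $P_{(m,n)}$ (waistband at the cusp $m$, both cuffs at the cusp $n$) have the following stable letters $\alpha$ and fundamental groups $H$ (up to conjugacy in $\Gamma$): - $P_{(R,G)}$: $\alpha=x$, $H=x\langle y^{-1}zy,\,z^{-1}\rangle x^{-1}$; - $P_{(R,B)}$: $\alpha=x$, $H=\langle y^{-1},\,zyz^{-1}\rangle$; - $P_{(B,R)}$: $\alpha=y$, $H=y\langle z^{-1}xz,\,x^{-1}\rangle y^{-1}$; - $P_{(B,G)}$: $\alpha=y$, $H=\langle z^{-1},\,xzx^{-1}\rangle$; - $P_{(G,R)}$: $\alpha=z$, $H=\langle x^{-1},\,yxy^{-1}\rangle$; - $P_{(G,B)}$: $\alpha=z$, $H=z\langle x^{-1}yx,\,y^{-1}\rangle z^{-1}$. For each of them let $A\le\Gamma$ be generated by the two meridians in $\{x,y,z\}\setminus\{\alpha\}$, by $H$ and by $\alpha^{-1}H\alpha$.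 The projective bending of $\rho$ along the sphere is the family of representations $\rho_t:\Gamma\to SL_4(\mathbb R)$, $t\in\mathbb R$, with $\rho_t|_A=\rho|_A$ and $\rho_t(\alpha)=c(t)\rho(\alpha)$, where $c(t)$ is the one-parameter group that centralizes $\rho(H)$ and is conjugate to $\mathrm{diag}(e^{-3t},e^t,e^t,e^t)$. Its tangent cocycle is $\gamma\mapsto \frac{d}{dt}\big|_{t=0}\rho_t(\gamma)\,\rho(\gamma)^{-1}$; write $\beta(P_{(m,n)})\in H^1(\Gamma,\nu_4)$ for its class. **Theorem.** 1. Each $H$ fixes a spacelike vector under $\rho$ and is generated by two parabolic elements $p,q$ with $pq$ parabolic and $\rho(p),\rho(q)$ not commuting. Moreover $\Gamma$ is the HNN extension of $A$ with stable letter $\alpha$ conjugating $\alpha^{-1}H\alpha\le A$ to $H\le A$. 2. $\dim_{\mathbb R}H^1(\Gamma,\nu_4)=6$. The six bendings $\rho^j_t$ exist, their tangent cocycles take values in $\nu_4$, and the six classes $\beta(P_{(m,n)})$ form a basis of $H^1(\Gamma,\nu_4)$. 3. For the words $w_1,\dots,w_6=x^{-1}y,\ xz,\ yz,\ xyz,\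 yzx^{-1},\ zxy^{-1}$, the $6\times 6$ matrix of trace derivatives $\frac{d}{dt}\big|_{t=0}\mathrm{tr}\,\rho^j_t(w_i)$ is nonsingular. 4. $\dim_{\mathbb R}PH^1(\Gamma,\nu_4)=3$, and $PH^1(\Gamma,\nu_4)$ is spanned by the differences along the cancelling pairs, $\beta(P_{(R,G)})-\beta(P_{(R,B)})$, $\beta(P_{(B,R)})-\beta(P_{(B,G)})$ and $\beta(P_{(G,R)})-\beta(P_{(G,B)})$. -/

import Mathlib

noncomputable section

namespace Borromean

open groupCohomology
open scoped Matrix commutatorElement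

/-! ### The Borromean rings group -/

/-- The two relators `[x, [y⁻¹, z]]` and `[y, [z⁻¹, x]]` in the free group on `x = of 0`, `y = of 1`,
`z = of 2`, where `⁅a, b⁆ = a * b * a⁻¹ * b⁻¹`. -/
def relators : Set (FreeGroup (Fin 3)) :=
  {⁅(FreeGroup.of 0 : FreeGroup (Fin 3)), ⁅(FreeGroup.of 1 : FreeGroup (Fin 3))⁻¹, FreeGroup.of 2⁆⁆,
   ⁅(FreeGroup.of 1 : FreeGroup (Fin 3)), ⁅(FreeGroup.of 2 : FreeGroup (Fin 3))⁻¹, FreeGroup.of 0⁆⁆}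

/-- The Borromean rings group `π₁(S³ ∖ 6³₂) = ⟨x, y, z | [x, [y⁻¹, z]] = [y, [z⁻¹, x]] = 1⟩`;
`x`, `y`, `z` are meridians of the three components. -/
abbrev Γ : Type := PresentedGroup relators

/-- The meridian `x`. -/
def x : Γ := PresentedGroup.of 0

/-- The meridian `y`. -/
def y : Γ := PresentedGroup.of 1

/-- The meridian `z`. -/
def z : Γ := PresentedGroup.of 2

/-! ### The holonomy representation into `SO(3,1) ⊂ SL₄(ℝ)` -/

/-- `SL₄(ℝ)`. -/
abbrev SL4 : Type := Matrix.SpecialLinearGroup (Fin 4) ℝ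

/-- The Lorentzian form `-x₀² + x₁² + x₂² + x₃²`. -/
def J : Matrix (Fin 4) (Fin 4) ℝ := Matrix.diagonal ![-1, 1, 1, 1]

/-- `SO(3,1)`, the elements of `SL₄(ℝ)` that preserve the form `J`. -/
def SO31 : Subgroup SL4 where
  carrier := {A | (A : Matrix (Fin 4) (Fin 4) ℝ)ᵀ * J * (A : Matrix (Fin 4) (Fin 4) ℝ) = J}
  one_mem' := by simp
  mul_mem' := by
    intro A B hA hB
    simp only [Set.mem_ofPred_eq, Matrix.SpecialLinearGroup.coe_mul, Matrix.transpose_mul] at *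
    calc _ = (B : Matrix (Fin 4) (Fin 4) ℝ)ᵀ *
          ((A : Matrix (Fin 4) (Fin 4) ℝ)ᵀ * J * (A : Matrix (Fin 4) (Fin 4) ℝ)) *
          (B : Matrix (Fin 4) (Fin 4) ℝ) := by simp only [Matrix.mul_assoc]
      _ = J := by rw [hA, hB]
  inv_mem' := by
    intro A hA
    simp only [Set.mem_ofPred_eq] at *
    have h1 : (A : Matrix (Fin 4) (Fin 4) ℝ) * ((A⁻¹ : SL4) : Matrix (Fin 4) (Fin 4) ℝ) = 1 := by
      rw [← Matrix.SpecialLinearGroup.coe_mul, mul_inv_cancel, Matrix.SpecialLinearGroup.coe_one]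
    have h2 : ((A⁻¹ : SL4) : Matrix (Fin 4) (Fin 4) ℝ)ᵀ * (A : Matrix (Fin 4) (Fin 4) ℝ)ᵀ = 1 := by
      rw [← Matrix.transpose_mul, h1, Matrix.transpose_one]
    conv_lhs => rw [← hA]
    calc _ = (((A⁻¹ : SL4) : Matrix (Fin 4) (Fin 4) ℝ)ᵀ * (A : Matrix (Fin 4) (Fin 4) ℝ)ᵀ) * J *
          ((A : Matrix (Fin 4) (Fin 4) ℝ) * ((A⁻¹ : SL4) : Matrix (Fin 4) (Fin 4) ℝ)) := by
            simp only [Matrix.mul_assoc]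
      _ = J := by rw [h1, h2, Matrix.one_mul, Matrix.mul_one]

/-- The matrices of `x`, `y`, `z`, with integer entries. -/
def genMatrix : Fin 3 → Matrix (Fin 4) (Fin 4) ℤ :=
  ![!![3, 0, 2, 2; 0, 1, 0, 0; -2, 0, -1, -2; 2, 0, 2, 1],
    !![3, 2, 0, -2; 2, 1, 0, -2; 0, 0, 1, 0; 2, 2, 0, -1],
    !![3, -2, -2, 0; 2, -1, -2, 0; -2, 2, 1, 0; 0, 0, 0, 1]]

lemma det_genMatrix (i : Fin 3) : (genMatrix i).det = 1 := by
  revert i; decide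

/-- The matrices of `x`, `y`, `z` as elements of `SL₄(ℤ)`. -/
def genInt (i : Fin 3) : Matrix.SpecialLinearGroup (Fin 4) ℤ := ⟨genMatrix i, det_genMatrix i⟩

/-- The matrices of `x`, `y`, `z` as elements of `SL₄(ℝ)`. -/
def genReal (i : Fin 3) : SL4 :=
  Matrix.SpecialLinearGroup.map (Int.castRingHom ℝ) (genInt i)

lemma genMatrix_preserves (i : Fin 3) :
    (genMatrix i)ᵀ * Matrix.diagonal ![-1, 1, 1, 1] * genMatrix i =
      Matrix.diagonal ![-1, 1, 1, 1] := by
  revert i; decide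

lemma genReal_mem (i : Fin 3) : genReal i ∈ SO31 := by
  change ((genReal i : SL4) : Matrix (Fin 4) (Fin 4) ℝ)ᵀ * J *
    ((genReal i : SL4) : Matrix (Fin 4) (Fin 4) ℝ) = J
  have hJ : J = (Matrix.diagonal ![-1, 1, 1, 1] : Matrix (Fin 4) (Fin 4) ℤ).map
      (Int.castRingHom ℝ) := by
    ext a b; fin_cases a <;> fin_cases b <;> simp [J]
  have hg : ((genReal i : SL4) : Matrix (Fin 4) (Fin 4) ℝ) =
      (genMatrix i).map (Int.castRingHom ℝ) := rfl
  rw [hJ, hg, ← Matrix.transpose_map, ← Matrix.map_mul, ← Matrix.map_mul, genMatrix_preserves]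

/-- The matrices of `x`, `y`, `z` as elements of `SO(3,1)`. -/
def gen (i : Fin 3) : SO31 := ⟨genReal i, genReal_mem i⟩

lemma genInt_inv (i : Fin 3) :
    (((genInt i)⁻¹ : Matrix.SpecialLinearGroup (Fin 4) ℤ) : Matrix (Fin 4) (Fin 4) ℤ) =
      Matrix.diagonal ![-1, 1, 1, 1] * (genMatrix i)ᵀ * Matrix.diagonal ![-1, 1, 1, 1] := by
  have h1 : Matrix.diagonal ![-1, 1, 1, 1] * (genMatrix i)ᵀ * Matrix.diagonal ![-1, 1, 1, 1] *
      genMatrix i = 1 := by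
    revert i; decide
  have h2 : genMatrix i *
      (((genInt i)⁻¹ : Matrix.SpecialLinearGroup (Fin 4) ℤ) : Matrix (Fin 4) (Fin 4) ℤ) = 1 := by
    change ((genInt i : Matrix.SpecialLinearGroup (Fin 4) ℤ) : Matrix (Fin 4) (Fin 4) ℤ) * _ = 1
    rw [← Matrix.SpecialLinearGroup.coe_mul, mul_inv_cancel, Matrix.SpecialLinearGroup.coe_one]
  exact (left_inv_eq_right_inv h1 h2).symm

lemma genInt_relators :
    ⁅genInt 0, ⁅(genInt 1)⁻¹, genInt 2⁆⁆ = 1 ∧ ⁅genInt 1, ⁅(genInt 2)⁻¹, genInt 0⁆⁆ = 1 := by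
  have hc : ∀ i : Fin 3, ((genInt i : Matrix.SpecialLinearGroup (Fin 4) ℤ) :
      Matrix (Fin 4) (Fin 4) ℤ) = genMatrix i := fun _ => rfl
  constructor
  all_goals
    rw [commutatorElement_eq_one_iff_mul_comm, commutatorElement_def, inv_inv]
    apply Subtype.ext
    simp only [Matrix.SpecialLinearGroup.coe_mul, genInt_inv, hc]
    decide

lemma gen_relators : ∀ r ∈ relators, FreeGroup.lift gen r = 1 := by
  have aux : ∀ r : FreeGroup (Fin 3), FreeGroup.lift genInt r = 1 → FreeGroup.lift gen r = 1 := by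
    intro r hr
    have h : SO31.subtype.comp (FreeGroup.lift gen) =
        (Matrix.SpecialLinearGroup.map (Int.castRingHom ℝ)).comp (FreeGroup.lift genInt) := by
      ext1 i
      simp [gen, genReal]
    have h2 := DFunLike.congr_fun h r
    simp only [MonoidHom.comp_apply, hr, map_one] at h2
    exact Subtype.ext h2
  intro r hr
  apply aux
  rcases hr with rfl | rfl
  · simpa only [map_commutatorElement, map_inv, FreeGroup.lift_apply_of] using genInt_relators.1
  · simpa only [map_commutatorElement, map_inv, FreeGroup.lift_apply_of] using genInt_relators.2

/-- The holonomy representation `Γ → SO(3,1)` of the complete hyperbolic structure. -/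
def holonomy : Γ →* SO31 := PresentedGroup.toGroup gen_relators

/-- The holonomy representation, regarded as a representation into `SL₄(ℝ)`. -/
def ρ : Γ →* SL4 := SO31.subtype.comp holonomy

/-- The matrix of `γ` under the holonomy representation. -/
abbrev mat (γ : Γ) : Matrix (Fin 4) (Fin 4) ℝ := (ρ γ : SL4)

/-- `γ` is parabolic: its holonomy is a nontrivial unipotent element (in `SO⁺(3,1)`, the
orientation-preserving isometries of hyperbolic space, these are exactly the parabolic isometries). -/
def IsParabolic (γ : Γ) : Prop := ρ γ ≠ 1 ∧ IsNilpotent (mat γ - 1)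

/-! ### The coefficient module `ν₄` and its first cohomology -/

/-- The complement `ν₄` of `𝔰𝔬(3,1)` in `𝔰𝔩₄(ℝ)`: the trace-free `V` that are self-adjoint for the
Lorentzian form, `Vᵀ J = J V`. -/
def nu4 : Submodule ℝ (Matrix (Fin 4) (Fin 4) ℝ) where
  carrier := {V | V.trace = 0 ∧ Vᵀ * J = J * V}
  add_mem' := by
    rintro V W ⟨h1, h2⟩ ⟨h3, h4⟩
    exact ⟨by rw [Matrix.trace_add, h1, h3, add_zero],
      by rw [Matrix.transpose_add, Matrix.add_mul, Matrix.mul_add, h2, h4]⟩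
  zero_mem' := by simp
  smul_mem' := by
    rintro c V ⟨h1, h2⟩
    exact ⟨by rw [Matrix.trace_smul, h1, smul_zero],
      by rw [Matrix.transpose_smul, Matrix.smul_mul, Matrix.mul_smul, h2]⟩

lemma conj_mem_nu4 (A : SO31) {V : Matrix (Fin 4) (Fin 4) ℝ} (hV : V ∈ nu4) :
    ((A : SL4) : Matrix (Fin 4) (Fin 4) ℝ) * V * (((A : SL4)⁻¹ : SL4) : Matrix (Fin 4) (Fin 4) ℝ)
      ∈ nu4 := by
  obtain ⟨A, hA⟩ := A
  obtain ⟨h1, h2⟩ := hV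
  change (A : Matrix (Fin 4) (Fin 4) ℝ)ᵀ * J * (A : Matrix (Fin 4) (Fin 4) ℝ) = J at hA
  set a : Matrix (Fin 4) (Fin 4) ℝ := (A : Matrix (Fin 4) (Fin 4) ℝ) with ha
  set b : Matrix (Fin 4) (Fin 4) ℝ := ((A⁻¹ : SL4) : Matrix (Fin 4) (Fin 4) ℝ) with hb
  have hab : a * b = 1 := by
    rw [ha, hb, ← Matrix.SpecialLinearGroup.coe_mul, mul_inv_cancel,
      Matrix.SpecialLinearGroup.coe_one]
  have hba : b * a = 1 := by
    rw [ha, hb, ← Matrix.SpecialLinearGroup.coe_mul, inv_mul_cancel,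
      Matrix.SpecialLinearGroup.coe_one]
  have hbT : bᵀ * aᵀ = 1 := by rw [← Matrix.transpose_mul, hab, Matrix.transpose_one]
  have e1 : aᵀ * J = J * b := by
    calc aᵀ * J = aᵀ * J * (a * b) := by rw [hab, Matrix.mul_one]
      _ = (aᵀ * J * a) * b := by simp only [Matrix.mul_assoc]
      _ = J * b := by rw [hA]
  have e2 : bᵀ * J = J * a := by
    calc bᵀ * J = bᵀ * (aᵀ * J * a) := by rw [hA]
      _ = (bᵀ * aᵀ) * (J * a) := by simp only [Matrix.mul_assoc]
      _ = J * a := by rw [hbT, Matrix.one_mul]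
  refine ⟨?_, ?_⟩
  · rw [Matrix.trace_mul_comm, ← Matrix.mul_assoc, hba, Matrix.one_mul, h1]
  · calc (a * V * b)ᵀ * J = bᵀ * (Vᵀ * (aᵀ * J)) := by
          simp only [Matrix.transpose_mul, Matrix.mul_assoc]
      _ = bᵀ * ((Vᵀ * J) * b) := by rw [e1, Matrix.mul_assoc]
      _ = (bᵀ * J) * (V * b) := by rw [h2]; simp only [Matrix.mul_assoc]
      _ = J * (a * V * b) := by rw [e2]; simp only [Matrix.mul_assoc]

/-- The adjoint action `V ↦ A V A⁻¹` of `SO(3,1)` on `ν₄`. -/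
def Ad : Representation ℝ SO31 nu4 where
  toFun A :=
    { toFun := fun V => ⟨_, conj_mem_nu4 A V.2⟩
      map_add' := fun V W => Subtype.ext (by simp [Matrix.mul_add, Matrix.add_mul])
      map_smul' := fun c V => Subtype.ext (by simp) }
  map_one' := by
    ext1 V
    exact Subtype.ext (by simp)
  map_mul' A B := by
    ext1 V
    refine Subtype.ext ?_
    change ((A * B : SL4) : Matrix (Fin 4) (Fin 4) ℝ) * (V : Matrix (Fin 4) (Fin 4) ℝ) *
      (((A * B : SL4)⁻¹ : SL4) : Matrix (Fin 4) (Fin 4) ℝ) =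
      ((A : SL4) : Matrix (Fin 4) (Fin 4) ℝ) *
        (((B : SL4) : Matrix (Fin 4) (Fin 4) ℝ) * (V : Matrix (Fin 4) (Fin 4) ℝ) *
          (((B : SL4)⁻¹ : SL4) : Matrix (Fin 4) (Fin 4) ℝ)) *
        (((A : SL4)⁻¹ : SL4) : Matrix (Fin 4) (Fin 4) ℝ)
    rw [mul_inv_rev, Matrix.SpecialLinearGroup.coe_mul, Matrix.SpecialLinearGroup.coe_mul]
    simp only [Matrix.mul_assoc]

/-- `ν₄` as a `Γ`-module, through the adjoint action and the holonomy representation. -/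
abbrev coeff : Rep ℝ Γ := Rep.of (Ad.comp holonomy)

/-- The parabolic cocycles `PZ¹(Γ, ν₄)`: those `c` with `c(γ) ∈ im(1 - Ad γ)` for every parabolic
`γ`. -/
def PZ1 : Submodule ℝ (cocycles₁ coeff) where
  carrier := {c | ∀ γ : Γ, IsParabolic γ → c γ ∈ LinearMap.range (LinearMap.id - coeff.ρ γ)}
  add_mem' := fun ha hb γ hγ => Submodule.add_mem _ (ha γ hγ) (hb γ hγ)
  zero_mem' := fun _ _ => Submodule.zero_mem _
  smul_mem' := fun r _ ha γ hγ => Submodule.smul_mem _ r (ha γ hγ)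

/-- The parabolic cohomology `PH¹(Γ, ν₄) = PZ¹(Γ, ν₄) / B¹(Γ, ν₄)`, as the image of `PZ¹(Γ, ν₄)` in
`H¹(Γ, ν₄)`. -/
def PH1 : Submodule ℝ (H1 coeff) := PZ1.map (H1π coeff).hom

/-! ### Bending -/

/-- `G` is the HNN extension of its subgroup `A` with stable letter `α`, where `α` conjugates
`α⁻¹ H α ≤ A` to `H ≤ A`. -/
def IsHNNSplitting {G : Type} [Group G] (A H : Subgroup G) (α : G) : Prop :=
  ∃ (K₁ K₂ : Subgroup A) (φ : K₁ ≃* K₂) (e : HNNExtension A K₁ K₂ φ ≃* G),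
    K₂.map A.subtype = H ∧ (∀ a : A, e (HNNExtension.of a) = a) ∧ e HNNExtension.t = α

/-- `H` is, through the holonomy, the group of a totally geodesic thrice-punctured sphere: it
stabilizes a hyperbolic plane together with its sides (it fixes a spacelike vector), and it is
generated by two noncommuting parabolic elements whose product is parabolic too. -/
def IsThricePuncturedSphereGroup (H : Subgroup Γ) : Prop :=
  (∃ n : Fin 4 → ℝ, 0 < n ⬝ᵥ (J *ᵥ n) ∧ ∀ h ∈ H, mat h *ᵥ n = n) ∧
  ∃ p q : Γ, H = Subgroup.closure {p, q} ∧ ρ p * ρ q ≠ ρ q * ρ p ∧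
    IsParabolic p ∧ IsParabolic q ∧ IsParabolic (p * q)

/-- `r` is the projective bending of the holonomy along a nonseparating surface with group `H`, for
the splitting of `Γ` as an HNN extension of `A` with stable letter `α`: there is a one-parameter
group `c(t)`, conjugate in `GL₄(ℝ)` to `diag(e⁻³ᵗ, eᵗ, eᵗ, eᵗ)` and centralizing the image of `H`,
such that `r t` agrees with the holonomy on `A` and sends `α` to `c(t) ρ(α)`. -/
def IsBending (A H : Subgroup Γ) (α : Γ) (r : ℝ → Γ →* SL4) : Prop :=
  ∃ c : ℝ → SL4,
    (∃ P : (Matrix (Fin 4) (Fin 4) ℝ)ˣ, ∀ t : ℝ,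
      ((c t : SL4) : Matrix (Fin 4) (Fin 4) ℝ) =
        (P : Matrix (Fin 4) (Fin 4) ℝ) *
          Matrix.diagonal ![Real.exp (-3 * t), Real.exp t, Real.exp t, Real.exp t] *
          ((P⁻¹ : (Matrix (Fin 4) (Fin 4) ℝ)ˣ) : Matrix (Fin 4) (Fin 4) ℝ)) ∧
    (∀ t : ℝ, ∀ h ∈ H, c t * ρ h = ρ h * c t) ∧
    (∀ t : ℝ, ∀ a ∈ A, r t a = ρ a) ∧
    (∀ t : ℝ, r t α = c t * ρ α)

/-- `ξ` is the cocycle tangent to the path `r` of representations at `t = 0`: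
`ξ(γ) = (d/dt r_t(γ)) ρ(γ)⁻¹`. -/
def IsTangentCocycle (r : ℝ → Γ →* SL4) (ξ : cocycles₁ coeff) : Prop :=
  ∀ (γ : Γ) (i j : Fin 4),
    HasDerivAt (fun t : ℝ => ((r t γ : SL4) : Matrix (Fin 4) (Fin 4) ℝ) i j)
      ((((ξ γ : nu4) : Matrix (Fin 4) (Fin 4) ℝ) * mat γ) i j) 0

/-! ### The six thrice-punctured spheres

They are listed in the order `(R,G)`, `(R,B)`, `(B,R)`, `(B,G)`, `(G,R)`, `(G,B)`; the first letter is
the cusp of the waistband and the second the cusp of the two cuffs. -/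

/-- The stable letters. -/
def stableLetter : Fin 6 → Γ := ![x, x, y, y, z, z]

/-- The fundamental groups of the six spheres, each conjugated (where necessary) to the side of the
sphere on which `α⁻¹ H α` and `H` are glued by the stable letter `α`. -/
def sphereGroup : Fin 6 → Subgroup Γ :=
  ![Subgroup.closure {x * (y⁻¹ * z * y) * x⁻¹, x * z⁻¹ * x⁻¹},
    Subgroup.closure {y⁻¹, z * y * z⁻¹},
    Subgroup.closure {y * (z⁻¹ * x * z) * y⁻¹, y * x⁻¹ * y⁻¹},
    Subgroup.closure {z⁻¹, x * z * x⁻¹},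
    Subgroup.closure {x⁻¹, y * x * y⁻¹},
    Subgroup.closure {z * (x⁻¹ * y * x) * z⁻¹, z * y⁻¹ * z⁻¹}]

/-- The fundamental groups of the complements of the six spheres: generated by the two meridians other
than the stable letter `α` and by the groups `H` and `α⁻¹ H α` of the two sides of the sphere. -/
def baseGroup (j : Fin 6) : Subgroup Γ :=
  (![Subgroup.closure {y, z}, Subgroup.closure {y, z}, Subgroup.closure {z, x},
    Subgroup.closure {z, x}, Subgroup.closure {x, y}, Subgroup.closure {x, y}] : Fin 6 → Subgroup Γ) j
  ⊔ sphereGroup j ⊔ (sphereGroup j).map (MulAut.conj (stableLetter j)⁻¹).toMonoidHom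

/-- Six elements of `Γ` whose traces are differentiated. -/
def testWord : Fin 6 → Γ :=
  ![x⁻¹ * y, x * z, y * z, x * y * z, y * z * x⁻¹, z * x * y⁻¹]

end Borromean

end

noncomputable section

namespace Borromean

open groupCohomology
open scoped Matrix commutatorElement

/-! ### The integral holonomy -/

/-! All matrices of generators, planes and tangent vectors involved are integral, so the numerical
facts are finite computations over `ℤ`; the arguments below reduce the theorem to them.

Splittings. Up to conjugacy each relator can be written so that the stable letter `α` occurs only
inside generators of `H` or of `α⁻¹Hα`. It is then a relation of `A` combined with the HNN
relations, so `Γ` has the universal property of the HNN extension (`hasHNNProperty`), and no normal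
form is needed. The same property with target `SL₄(ℝ)` produces the bendings, because `c(t)`
commutes with `ρ(H)`.

Dimension of `H¹`. Derivatives of traces vanish on principal cocycles, and the six of them have a
nonsingular matrix on the six tangent cocycles, so the classes are independent. Conversely a cocycle
is given by 27 numbers, nine coordinates for each of its values on `x`, `y`, `z`. Fox calculus on
the relators yields 12 linear relations, the traces give 6 functionals, and 9 more can be cancelled
by a principal cocycle. `coordinate_identity` certifies that these 12 + 6 + 9 functionals determine
the cocycle, whence `H1π_eq_zero_of_traceDeriv`.

Parabolic classes, upper bound. A parabolic cocycle has zero diagonal entry, on each generator, at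
the space axis fixed by that generator. The two bendings with this stable letter have entry 1 there
and the other four have 0, so the coefficients in a pair are opposite (`span_bendDifference`).

Parabolic classes, lower bound. The condition concerns every parabolic element, and the parabolics
are not classified. Instead each difference is identified, up to a factor 4 and a principal cocycle,
with a crossing cocycle (`crossing_eq`): the sum of the infinitesimal bendings along all integral
planes separating the base point from its image, with a `Γ`-invariant weight that depends on the
unit normal modulo 4. Let the parabolic `γ` fix the primitive null vector `v`. Planes that miss the
ideal point `v` contribute an element of `im(1 - Ad γ)`. For planes through it, a translation `n ↦ n
+ d v` of the normals reverses the weight but preserves the pairing with `γ`-invariants, so their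
sum is orthogonal to the invariants, that is, again in the image (`crossing_mem_PZ1`). -/

lemma genInt_lift_relators : ∀ r ∈ relators, FreeGroup.lift genInt r = 1 := by
  rintro r (rfl | rfl)
  · simpa only [map_commutatorElement, map_inv, FreeGroup.lift_apply_of] using genInt_relators.1
  · simpa only [map_commutatorElement, map_inv, FreeGroup.lift_apply_of] using genInt_relators.2

/-- The holonomy with values in `SL₄(ℤ)`. -/
def intHolonomy : Γ →* Matrix.SpecialLinearGroup (Fin 4) ℤ :=
  PresentedGroup.toGroup genInt_lift_relators

/-- The integer matrix of `γ` under the holonomy. -/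
def intMat (γ : Γ) : Matrix (Fin 4) (Fin 4) ℤ := (intHolonomy γ).1

lemma intMat_mul (g h : Γ) : intMat (g * h) = intMat g * intMat h := by
  simp [intMat]

lemma intMat_one : intMat 1 = 1 := by simp [intMat]

lemma ρ_eq_map (γ : Γ) :
    ρ γ = Matrix.SpecialLinearGroup.map (Int.castRingHom ℝ) (intHolonomy γ) := by
  have h : ρ = (Matrix.SpecialLinearGroup.map (Int.castRingHom ℝ)).comp intHolonomy := by
    refine PresentedGroup.ext fun i => ?_
    simp [ρ, holonomy, intHolonomy, gen, genReal]
  rw [h]; rfl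

lemma mat_eq_map (γ : Γ) : mat γ = (intMat γ).map (Int.cast : ℤ → ℝ) := by
  rw [mat, ρ_eq_map]; rfl

lemma mat_mul (g h : Γ) : mat (g * h) = mat g * mat h := by simp [mat]

lemma mat_one : mat 1 = 1 := by simp [mat]

lemma mat_mul_mat_inv (γ : Γ) : mat γ * mat γ⁻¹ = 1 := by
  rw [← mat_mul, mul_inv_cancel, mat_one]

lemma mat_inv_mul_mat (γ : Γ) : mat γ⁻¹ * mat γ = 1 := by
  rw [← mat_mul, inv_mul_cancel, mat_one]

lemma coe_ρ_inv (γ : Γ) : (((ρ γ)⁻¹ : SL4) : Matrix (Fin 4) (Fin 4) ℝ) = mat γ⁻¹ := by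
  simp only [mat, map_inv]

lemma intMat_gen (i : Fin 3) : intMat (PresentedGroup.of i) = genMatrix i := by
  simp [intMat, intHolonomy, genInt]

lemma intMat_gen_inv (i : Fin 3) : intMat (PresentedGroup.of i)⁻¹ =
    Matrix.diagonal ![-1, 1, 1, 1] * (genMatrix i)ᵀ * Matrix.diagonal ![-1, 1, 1, 1] := by
  rw [← genInt_inv]
  simp [intMat, intHolonomy]

lemma intMat_x : intMat x = !![3, 0, 2, 2; 0, 1, 0, 0; -2, 0, -1, -2; 2, 0, 2, 1] := intMat_gen 0

lemma intMat_y : intMat y = !![3, 2, 0, -2; 2, 1, 0, -2; 0, 0, 1, 0; 2, 2, 0, -1] := intMat_gen 1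

lemma intMat_z : intMat z = !![3, -2, -2, 0; 2, -1, -2, 0; -2, 2, 1, 0; 0, 0, 0, 1] := intMat_gen 2

lemma intMat_x_inv :
    intMat x⁻¹ = !![3, 0, 2, -2; 0, 1, 0, 0; -2, 0, -1, 2; -2, 0, -2, 1] := by
  rw [x, intMat_gen_inv]; decide

lemma intMat_y_inv :
    intMat y⁻¹ = !![3, -2, 0, -2; -2, 1, 0, 2; 0, 0, 1, 0; 2, -2, 0, -1] := by
  rw [y, intMat_gen_inv]; decide

lemma intMat_z_inv :
    intMat z⁻¹ = !![3, -2, 2, 0; 2, -1, 2, 0; 2, -2, 1, 0; 0, 0, 0, 1] := by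
  rw [z, intMat_gen_inv]; decide

lemma mat_preserves (γ : Γ) : (mat γ)ᵀ * J * mat γ = J := (holonomy γ).2

lemma J_mul_J : J * J = 1 := by
  rw [J, Matrix.diagonal_mul_diagonal, ← Matrix.diagonal_one]
  congr 1; ext i; fin_cases i <;> norm_num

lemma J_transpose : Jᵀ = J := Matrix.diagonal_transpose _

lemma mat_transpose_mul_J (γ : Γ) : (mat γ)ᵀ * J = J * mat γ⁻¹ := by
  calc (mat γ)ᵀ * J = (mat γ)ᵀ * J * (mat γ * mat γ⁻¹) := by rw [mat_mul_mat_inv, Matrix.mul_one]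
    _ = ((mat γ)ᵀ * J * mat γ) * mat γ⁻¹ := by simp only [Matrix.mul_assoc]
    _ = J * mat γ⁻¹ := by rw [mat_preserves]

/-- Induction over words in the generators and their inverses. -/
lemma induction_generators {p : Γ → Prop} (one : p 1) (mul : ∀ g h, p g → p h → p (g * h))
    (gen : ∀ i, p (PresentedGroup.of i)) (inv : ∀ i, p (PresentedGroup.of i)⁻¹) (γ : Γ) : p γ := by
  induction γ using PresentedGroup.induction_on with
  | _ w =>
    induction w using FreeGroup.induction_on with
    | C1 => exact one
    | of i => exact gen i
    | inv_of i _ => exact inv i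
    | mul u v hu hv => rw [map_mul]; exact mul _ _ hu hv

/-! ### Cocycles with values in `ν₄` -/

/-- The matrix value of a cocycle. -/
def val (c : cocycles₁ coeff) (γ : Γ) : Matrix (Fin 4) (Fin 4) ℝ := ((c γ : nu4) : _)

lemma val_mem (c : cocycles₁ coeff) (γ : Γ) : val c γ ∈ nu4 := (c γ : nu4).2

lemma coe_coeff_ρ (γ : Γ) (V : nu4) :
    ((coeff.ρ γ V : nu4) : Matrix (Fin 4) (Fin 4) ℝ) = mat γ * V * mat γ⁻¹ := by
  rw [← coe_ρ_inv]; rfl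

lemma val_mul (c : cocycles₁ coeff) (g h : Γ) :
    val c (g * h) = val c g + mat g * val c h * mat g⁻¹ := by
  have h1 := (mem_cocycles₁_iff (A := coeff) c).1 c.2 g h
  have h2 := congrArg (fun V : nu4 => (V : Matrix (Fin 4) (Fin 4) ℝ)) h1
  refine h2.trans ?_
  rw [add_comm]
  change val c g + ((coeff.ρ g (c h) : nu4) : Matrix _ _ ℝ) = _
  rw [coe_coeff_ρ]; rfl

lemma val_one (c : cocycles₁ coeff) : val c 1 = 0 := by
  have h := val_mul c 1 1
  rw [mul_one, inv_one, mat_one, Matrix.one_mul, Matrix.mul_one] at h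
  simpa using h

/-- A map `Γ → ν₄` satisfying the cocycle identity. -/
def mkCocycle (f : Γ → nu4) (hf : ∀ g h, ((f (g * h) : nu4) : Matrix (Fin 4) (Fin 4) ℝ) =
    f g + mat g * (f h : Matrix (Fin 4) (Fin 4) ℝ) * mat g⁻¹) : cocycles₁ coeff :=
  ⟨f, (mem_cocycles₁_iff (A := coeff) f).2 fun g h => Subtype.ext <| by
    rw [hf, add_comm, ← coe_coeff_ρ g (f h)]; rfl⟩

lemma val_mkCocycle (f : Γ → nu4) (hf) (γ : Γ) : val (mkCocycle f hf) γ = f γ := rfl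

lemma val_add (c d : cocycles₁ coeff) (γ : Γ) : val (c + d) γ = val c γ + val d γ := rfl

lemma val_sub (c d : cocycles₁ coeff) (γ : Γ) : val (c - d) γ = val c γ - val d γ := rfl

lemma val_smul (a : ℝ) (c : cocycles₁ coeff) (γ : Γ) : val (a • c) γ = a • val c γ := rfl

lemma val_inv (c : cocycles₁ coeff) (γ : Γ) :
    val c γ⁻¹ = -(mat γ⁻¹ * val c γ * mat γ) := by
  have h := val_mul c γ⁻¹ γ
  rw [inv_mul_cancel, val_one, inv_inv] at h
  exact eq_neg_of_add_eq_zero_left h.symm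

lemma val_ext_generators {c d : cocycles₁ coeff} (h : ∀ i, val c (PresentedGroup.of i) =
    val d (PresentedGroup.of i)) (γ : Γ) : val c γ = val d γ := by
  induction γ using induction_generators with
  | one => rw [val_one, val_one]
  | mul g h hg hh => rw [val_mul, val_mul, hg, hh]
  | gen i => exact h i
  | inv i => rw [val_inv, val_inv, h]

/-- The principal cocycle `γ ↦ V - Ad γ V`. -/
def principal (V : nu4) : cocycles₁ coeff :=
  mkCocycle (fun γ => V - coeff.ρ γ V) fun g h => by
    rw [map_mul]
    change (V : Matrix (Fin 4) (Fin 4) ℝ) - ((coeff.ρ g (coeff.ρ h V) : nu4) : Matrix _ _ ℝ) =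
      ((V : Matrix (Fin 4) (Fin 4) ℝ) - ((coeff.ρ g V : nu4) : Matrix _ _ ℝ)) +
      mat g * ((V : Matrix (Fin 4) (Fin 4) ℝ) - ((coeff.ρ h V : nu4) : Matrix _ _ ℝ)) * mat g⁻¹
    rw [coe_coeff_ρ, coe_coeff_ρ g V, Matrix.mul_sub, Matrix.sub_mul]
    abel

lemma val_principal (V : nu4) (γ : Γ) :
    val (principal V) γ = (V : Matrix (Fin 4) (Fin 4) ℝ) - mat γ * V * mat γ⁻¹ := by
  rw [← coe_coeff_ρ]; rfl

lemma H1π_principal (V : nu4) : H1π coeff (principal V) = 0 := by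
  rw [H1π_eq_zero_iff]
  -- The coboundary of `V` is `γ ↦ Ad γ V - V`, opposite in sign to `principal V`.
  refine ⟨-V, ?_⟩
  ext γ : 1
  change coeff.ρ γ (-V) - (-V) = (V : nu4) - coeff.ρ γ V
  rw [map_neg]; abel

lemma exists_principal_of_H1π_eq_zero {c : cocycles₁ coeff} (h : H1π coeff c = 0) :
    ∃ V : nu4, ∀ γ, val c γ = val (principal V) γ := by
  rw [H1π_eq_zero_iff] at h
  obtain ⟨V, hV⟩ := h
  refine ⟨-V, fun γ => ?_⟩
  have h1 : (coeff.ρ γ V - V : nu4) = c γ := congrFun hV γ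
  rw [val, ← h1, val_principal]
  change ((coeff.ρ γ V : nu4) : Matrix _ _ ℝ) - (V : Matrix _ _ ℝ) =
    (-(V : Matrix _ _ ℝ)) - mat γ * (-(V : Matrix _ _ ℝ)) * mat γ⁻¹
  rw [coe_coeff_ρ, Matrix.mul_neg, Matrix.neg_mul]; abel

lemma ext_generators {c d : cocycles₁ coeff} (h : ∀ i, val c (PresentedGroup.of i) =
    val d (PresentedGroup.of i)) : c = d :=
  cocycles₁_ext fun γ => Subtype.ext (val_ext_generators h γ)

/-! ### The splittings of `Γ` as an HNN extension -/

/-- The defining relations hold in `Γ`. -/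
lemma relation_one : ⁅x, ⁅y⁻¹, z⁆⁆ = 1 := by
  have h := PresentedGroup.one_of_mem (rels := relators) (Or.inl rfl)
  rw [map_commutatorElement, map_commutatorElement, map_inv] at h
  exact h

lemma relation_two : ⁅y, ⁅z⁻¹, x⁆⁆ = 1 := by
  have h := PresentedGroup.one_of_mem (rels := relators) (Or.inr rfl)
  rw [map_commutatorElement, map_commutatorElement, map_inv] at h
  exact h

/-- The universal property of `Γ`. -/
lemma exists_hom {L : Type*} [Group L] (X Y Z : L) (h₁ : ⁅X, ⁅Y⁻¹, Z⁆⁆ = 1)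
    (h₂ : ⁅Y, ⁅Z⁻¹, X⁆⁆ = 1) : ∃ f : Γ →* L, f x = X ∧ f y = Y ∧ f z = Z := by
  have h : ∀ r ∈ relators, FreeGroup.lift ![X, Y, Z] r = 1 := by
    rintro r (rfl | rfl)
    · simpa [map_commutatorElement] using h₁
    · simpa [map_commutatorElement] using h₂
  exact ⟨PresentedGroup.toGroup h, by simp [x], by simp [y], by simp [z]⟩

/-- `Γ` has the universal property of the HNN extension of `A` with stable letter `α` that
conjugates `α⁻¹ H α` to `H`. -/
def HasHNNProperty (A H : Subgroup Γ) (α : Γ) : Prop :=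
  ∀ (L : Type) [Group L] (ι : A →* L) (t : L),
    (∀ a b : A, (a : Γ) ∈ H → α * b = a * α → t * ι b = ι a * t) →
    ∃ f : Γ →* L, f α = t ∧ ∀ a : A, f a = ι a

/-- The lift of the inclusion of `A` and the given `f` are mutually inverse, since each composite
fixes `A` and the stable letter; `hgen` says that this suffices on the side of `Γ`. -/
lemma exists_hnnExtension_mulEquiv {A : Subgroup Γ} {K₁ K₂ : Subgroup A} {φ : K₁ ≃* K₂} {α : Γ}
    (hφ : ∀ b, ((φ b : A) : Γ) = α * (b : A) * α⁻¹) (f : Γ →* HNNExtension A K₁ K₂ φ)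
    (hfα : f α = HNNExtension.t) (hfA : ∀ a : A, f a = HNNExtension.of a)
    (hgen : ∀ f : Γ →* Γ, f α = α → (∀ a : A, f a = a) → f = MonoidHom.id Γ) :
    ∃ e : HNNExtension A K₁ K₂ φ ≃* Γ, (∀ a : A, e (HNNExtension.of a) = a) ∧
      e HNNExtension.t = α := by
  let g : HNNExtension A K₁ K₂ φ →* Γ := HNNExtension.lift A.subtype α fun b => by
    rw [Subgroup.subtype_apply, Subgroup.subtype_apply, hφ]; group
  have hgt : g HNNExtension.t = α := HNNExtension.lift_t _ _ _
  have hga : ∀ a : A, g (HNNExtension.of a) = a := fun a => HNNExtension.lift_of _ _ _ a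
  refine ⟨MonoidHom.toMulEquiv g f ?_ ?_, hga, hgt⟩
  · refine HNNExtension.hom_ext (MonoidHom.ext fun a => ?_) ?_
    · simp only [MonoidHom.comp_apply, hga, hfA, MonoidHom.id_apply]
    · simp only [MonoidHom.comp_apply, hgt, hfα, MonoidHom.id_apply]
  · refine hgen _ ?_ fun a => ?_
    · rw [MonoidHom.comp_apply, hfα, hgt]
    · rw [MonoidHom.comp_apply, hfA, hga]

/-- A group with the universal property of an HNN extension splits as an HNN extension. -/
lemma HasHNNProperty.isHNNSplitting {A H : Subgroup Γ} {α : Γ} (h : HasHNNProperty A H α)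
    (hH : H ≤ A) (hα : H.map (MulAut.conj α⁻¹).toMonoidHom ≤ A)
    (hgen : ∀ f : Γ →* Γ, f α = α → (∀ a : A, f a = a) → f = MonoidHom.id Γ) :
    IsHNNSplitting A H α := by
  have mem_conj : ∀ {a : Γ}, a ∈ H → α⁻¹ * a * α ∈ H.map (MulAut.conj α⁻¹).toMonoidHom :=
    fun {a} ha => ⟨a, ha, by simp⟩
  have conj_mem : ∀ {b : Γ}, b ∈ H.map (MulAut.conj α⁻¹).toMonoidHom → α * b * α⁻¹ ∈ H := by
    rintro _ ⟨a, ha, rfl⟩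
    simpa [mul_assoc] using ha
  let φ : ((H.map (MulAut.conj α⁻¹).toMonoidHom).subgroupOf A) ≃* (H.subgroupOf A) :=
    { toFun := fun b => ⟨⟨α * b.1.1 * α⁻¹, hH (conj_mem b.2)⟩, conj_mem b.2⟩
      invFun := fun a => ⟨⟨α⁻¹ * a.1.1 * α, hα (mem_conj a.2)⟩, mem_conj a.2⟩
      left_inv := fun b => Subtype.ext (Subtype.ext (by simp [mul_assoc]))
      right_inv := fun a => Subtype.ext (Subtype.ext (by simp [mul_assoc]))
      map_mul' := fun b c => Subtype.ext (Subtype.ext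
        (show α * (b.1.1 * c.1.1) * α⁻¹ = α * b.1.1 * α⁻¹ * (α * c.1.1 * α⁻¹) by group)) }
  have hφ : ∀ b, ((φ b : A) : Γ) = α * (b : A) * α⁻¹ := fun b => rfl
  -- The universal property is tested on the HNN extension itself, which gives the inverse map.
  obtain ⟨f, hfα, hfA⟩ := h (HNNExtension A _ _ φ) HNNExtension.of HNNExtension.t (by
    intro a b ha hab
    have hb : b = α⁻¹ * a * α := by rw [mul_assoc, ← hab]; group
    have hb' : b ∈ (H.map (MulAut.conj α⁻¹).toMonoidHom).subgroupOf A := by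
      rw [Subgroup.mem_subgroupOf, hb]; exact mem_conj ha
    have hab' : (φ ⟨b, hb'⟩ : A) = a := Subtype.ext (by rw [hφ]; simp [hab])
    rw [← hab']
    exact HNNExtension.t_mul_of ⟨b, hb'⟩)
  obtain ⟨e, he, het⟩ := exists_hnnExtension_mulEquiv hφ f hfα hfA hgen
  exact ⟨_, _, φ, e, by rw [Subgroup.subgroupOf_map_subtype, inf_eq_left.2 hH], he, het⟩

/-- The subgroup generated by `a`, `b`, the group `⟨p, q⟩` and its conjugate by `α⁻¹`. -/
def sideGroup (α a b p q : Γ) : Subgroup Γ :=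
  Subgroup.closure {a, b} ⊔ Subgroup.closure {p, q} ⊔
    (Subgroup.closure {p, q}).map (MulAut.conj α⁻¹).toMonoidHom

section sideGroup

variable (α a b p q : Γ)

lemma closure_le_sideGroup : Subgroup.closure {p, q} ≤ sideGroup α a b p q :=
  le_sup_right.trans le_sup_left

lemma map_conj_le_sideGroup : (Subgroup.closure {p, q}).map (MulAut.conj α⁻¹).toMonoidHom ≤
    sideGroup α a b p q := le_sup_right

lemma fst_mem_sideGroup : a ∈ sideGroup α a b p q :=
  le_sup_left (a := Subgroup.closure {a, b} ⊔ _) (le_sup_left (a := Subgroup.closure {a, b})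
    (Subgroup.subset_closure (by simp)))

lemma snd_mem_sideGroup : b ∈ sideGroup α a b p q :=
  le_sup_left (a := Subgroup.closure {a, b} ⊔ _) (le_sup_left (a := Subgroup.closure {a, b})
    (Subgroup.subset_closure (by simp)))

lemma left_mem_sideGroup : p ∈ sideGroup α a b p q :=
  closure_le_sideGroup α a b p q (Subgroup.subset_closure (by simp))

lemma right_mem_sideGroup : q ∈ sideGroup α a b p q :=
  closure_le_sideGroup α a b p q (Subgroup.subset_closure (by simp))

lemma conj_left_mem_sideGroup : α⁻¹ * p * α ∈ sideGroup α a b p q :=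
  map_conj_le_sideGroup α a b p q ⟨p, Subgroup.subset_closure (by simp), by simp⟩

lemma conj_right_mem_sideGroup : α⁻¹ * q * α ∈ sideGroup α a b p q :=
  map_conj_le_sideGroup α a b p q ⟨q, Subgroup.subset_closure (by simp), by simp⟩

variable {α a b p q}

/-- It is enough to check the universal property on generators. -/
lemma hasHNNProperty_sideGroup
    (h : ∀ (L : Type) [Group L] (ι : sideGroup α a b p q →* L) (t : L),
      ι ⟨p, left_mem_sideGroup α a b p q⟩ =
        t * ι ⟨α⁻¹ * p * α, conj_left_mem_sideGroup α a b p q⟩ * t⁻¹ →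
      ι ⟨q, right_mem_sideGroup α a b p q⟩ =
        t * ι ⟨α⁻¹ * q * α, conj_right_mem_sideGroup α a b p q⟩ * t⁻¹ →
      ∃ f : Γ →* L, f α = t ∧ f a = ι ⟨a, fst_mem_sideGroup α a b p q⟩ ∧
        f b = ι ⟨b, snd_mem_sideGroup α a b p q⟩ ∧ f p = ι ⟨p, left_mem_sideGroup α a b p q⟩ ∧
        f q = ι ⟨q, right_mem_sideGroup α a b p q⟩) :
    HasHNNProperty (sideGroup α a b p q) (Subgroup.closure {p, q}) α := by
  intro L _ ι t ht
  have hp : ι ⟨p, left_mem_sideGroup α a b p q⟩ =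
      t * ι ⟨α⁻¹ * p * α, conj_left_mem_sideGroup α a b p q⟩ * t⁻¹ := by
    rw [ht ⟨p, left_mem_sideGroup α a b p q⟩ _ (Subgroup.subset_closure (by simp)) (by group)]
    group
  have hq : ι ⟨q, right_mem_sideGroup α a b p q⟩ =
      t * ι ⟨α⁻¹ * q * α, conj_right_mem_sideGroup α a b p q⟩ * t⁻¹ := by
    rw [ht ⟨q, right_mem_sideGroup α a b p q⟩ _ (Subgroup.subset_closure (by simp)) (by group)]
    group
  obtain ⟨f, hα, ha, hb, hfp, hfq⟩ := h L ι t hp hq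
  refine ⟨f, hα, ?_⟩
  -- The part of `A` on which `f` and `ι` agree. It contains the conjugates `α⁻¹pα` and `α⁻¹qα`
  -- because `hp` and `hq` express `ι p` and `ι q` through them.
  let E : Subgroup Γ := ((f.comp (sideGroup α a b p q).subtype).eqLocus ι).map
    (sideGroup α a b p q).subtype
  have hE : ∀ {g : Γ} (hg : g ∈ sideGroup α a b p q), f g = ι ⟨g, hg⟩ → g ∈ E :=
    fun {g} hg h => ⟨⟨g, hg⟩, h, rfl⟩
  have hle : sideGroup α a b p q ≤ E := by
    refine sup_le (sup_le ?_ ?_) ?_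
    · rw [Subgroup.closure_le]
      rintro g (rfl | rfl)
      exacts [hE _ ha, hE _ hb]
    · rw [Subgroup.closure_le]
      rintro g (rfl | rfl)
      exacts [hE _ hfp, hE _ hfq]
    · rw [MonoidHom.map_closure, Subgroup.closure_le]
      rintro _ ⟨g, rfl | rfl, rfl⟩
      · have := hE (conj_left_mem_sideGroup α a b g q)
          (by rw [map_mul, map_mul, map_inv, hfp, hα, hp]; group)
        simpa using this
      · have := hE (conj_right_mem_sideGroup α a b p g)
          (by rw [map_mul, map_mul, map_inv, hfq, hα, hq]; group)
        simpa using this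
  rintro ⟨g, hg⟩
  obtain ⟨g', h1, h2⟩ := hle hg
  have : g' = ⟨g, hg⟩ := Subtype.ext h2
  rw [← this]; exact h1

end sideGroup

/-! ### The six splittings, by rewriting the relators -/

/-- Two words in a group vanish together if one is conjugate to the other. -/
lemma eq_one_iff_of_conj {G : Type*} [Group G] {r u v : G} (g : G) (h : g * r * g⁻¹ = u * v⁻¹) :
    r = 1 ↔ u = v := by
  rw [← conj_eq_one_iff (a := g), h, mul_inv_eq_one]

/-- Stated in an arbitrary group because it is used twice: in `Γ`, to read the relator as a relation
between elements of `A`, and in the target `L`, to recover the relator from the image of that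
relation. The same holds for the analogous equivalences of the other spheres. -/
lemma relator_one_iff_RG {G : Type*} [Group G] (X Y Z : G) : ⁅X, ⁅Y⁻¹, Z⁆⁆ = 1 ↔
    (X * (Y⁻¹ * Z * Y) * X⁻¹) * (X * Z⁻¹ * X⁻¹) = Y⁻¹ * Z * Y * Z⁻¹ :=
  eq_one_iff_of_conj (1) (by rw [commutatorElement_def, commutatorElement_def]; group)

lemma relator_two_iff_RG {G : Type*} [Group G] (X Y Z : G) : ⁅Y, ⁅Z⁻¹, X⁆⁆ = 1 ↔
    Y * (Z⁻¹ * (X * Z⁻¹ * X⁻¹)⁻¹) = Z⁻¹ * (X * Z⁻¹ * X⁻¹)⁻¹ * Y :=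
  eq_one_iff_of_conj (1) (by rw [commutatorElement_def, commutatorElement_def]; group)

/-- Here `α⁻¹Hα` already lies in `⟨y, z⟩`, so the additional elements of `A` are `p` and `q`. The
HNN relations replace `ι p` and `ι q` by `t`-conjugates of words in `ι y` and `ι z`, which turns the
two relations of `A` into the relators for `t`, `ι y`, `ι z`. `BR` and `GB` follow this pattern. -/
lemma hasHNNProperty_RG : HasHNNProperty (sideGroup x y z (x * (y⁻¹ * z * y) * x⁻¹) (x * z⁻¹ * x⁻¹))
    (Subgroup.closure {x * (y⁻¹ * z * y) * x⁻¹, x * z⁻¹ * x⁻¹}) x := by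
  refine hasHNNProperty_sideGroup fun L _ ι t hp hq => ?_
  set ya : sideGroup x y z (x * (y⁻¹ * z * y) * x⁻¹) (x * z⁻¹ * x⁻¹) := ⟨y, _⟩
  set za : sideGroup x y z (x * (y⁻¹ * z * y) * x⁻¹) (x * z⁻¹ * x⁻¹) := ⟨z, _⟩
  set pa : sideGroup x y z (x * (y⁻¹ * z * y) * x⁻¹) (x * z⁻¹ * x⁻¹) :=
      ⟨x * (y⁻¹ * z * y) * x⁻¹, left_mem_sideGroup _ _ _ _ _⟩ with hpa
  set qa : sideGroup x y z (x * (y⁻¹ * z * y) * x⁻¹) (x * z⁻¹ * x⁻¹) :=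
      ⟨x * z⁻¹ * x⁻¹, right_mem_sideGroup _ _ _ _ _⟩ with hqa
  set ua : sideGroup x y z (x * (y⁻¹ * z * y) * x⁻¹) (x * z⁻¹ * x⁻¹) :=
      ⟨x⁻¹ * (x * (y⁻¹ * z * y) * x⁻¹) * x, _⟩ with hua
  set va : sideGroup x y z (x * (y⁻¹ * z * y) * x⁻¹) (x * z⁻¹ * x⁻¹) :=
      ⟨x⁻¹ * (x * z⁻¹ * x⁻¹) * x, _⟩ with hva
  have h₁ : pa * qa = ya⁻¹ * za * ya * za⁻¹ :=
      Subtype.ext ((relator_one_iff_RG x y z).1 relation_one)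
  have h₂ : ya * (za⁻¹ * qa⁻¹) = za⁻¹ * qa⁻¹ * ya :=
      Subtype.ext ((relator_two_iff_RG x y z).1 relation_two)
  have hu : ua = ya⁻¹ * za * ya :=
      Subtype.ext (show x⁻¹ * (x * (y⁻¹ * z * y) * x⁻¹) * x = y⁻¹ * z * y by group)
  have hv : va = za⁻¹ := Subtype.ext (show x⁻¹ * (x * z⁻¹ * x⁻¹) * x = z⁻¹ by group)
  replace h₁ := congrArg ι h₁
  replace h₂ := congrArg ι h₂
  rw [hu] at hp
  rw [hv] at hq
  simp only [map_mul, map_inv] at hp hq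
  simp only [map_mul, map_inv, hp, hq] at h₁ h₂
  obtain ⟨f, fx, fy, fz⟩ := exists_hom t (ι ya) (ι za)
    ((relator_one_iff_RG _ _ _).2 h₁) ((relator_two_iff_RG _ _ _).2 h₂)
  refine ⟨f, fx, fy, fz, ?_, ?_⟩
  · rw [hp]; simp only [map_mul, map_inv, fx, fy, fz]
  · rw [hq]; simp only [map_mul, map_inv, fx, fz]

lemma relator_one_iff_RB {G : Type*} [Group G] (X Y Z : G) : ⁅X, ⁅Y⁻¹, Z⁆⁆ = 1 ↔
    Y⁻¹ * Z * Y * Z⁻¹ = (X⁻¹ * (Y⁻¹) * X) * (X⁻¹ * (Z * Y * Z⁻¹) * X) :=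
  eq_one_iff_of_conj (X⁻¹) (by rw [commutatorElement_def, commutatorElement_def]; group)

lemma relator_two_iff_RB {G : Type*} [Group G] (X Y Z : G) : ⁅Y, ⁅Z⁻¹, X⁆⁆ = 1 ↔
    (X⁻¹ * (Z * Y * Z⁻¹) * X) = Z * (X⁻¹ * (Y⁻¹) * X)⁻¹ * Z⁻¹ :=
  eq_one_iff_of_conj (X⁻¹ * Z) (by rw [commutatorElement_def, commutatorElement_def]; group)

/-- Here `H` itself lies in `⟨y, z⟩`, so the additional elements of `A` are `u = α⁻¹pα` and `v =
α⁻¹qα`, and the HNN relations are solved for `ι u` and `ι v`. `BG` and `GR` follow this pattern. -/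
lemma hasHNNProperty_RB : HasHNNProperty (sideGroup x y z (y⁻¹) (z * y * z⁻¹))
    (Subgroup.closure {y⁻¹, z * y * z⁻¹}) x := by
  refine hasHNNProperty_sideGroup fun L _ ι t hp hq => ?_
  set ya : sideGroup x y z (y⁻¹) (z * y * z⁻¹) := ⟨y, _⟩
  set za : sideGroup x y z (y⁻¹) (z * y * z⁻¹) := ⟨z, _⟩
  set pa : sideGroup x y z (y⁻¹) (z * y * z⁻¹) := ⟨y⁻¹, left_mem_sideGroup _ _ _ _ _⟩ with hpa
  set qa : sideGroup x y z (y⁻¹) (z * y * z⁻¹) :=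
      ⟨z * y * z⁻¹, right_mem_sideGroup _ _ _ _ _⟩ with hqa
  set ua : sideGroup x y z (y⁻¹) (z * y * z⁻¹) := ⟨x⁻¹ * (y⁻¹) * x, _⟩ with hua
  set va : sideGroup x y z (y⁻¹) (z * y * z⁻¹) := ⟨x⁻¹ * (z * y * z⁻¹) * x, _⟩ with hva
  have h₁ : ya⁻¹ * za * ya * za⁻¹ = ua * va :=
      Subtype.ext ((relator_one_iff_RB x y z).1 relation_one)
  have h₂ : va = za * ua⁻¹ * za⁻¹ := Subtype.ext ((relator_two_iff_RB x y z).1 relation_two)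
  have hp' : pa = ya⁻¹ := rfl
  have hq' : qa = za * ya * za⁻¹ := rfl
  have hu : ι ua = t⁻¹ * ι pa * t := by rw [hp]; group
  have hv : ι va = t⁻¹ * ι qa * t := by rw [hq]; group
  rw [hp', map_inv] at hu
  rw [hq', map_mul, map_mul, map_inv] at hv
  replace h₁ := congrArg ι h₁
  replace h₂ := congrArg ι h₂
  simp only [map_mul, map_inv, hu, hv] at h₁ h₂
  obtain ⟨f, fx, fy, fz⟩ := exists_hom t (ι ya) (ι za)
    ((relator_one_iff_RB _ _ _).2 h₁) ((relator_two_iff_RB _ _ _).2 h₂)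
  refine ⟨f, fx, fy, fz, ?_, ?_⟩
  · rw [hp', map_inv, map_inv, fy]
  · rw [hq']; simp only [map_mul, map_inv, fy, fz]

lemma relator_one_iff_BR {G : Type*} [Group G] (X Y Z : G) : ⁅X, ⁅Y⁻¹, Z⁆⁆ = 1 ↔
    (Y * X⁻¹ * Y⁻¹)⁻¹ = Z * (Y * (Z⁻¹ * X * Z) * Y⁻¹) * Z⁻¹ :=
  eq_one_iff_of_conj (Y) (by rw [commutatorElement_def, commutatorElement_def]; group)

lemma relator_two_iff_BR {G : Type*} [Group G] (X Y Z : G) : ⁅Y, ⁅Z⁻¹, X⁆⁆ = 1 ↔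
    (Y * (Z⁻¹ * X * Z) * Y⁻¹) * (Y * X⁻¹ * Y⁻¹) = Z⁻¹ * X * Z * X⁻¹ :=
  eq_one_iff_of_conj (1) (by rw [commutatorElement_def, commutatorElement_def]; group)

lemma hasHNNProperty_BR : HasHNNProperty (sideGroup y z x (y * (z⁻¹ * x * z) * y⁻¹) (y * x⁻¹ * y⁻¹))
    (Subgroup.closure {y * (z⁻¹ * x * z) * y⁻¹, y * x⁻¹ * y⁻¹}) y := by
  refine hasHNNProperty_sideGroup fun L _ ι t hp hq => ?_
  set za : sideGroup y z x (y * (z⁻¹ * x * z) * y⁻¹) (y * x⁻¹ * y⁻¹) := ⟨z, _⟩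
  set xa : sideGroup y z x (y * (z⁻¹ * x * z) * y⁻¹) (y * x⁻¹ * y⁻¹) := ⟨x, _⟩
  set pa : sideGroup y z x (y * (z⁻¹ * x * z) * y⁻¹) (y * x⁻¹ * y⁻¹) :=
      ⟨y * (z⁻¹ * x * z) * y⁻¹, left_mem_sideGroup _ _ _ _ _⟩ with hpa
  set qa : sideGroup y z x (y * (z⁻¹ * x * z) * y⁻¹) (y * x⁻¹ * y⁻¹) :=
      ⟨y * x⁻¹ * y⁻¹, right_mem_sideGroup _ _ _ _ _⟩ with hqa
  set ua : sideGroup y z x (y * (z⁻¹ * x * z) * y⁻¹) (y * x⁻¹ * y⁻¹) :=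
      ⟨y⁻¹ * (y * (z⁻¹ * x * z) * y⁻¹) * y, _⟩ with hua
  set va : sideGroup y z x (y * (z⁻¹ * x * z) * y⁻¹) (y * x⁻¹ * y⁻¹) :=
      ⟨y⁻¹ * (y * x⁻¹ * y⁻¹) * y, _⟩ with hva
  have h₁ : qa⁻¹ = za * pa * za⁻¹ := Subtype.ext ((relator_one_iff_BR x y z).1 relation_one)
  have h₂ : pa * qa = za⁻¹ * xa * za * xa⁻¹ :=
      Subtype.ext ((relator_two_iff_BR x y z).1 relation_two)
  have hu : ua = za⁻¹ * xa * za :=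
      Subtype.ext (show y⁻¹ * (y * (z⁻¹ * x * z) * y⁻¹) * y = z⁻¹ * x * z by group)
  have hv : va = xa⁻¹ := Subtype.ext (show y⁻¹ * (y * x⁻¹ * y⁻¹) * y = x⁻¹ by group)
  replace h₁ := congrArg ι h₁
  replace h₂ := congrArg ι h₂
  rw [hu] at hp
  rw [hv] at hq
  simp only [map_mul, map_inv] at hp hq
  simp only [map_mul, map_inv, hp, hq] at h₁ h₂
  obtain ⟨f, fx, fy, fz⟩ := exists_hom (ι xa) t (ι za)
    ((relator_one_iff_BR _ _ _).2 h₁) ((relator_two_iff_BR _ _ _).2 h₂)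
  refine ⟨f, fy, fz, fx, ?_, ?_⟩
  · rw [hp]; simp only [map_mul, map_inv, fx, fy, fz]
  · rw [hq]; simp only [map_mul, map_inv, fx, fy]

lemma relator_one_iff_BG {G : Type*} [Group G] (X Y Z : G) : ⁅X, ⁅Y⁻¹, Z⁆⁆ = 1 ↔
    X * ((Y⁻¹ * (Z⁻¹) * Y)⁻¹ * Z⁻¹) = (Y⁻¹ * (Z⁻¹) * Y)⁻¹ * Z⁻¹ * X :=
  eq_one_iff_of_conj (1) (by rw [commutatorElement_def, commutatorElement_def]; group)

lemma relator_two_iff_BG {G : Type*} [Group G] (X Y Z : G) : ⁅Y, ⁅Z⁻¹, X⁆⁆ = 1 ↔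
    Z⁻¹ * X * Z * X⁻¹ = (Y⁻¹ * (Z⁻¹) * Y) * (Y⁻¹ * (X * Z * X⁻¹) * Y) :=
  eq_one_iff_of_conj (Y⁻¹) (by rw [commutatorElement_def, commutatorElement_def]; group)

lemma hasHNNProperty_BG : HasHNNProperty (sideGroup y z x (z⁻¹) (x * z * x⁻¹))
    (Subgroup.closure {z⁻¹, x * z * x⁻¹}) y := by
  refine hasHNNProperty_sideGroup fun L _ ι t hp hq => ?_
  set za : sideGroup y z x (z⁻¹) (x * z * x⁻¹) := ⟨z, _⟩
  set xa : sideGroup y z x (z⁻¹) (x * z * x⁻¹) := ⟨x, _⟩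
  set pa : sideGroup y z x (z⁻¹) (x * z * x⁻¹) := ⟨z⁻¹, left_mem_sideGroup _ _ _ _ _⟩ with hpa
  set qa : sideGroup y z x (z⁻¹) (x * z * x⁻¹) :=
      ⟨x * z * x⁻¹, right_mem_sideGroup _ _ _ _ _⟩ with hqa
  set ua : sideGroup y z x (z⁻¹) (x * z * x⁻¹) := ⟨y⁻¹ * (z⁻¹) * y, _⟩ with hua
  set va : sideGroup y z x (z⁻¹) (x * z * x⁻¹) := ⟨y⁻¹ * (x * z * x⁻¹) * y, _⟩ with hva
  have h₁ : xa * (ua⁻¹ * za⁻¹) = ua⁻¹ * za⁻¹ * xa :=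
      Subtype.ext ((relator_one_iff_BG x y z).1 relation_one)
  have h₂ : za⁻¹ * xa * za * xa⁻¹ = ua * va :=
      Subtype.ext ((relator_two_iff_BG x y z).1 relation_two)
  have hp' : pa = za⁻¹ := rfl
  have hq' : qa = xa * za * xa⁻¹ := rfl
  have hu : ι ua = t⁻¹ * ι pa * t := by rw [hp]; group
  have hv : ι va = t⁻¹ * ι qa * t := by rw [hq]; group
  rw [hp', map_inv] at hu
  rw [hq', map_mul, map_mul, map_inv] at hv
  replace h₁ := congrArg ι h₁
  replace h₂ := congrArg ι h₂
  simp only [map_mul, map_inv, hu, hv] at h₁ h₂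
  obtain ⟨f, fx, fy, fz⟩ := exists_hom (ι xa) t (ι za)
    ((relator_one_iff_BG _ _ _).2 h₁) ((relator_two_iff_BG _ _ _).2 h₂)
  refine ⟨f, fy, fz, fx, ?_, ?_⟩
  · rw [hp', map_inv, map_inv, fz]
  · rw [hq']; simp only [map_mul, map_inv, fx, fz]

lemma relator_one_iff_GR {G : Type*} [Group G] (X Y Z : G) : ⁅X, ⁅Y⁻¹, Z⁆⁆ = 1 ↔
    (Z⁻¹ * (Y * X * Y⁻¹) * Z) = Y * (Z⁻¹ * (X⁻¹) * Z)⁻¹ * Y⁻¹ :=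
  eq_one_iff_of_conj (Z⁻¹ * Y) (by rw [commutatorElement_def, commutatorElement_def]; group)

lemma relator_two_iff_GR {G : Type*} [Group G] (X Y Z : G) : ⁅Y, ⁅Z⁻¹, X⁆⁆ = 1 ↔
    Y * ((Z⁻¹ * (X⁻¹) * Z)⁻¹ * X⁻¹) = (Z⁻¹ * (X⁻¹) * Z)⁻¹ * X⁻¹ * Y :=
  eq_one_iff_of_conj (1) (by rw [commutatorElement_def, commutatorElement_def]; group)

lemma hasHNNProperty_GR : HasHNNProperty (sideGroup z x y (x⁻¹) (y * x * y⁻¹))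
    (Subgroup.closure {x⁻¹, y * x * y⁻¹}) z := by
  refine hasHNNProperty_sideGroup fun L _ ι t hp hq => ?_
  set xa : sideGroup z x y (x⁻¹) (y * x * y⁻¹) := ⟨x, _⟩
  set ya : sideGroup z x y (x⁻¹) (y * x * y⁻¹) := ⟨y, _⟩
  set pa : sideGroup z x y (x⁻¹) (y * x * y⁻¹) := ⟨x⁻¹, left_mem_sideGroup _ _ _ _ _⟩ with hpa
  set qa : sideGroup z x y (x⁻¹) (y * x * y⁻¹) :=
      ⟨y * x * y⁻¹, right_mem_sideGroup _ _ _ _ _⟩ with hqa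
  set ua : sideGroup z x y (x⁻¹) (y * x * y⁻¹) := ⟨z⁻¹ * (x⁻¹) * z, _⟩ with hua
  set va : sideGroup z x y (x⁻¹) (y * x * y⁻¹) := ⟨z⁻¹ * (y * x * y⁻¹) * z, _⟩ with hva
  have h₁ : va = ya * ua⁻¹ * ya⁻¹ := Subtype.ext ((relator_one_iff_GR x y z).1 relation_one)
  have h₂ : ya * (ua⁻¹ * xa⁻¹) = ua⁻¹ * xa⁻¹ * ya :=
      Subtype.ext ((relator_two_iff_GR x y z).1 relation_two)
  have hp' : pa = xa⁻¹ := rfl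
  have hq' : qa = ya * xa * ya⁻¹ := rfl
  have hu : ι ua = t⁻¹ * ι pa * t := by rw [hp]; group
  have hv : ι va = t⁻¹ * ι qa * t := by rw [hq]; group
  rw [hp', map_inv] at hu
  rw [hq', map_mul, map_mul, map_inv] at hv
  replace h₁ := congrArg ι h₁
  replace h₂ := congrArg ι h₂
  simp only [map_mul, map_inv, hu, hv] at h₁ h₂
  obtain ⟨f, fx, fy, fz⟩ := exists_hom (ι xa) (ι ya) t
    ((relator_one_iff_GR _ _ _).2 h₁) ((relator_two_iff_GR _ _ _).2 h₂)
  refine ⟨f, fz, fx, fy, ?_, ?_⟩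
  · rw [hp', map_inv, map_inv, fx]
  · rw [hq']; simp only [map_mul, map_inv, fx, fy]

lemma relator_one_iff_GB {G : Type*} [Group G] (X Y Z : G) : ⁅X, ⁅Y⁻¹, Z⁆⁆ = 1 ↔
    X * (Y⁻¹ * (Z * Y⁻¹ * Z⁻¹)⁻¹) = Y⁻¹ * (Z * Y⁻¹ * Z⁻¹)⁻¹ * X :=
  eq_one_iff_of_conj (1) (by rw [commutatorElement_def, commutatorElement_def]; group)

lemma relator_two_iff_GB {G : Type*} [Group G] (X Y Z : G) : ⁅Y, ⁅Z⁻¹, X⁆⁆ = 1 ↔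
    (Z * Y⁻¹ * Z⁻¹)⁻¹ * X * (Z * (X⁻¹ * Y * X) * Z⁻¹)⁻¹ = X :=
  eq_one_iff_of_conj (Z) (by rw [commutatorElement_def, commutatorElement_def]; group)

lemma hasHNNProperty_GB : HasHNNProperty (sideGroup z x y (z * (x⁻¹ * y * x) * z⁻¹) (z * y⁻¹ * z⁻¹))
    (Subgroup.closure {z * (x⁻¹ * y * x) * z⁻¹, z * y⁻¹ * z⁻¹}) z := by
  refine hasHNNProperty_sideGroup fun L _ ι t hp hq => ?_
  set xa : sideGroup z x y (z * (x⁻¹ * y * x) * z⁻¹) (z * y⁻¹ * z⁻¹) := ⟨x, _⟩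
  set ya : sideGroup z x y (z * (x⁻¹ * y * x) * z⁻¹) (z * y⁻¹ * z⁻¹) := ⟨y, _⟩
  set pa : sideGroup z x y (z * (x⁻¹ * y * x) * z⁻¹) (z * y⁻¹ * z⁻¹) :=
      ⟨z * (x⁻¹ * y * x) * z⁻¹, left_mem_sideGroup _ _ _ _ _⟩ with hpa
  set qa : sideGroup z x y (z * (x⁻¹ * y * x) * z⁻¹) (z * y⁻¹ * z⁻¹) :=
      ⟨z * y⁻¹ * z⁻¹, right_mem_sideGroup _ _ _ _ _⟩ with hqa
  set ua : sideGroup z x y (z * (x⁻¹ * y * x) * z⁻¹) (z * y⁻¹ * z⁻¹) :=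
      ⟨z⁻¹ * (z * (x⁻¹ * y * x) * z⁻¹) * z, _⟩ with hua
  set va : sideGroup z x y (z * (x⁻¹ * y * x) * z⁻¹) (z * y⁻¹ * z⁻¹) :=
      ⟨z⁻¹ * (z * y⁻¹ * z⁻¹) * z, _⟩ with hva
  have h₁ : xa * (ya⁻¹ * qa⁻¹) = ya⁻¹ * qa⁻¹ * xa :=
      Subtype.ext ((relator_one_iff_GB x y z).1 relation_one)
  have h₂ : qa⁻¹ * xa * pa⁻¹ = xa := Subtype.ext ((relator_two_iff_GB x y z).1 relation_two)
  have hu : ua = xa⁻¹ * ya * xa :=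
      Subtype.ext (show z⁻¹ * (z * (x⁻¹ * y * x) * z⁻¹) * z = x⁻¹ * y * x by group)
  have hv : va = ya⁻¹ := Subtype.ext (show z⁻¹ * (z * y⁻¹ * z⁻¹) * z = y⁻¹ by group)
  replace h₁ := congrArg ι h₁
  replace h₂ := congrArg ι h₂
  rw [hu] at hp
  rw [hv] at hq
  simp only [map_mul, map_inv] at hp hq
  simp only [map_mul, map_inv, hp, hq] at h₁ h₂
  obtain ⟨f, fx, fy, fz⟩ := exists_hom (ι xa) (ι ya) t
    ((relator_one_iff_GB _ _ _).2 h₁) ((relator_two_iff_GB _ _ _).2 h₂)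
  refine ⟨f, fz, fx, fy, ?_, ?_⟩
  · rw [hp]; simp only [map_mul, map_inv, fx, fy, fz]
  · rw [hq]; simp only [map_mul, map_inv, fy, fz]

lemma hasHNNProperty (j : Fin 6) :
    HasHNNProperty (baseGroup j) (sphereGroup j) (stableLetter j) := by
  fin_cases j
  exacts [hasHNNProperty_RG, hasHNNProperty_RB, hasHNNProperty_BR, hasHNNProperty_BG,
    hasHNNProperty_GR, hasHNNProperty_GB]

lemma gen_mem_baseGroup (j : Fin 6) : ∀ i : Fin 3,
    PresentedGroup.of i = stableLetter j ∨ PresentedGroup.of i ∈ baseGroup j := by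
  have h1 : ∀ {a b : Γ} {H K : Subgroup Γ}, a ∈ Subgroup.closure {a, b} ⊔ H ⊔ K := fun {a b H K} =>
    (le_sup_left.trans le_sup_left : Subgroup.closure {a, b} ≤ Subgroup.closure {a, b} ⊔ H ⊔ K)
      (Subgroup.subset_closure (by simp))
  have h2 : ∀ {a b : Γ} {H K : Subgroup Γ}, b ∈ Subgroup.closure {a, b} ⊔ H ⊔ K := fun {a b H K} =>
    (le_sup_left.trans le_sup_left : Subgroup.closure {a, b} ≤ Subgroup.closure {a, b} ⊔ H ⊔ K)
      (Subgroup.subset_closure (by simp))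
  intro i
  fin_cases j <;> fin_cases i
  exacts [.inl rfl, .inr h1, .inr h2, .inl rfl, .inr h1, .inr h2,
    .inr h2, .inl rfl, .inr h1, .inr h2, .inl rfl, .inr h1,
    .inr h1, .inr h2, .inl rfl, .inr h1, .inr h2, .inl rfl]

lemma isHNNSplitting (j : Fin 6) :
    IsHNNSplitting (baseGroup j) (sphereGroup j) (stableLetter j) := by
  refine (hasHNNProperty j).isHNNSplitting (le_sup_right.trans le_sup_left) le_sup_right
    fun f hα hA => PresentedGroup.ext fun i => ?_
  rcases gen_mem_baseGroup j i with h | h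
  · rw [h, hα]; rfl
  · exact hA ⟨_, h⟩

/-! ### The thrice-punctured spheres -/

/-- The exponent 3 loses nothing: a parabolic isometry of hyperbolic space has a single Jordan block
of size 3 and one of size 1. -/
lemma isParabolic_of_intMat {γ : Γ} (h₁ : intMat γ ≠ 1) (h₂ : (intMat γ - 1) ^ 3 = 0) :
    IsParabolic γ := by
  constructor
  · intro h
    apply h₁
    have h3 : (intMat γ).map (Int.cast : ℤ → ℝ) = (1 : Matrix (Fin 4) (Fin 4) ℤ).map Int.cast := by
      rw [← mat_eq_map, mat, h, Matrix.SpecialLinearGroup.coe_one]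
      simp
    exact Matrix.map_injective Int.cast_injective h3
  · refine ⟨3, ?_⟩
    have h3 : mat γ - 1 = (Int.castRingHom ℝ).mapMatrix (intMat γ - 1) := by
      rw [map_sub, map_one, mat_eq_map]; rfl
    rw [h3, ← map_pow, h₂, map_zero]

/-- Integral normal vectors of the planes stabilized by the six sphere groups. -/
def normal : Fin 6 → Fin 4 → ℤ :=
  ![![2, 0, -2, 1], ![1, 0, -1, 1], ![2, 1, 0, 2], ![1, 1, 0, 1], ![-1, -1, 1, 0], ![-2, -2, 1, 0]]

/-- The normal vectors, as real vectors. -/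
def realNormal (j : Fin 6) : Fin 4 → ℝ := fun i => normal j i

lemma mat_mulVec_cast (γ : Γ) (n : Fin 4 → ℤ) :
    mat γ *ᵥ (fun i => (n i : ℝ)) = fun i => ((intMat γ *ᵥ n) i : ℝ) := by
  rw [mat_eq_map]
  ext i
  simp [Matrix.mulVec, dotProduct]

lemma fixes_of_mem_closure {p q : Γ} {v : Fin 4 → ℝ} (hp : mat p *ᵥ v = v) (hq : mat q *ᵥ v = v) :
    ∀ h ∈ Subgroup.closure {p, q}, mat h *ᵥ v = v := by
  intro h hh
  induction hh using Subgroup.closure_induction with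
  | mem a ha => rcases ha with rfl | rfl <;> assumption
  | one => rw [mat_one, Matrix.one_mulVec]
  | mul a b _ _ ha hb => rw [mat_mul, ← Matrix.mulVec_mulVec, hb, ha]
  | inv a _ ha =>
    conv_lhs => rw [← ha]
    rw [Matrix.mulVec_mulVec, mat_inv_mul_mat, Matrix.one_mulVec]

lemma exists_generators (j : Fin 6) : ∃ p q : Γ, sphereGroup j = Subgroup.closure {p, q} ∧
    intMat (p * q) ≠ intMat (q * p) ∧ intMat p *ᵥ normal j = normal j ∧
    intMat q *ᵥ normal j = normal j ∧ IsParabolic p ∧ IsParabolic q ∧ IsParabolic (p * q) := by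
  fin_cases j
  all_goals
    refine ⟨_, _, rfl, ?_, ?_, ?_, isParabolic_of_intMat ?_ ?_, isParabolic_of_intMat ?_ ?_,
      isParabolic_of_intMat ?_ ?_⟩
    all_goals
      simp only [intMat_mul, intMat_x, intMat_y, intMat_z, intMat_x_inv, intMat_y_inv, intMat_z_inv]
      decide +kernel

lemma realNormal_fixed (j : Fin 6) : ∀ h ∈ sphereGroup j, mat h *ᵥ realNormal j = realNormal j := by
  obtain ⟨p, q, hpq, -, hp, hq, -⟩ := exists_generators j
  rw [hpq]
  refine fixes_of_mem_closure ?_ ?_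
  · change mat p *ᵥ (fun i => (normal j i : ℝ)) = _
    rw [mat_mulVec_cast, hp]; rfl
  · change mat q *ᵥ (fun i => (normal j i : ℝ)) = _
    rw [mat_mulVec_cast, hq]; rfl

lemma realNormal_norm (j : Fin 6) : realNormal j ⬝ᵥ (J *ᵥ realNormal j) = 1 := by
  fin_cases j <;>
    simp [realNormal, normal, J, dotProduct, Fin.sum_univ_four, Matrix.mulVec_diagonal]

lemma isThricePuncturedSphereGroup (j : Fin 6) : IsThricePuncturedSphereGroup (sphereGroup j) := by
  obtain ⟨p, q, hpq, hne, -, -, h1, h2, h3⟩ := exists_generators j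
  refine ⟨⟨realNormal j, by rw [realNormal_norm]; exact one_pos, realNormal_fixed j⟩, p, q, hpq,
    fun h => hne ?_, h1, h2, h3⟩
  apply Matrix.map_injective (Int.cast_injective (α := ℝ))
  change (intMat (p * q)).map (Int.cast : ℤ → ℝ) = (intMat (q * p)).map (Int.cast : ℤ → ℝ)
  rw [← mat_eq_map, ← mat_eq_map, mat, mat, map_mul, map_mul, h]

/-! ### The bendings -/

/-- Bases of `ℤ⁴` made of the normal vector and of vectors orthogonal to it. -/
def normalBasis : Fin 6 → Matrix (Fin 4) (Fin 4) ℤ :=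
  ![!![2, 0, 1, 1; 0, 1, 0, 0; -2, 0, -1, 0; 1, 0, 0, 2],
    !![1, 0, 1, 1; 0, 1, 0, 0; -1, 0, 0, -1; 1, 0, 1, 0],
    !![2, 0, 1, 1; 1, 0, 0, 2; 0, 1, 0, 0; 2, 0, 1, 0],
    !![1, 0, 1, 1; 1, 0, 1, 0; 0, 1, 0, 0; 1, 0, 0, 1],
    !![-1, 0, 1, 1; -1, 0, 1, 0; 1, 0, 0, -1; 0, 1, 0, 0],
    !![-2, 0, 1, 1; -2, 0, 1, 0; 1, 0, 0, -2; 0, 1, 0, 0]]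

/-- The inverses of the matrices `normalBasis`. -/
def normalBasisInv : Fin 6 → Matrix (Fin 4) (Fin 4) ℤ :=
  ![!![-2, 0, -2, 1; 0, 1, 0, 0; 4, 0, 3, -2; 1, 0, 1, 0],
    !![-1, 0, -1, 1; 0, 1, 0, 0; 1, 0, 1, 0; 1, 0, 0, -1],
    !![-2, 1, 0, 2; 0, 0, 1, 0; 4, -2, 0, -3; 1, 0, 0, -1],
    !![-1, 1, 0, 1; 0, 0, 1, 0; 1, 0, 0, -1; 1, -1, 0, 0],
    !![1, -1, 1, 0; 0, 0, 0, 1; 1, 0, 1, 0; 1, -1, 0, 0],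
    !![2, -2, 1, 0; 0, 0, 0, 1; 4, -3, 2, 0; 1, -1, 0, 0]]

lemma normalBasis_mul_inv (j : Fin 6) : normalBasis j * normalBasisInv j = 1 := by
  revert j; decide +kernel

lemma normalBasisInv_mul (j : Fin 6) : normalBasisInv j * normalBasis j = 1 := by
  revert j; decide +kernel

/-- `normalBasis j` as an invertible real matrix. -/
def frame (j : Fin 6) : (Matrix (Fin 4) (Fin 4) ℝ)ˣ :=
  Units.map (Int.castRingHom ℝ).mapMatrix.toMonoidHom
    ⟨normalBasis j, normalBasisInv j, normalBasis_mul_inv j, normalBasisInv_mul j⟩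

/-- The integral orthogonal projection onto the line of `normal j`. -/
def intProj (j : Fin 6) : Matrix (Fin 4) (Fin 4) ℤ :=
  Matrix.vecMulVec (normal j) (normal j) * Matrix.diagonal ![-1, 1, 1, 1]

/-- The orthogonal projection onto the line of `realNormal j`. -/
def proj (j : Fin 6) : Matrix (Fin 4) (Fin 4) ℝ :=
  Matrix.vecMulVec (realNormal j) (realNormal j) * J

lemma J_eq_map : J = (Matrix.diagonal ![-1, 1, 1, 1] : Matrix (Fin 4) (Fin 4) ℤ).map
    (Int.castRingHom ℝ) := by
  ext a b; fin_cases a <;> fin_cases b <;> simp [J]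

lemma proj_eq_map (j : Fin 6) : proj j = (intProj j).map (Int.castRingHom ℝ) := by
  rw [intProj, Matrix.map_mul, ← J_eq_map, proj]
  congr 1
  ext a b
  simp [Matrix.vecMulVec_apply, realNormal]

/-- The first column of the frame is the unit normal and the other columns span its orthogonal
complement. -/
lemma frame_single (j : Fin 6) : (frame j : Matrix (Fin 4) (Fin 4) ℝ) * Matrix.single 0 0 1 *
    (((frame j)⁻¹ : (Matrix (Fin 4) (Fin 4) ℝ)ˣ) : Matrix (Fin 4) (Fin 4) ℝ) = proj j := by
  have h : ∀ j, normalBasis j * Matrix.single 0 0 1 * normalBasisInv j = intProj j := by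
    decide +kernel
  rw [proj_eq_map, ← h, Matrix.map_mul, Matrix.map_mul, Matrix.map_single, map_one]
  rfl

/-- The one-parameter group along which `ρ` is bent. -/
def bendMat (j : Fin 6) (t : ℝ) : Matrix (Fin 4) (Fin 4) ℝ :=
  frame j * Matrix.diagonal ![Real.exp (-3 * t), Real.exp t, Real.exp t, Real.exp t] *
    (((frame j)⁻¹ : (Matrix (Fin 4) (Fin 4) ℝ)ˣ) : Matrix (Fin 4) (Fin 4) ℝ)

/-- In this form the one-parameter group depends only on the projection, so that its centralizer and
its derivative can be read off. -/
lemma bendMat_eq (j : Fin 6) (t : ℝ) :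
    bendMat j t = Real.exp t • 1 + (Real.exp (-3 * t) - Real.exp t) • proj j := by
  have h : Matrix.diagonal ![Real.exp (-3 * t), Real.exp t, Real.exp t, Real.exp t] =
      Real.exp t • (1 : Matrix (Fin 4) (Fin 4) ℝ) +
        (Real.exp (-3 * t) - Real.exp t) • Matrix.single 0 0 1 := by
    ext a b; fin_cases a <;> fin_cases b <;> simp
  rw [bendMat, h, Matrix.mul_add, Matrix.add_mul, Matrix.mul_smul, Matrix.smul_mul,
    Matrix.mul_smul, Matrix.smul_mul, frame_single, Matrix.mul_one, ← Units.val_mul,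
    mul_inv_cancel, Units.val_one]

lemma bendMat_mul (j : Fin 6) (s t : ℝ) : bendMat j s * bendMat j t = bendMat j (s + t) := by
  have h : ∀ A B : Matrix (Fin 4) (Fin 4) ℝ,
      (frame j * A * (((frame j)⁻¹ : (Matrix _ _ ℝ)ˣ) : Matrix (Fin 4) (Fin 4) ℝ)) *
      (frame j * B * (((frame j)⁻¹ : (Matrix _ _ ℝ)ˣ) : Matrix (Fin 4) (Fin 4) ℝ)) =
      frame j * (A * B) * (((frame j)⁻¹ : (Matrix _ _ ℝ)ˣ) : Matrix (Fin 4) (Fin 4) ℝ) := fun A B => by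
    simp only [mul_assoc, Units.inv_mul_cancel_left]
  rw [bendMat, bendMat, h, Matrix.diagonal_mul_diagonal, bendMat]
  congr 3
  ext i
  fin_cases i <;> simp [← Real.exp_add]; ring_nf

lemma det_bendMat (j : Fin 6) (t : ℝ) : (bendMat j t).det = 1 := by
  rw [bendMat, Matrix.det_units_conj, Matrix.det_diagonal, Fin.prod_univ_four]
  simp only [Matrix.cons_val]
  rw [← Real.exp_add, ← Real.exp_add, ← Real.exp_add, Real.exp_eq_one_iff]
  ring

/-- The one-parameter group along which `ρ` is bent, in `SL₄(ℝ)`. -/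
def bend (j : Fin 6) (t : ℝ) : SL4 := ⟨bendMat j t, det_bendMat j t⟩

lemma bendMat_zero (j : Fin 6) : bendMat j 0 = 1 := by
  rw [bendMat_eq]; simp

lemma bend_zero (j : Fin 6) : bend j 0 = 1 := Subtype.ext (bendMat_zero j)

lemma bend_inv (j : Fin 6) (t : ℝ) : (bend j t)⁻¹ = bend j (-t) := by
  refine inv_eq_of_mul_eq_one_right (Subtype.ext ?_)
  change bendMat j t * bendMat j (-t) = 1
  rw [bendMat_mul, add_neg_cancel, bendMat_zero]

/-- An element of `H` fixes the normal `n` and preserves `J`, hence also fixes the covector `nᵀJ`;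
the projection is `n nᵀJ`. -/
lemma proj_comm (j : Fin 6) {h : Γ} (hh : h ∈ sphereGroup j) : proj j * mat h = mat h * proj j := by
  have h1 := realNormal_fixed j h hh
  have h2 := realNormal_fixed j h⁻¹ (inv_mem hh)
  rw [proj, ← Matrix.mul_assoc (mat h), Matrix.mul_vecMulVec, h1, Matrix.vecMulVec_mul,
    Matrix.vecMulVec_mul, ← Matrix.mulVec_transpose, ← Matrix.mulVec_transpose]
  congr 1
  rw [Matrix.mulVec_mulVec, J_transpose, mat_transpose_mul_J, ← Matrix.mulVec_mulVec, h2]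

lemma bend_comm (j : Fin 6) (t : ℝ) {h : Γ} (hh : h ∈ sphereGroup j) :
    bend j t * ρ h = ρ h * bend j t := by
  refine Subtype.ext ?_
  change bendMat j t * mat h = mat h * bendMat j t
  rw [bendMat_eq, Matrix.add_mul, Matrix.mul_add, Matrix.smul_mul, Matrix.smul_mul,
    Matrix.mul_smul, Matrix.mul_smul, proj_comm j hh, Matrix.one_mul, Matrix.mul_one]

/-- The universal property with `t := c(t) ρ(α)`; its compatibility condition is exactly that `c(t)`
commutes with `ρ(H)`. -/
lemma exists_bending (j : Fin 6) (t : ℝ) : ∃ f : Γ →* SL4,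
    f (stableLetter j) = bend j t * ρ (stableLetter j) ∧ ∀ a ∈ baseGroup j, f a = ρ a := by
  obtain ⟨f, h1, h2⟩ := hasHNNProperty j SL4 (ρ.comp (baseGroup j).subtype)
    (bend j t * ρ (stableLetter j)) fun a b ha hab => by
      change bend j t * ρ (stableLetter j) * ρ b = ρ a * (bend j t * ρ (stableLetter j))
      rw [mul_assoc, ← map_mul, hab, map_mul, ← mul_assoc, bend_comm j t ha, mul_assoc]
  exact ⟨f, h1, fun a ha => h2 ⟨a, ha⟩⟩

/-- The projective bending along the `j`-th sphere. -/
def bending (j : Fin 6) (t : ℝ) : Γ →* SL4 := (exists_bending j t).choose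

lemma bending_stableLetter (j : Fin 6) (t : ℝ) :
    bending j t (stableLetter j) = bend j t * ρ (stableLetter j) :=
  (exists_bending j t).choose_spec.1

lemma bending_of_mem (j : Fin 6) (t : ℝ) {a : Γ} (ha : a ∈ baseGroup j) : bending j t a = ρ a :=
  (exists_bending j t).choose_spec.2 a ha

lemma isBending (j : Fin 6) :
    IsBending (baseGroup j) (sphereGroup j) (stableLetter j) (bending j) :=
  ⟨bend j, ⟨frame j, fun _ => rfl⟩, fun t _ hh => bend_comm j t hh,
    fun t _ ha => bending_of_mem j t ha, bending_stableLetter j⟩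

lemma bending_zero (j : Fin 6) : bending j 0 = ρ := by
  refine PresentedGroup.ext fun i => ?_
  rcases gen_mem_baseGroup j i with h | h
  · rw [h, bending_stableLetter, bend_zero, one_mul]
  · exact bending_of_mem j 0 h

/-! ### The tangent cocycles -/

/-- The tangent vector of the one-parameter group `bend j`. -/
def bendTangent (j : Fin 6) : Matrix (Fin 4) (Fin 4) ℝ := 1 - (4 : ℝ) • proj j

lemma vecMulVec_mul_J_mem (n : Fin 4 → ℝ) (hn : n ⬝ᵥ (J *ᵥ n) = 1) :
    1 - (4 : ℝ) • (Matrix.vecMulVec n n * J) ∈ nu4 := by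
  constructor
  · rw [Matrix.trace_sub, Matrix.trace_smul, Matrix.vecMulVec_mul, Matrix.trace_vecMulVec,
      ← Matrix.mulVec_transpose, J_transpose, hn, Matrix.trace_one]
    norm_num
  · rw [Matrix.transpose_sub, Matrix.transpose_smul, Matrix.transpose_mul, J_transpose,
      Matrix.transpose_vecMulVec, Matrix.transpose_one]
    simp only [Matrix.sub_mul, Matrix.mul_sub, Matrix.smul_mul, Matrix.mul_smul, Matrix.mul_assoc,
      Matrix.one_mul, Matrix.mul_one]

lemma bendTangent_mem (j : Fin 6) : bendTangent j ∈ nu4 :=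
  vecMulVec_mul_J_mem _ (realNormal_norm j)

lemma hasDerivAt_bendMat (j : Fin 6) (a b : Fin 4) :
    HasDerivAt (fun t => bendMat j t a b) (bendTangent j a b) 0 := by
  simp only [bendMat_eq, bendTangent, Matrix.add_apply, Matrix.sub_apply, Matrix.smul_apply,
    smul_eq_mul]
  have h1 : HasDerivAt (fun t : ℝ => Real.exp t) 1 0 := by
    simpa using Real.hasDerivAt_exp 0
  have h2 : HasDerivAt (fun t : ℝ => Real.exp (-3 * t)) (-3) 0 := by
    simpa using ((hasDerivAt_id (0 : ℝ)).const_mul (-3)).exp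
  have h3 := (h1.mul_const ((1 : Matrix (Fin 4) (Fin 4) ℝ) a b)).add
    ((h2.sub h1).mul_const (proj j a b))
  have h4 : 1 * (1 : Matrix (Fin 4) (Fin 4) ℝ) a b + (-3 - 1) * proj j a b =
      (1 : Matrix (Fin 4) (Fin 4) ℝ) a b - 4 * proj j a b := by ring
  rw [h4] at h3
  exact h3

/-- `V` is the tangent vector at `0` of the curve `t ↦ r t γ`. -/
def IsTangentAt (r : ℝ → Γ →* SL4) (γ : Γ) (V : Matrix (Fin 4) (Fin 4) ℝ) : Prop :=
  ∀ a b : Fin 4, HasDerivAt (fun t : ℝ => (r t γ : Matrix (Fin 4) (Fin 4) ℝ) a b)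
    ((V * mat γ) a b) 0

lemma hasDerivAt_matrix_mul {A B : ℝ → Matrix (Fin 4) (Fin 4) ℝ} {A' B' : Matrix (Fin 4) (Fin 4) ℝ}
    (hA : ∀ a b, HasDerivAt (fun t => A t a b) (A' a b) 0)
    (hB : ∀ a b, HasDerivAt (fun t => B t a b) (B' a b) 0) (a b : Fin 4) :
    HasDerivAt (fun t => (A t * B t) a b) ((A' * B 0 + A 0 * B') a b) 0 := by
  simp only [Matrix.mul_apply, Matrix.add_apply, ← Finset.sum_add_distrib]
  exact HasDerivAt.fun_sum fun k _ => (hA a k).mul (hB k b)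

lemma IsTangentAt.mul {r : ℝ → Γ →* SL4} (hr : r 0 = ρ) {g h : Γ}
    {V W : Matrix (Fin 4) (Fin 4) ℝ} (hg : IsTangentAt r g V) (hh : IsTangentAt r h W) :
    IsTangentAt r (g * h) (V + mat g * W * mat g⁻¹) := by
  intro a b
  have h1 := hasDerivAt_matrix_mul hg hh a b
  have h2 : (V + mat g * W * mat g⁻¹) * mat (g * h) =
      V * mat g * mat h + mat g * (W * mat h) := by
    rw [mat_mul, Matrix.add_mul]
    simp only [Matrix.mul_assoc]
    rw [← Matrix.mul_assoc (mat g⁻¹), mat_inv_mul_mat, Matrix.one_mul]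
  rw [h2]
  simpa only [hr, map_mul, Matrix.SpecialLinearGroup.coe_mul] using h1

lemma isTangentAt_of_mem (j : Fin 6) {a : Γ} (ha : a ∈ baseGroup j) :
    IsTangentAt (bending j) a 0 := by
  intro b c
  simp only [bending_of_mem j _ ha, Matrix.zero_mul, Matrix.zero_apply]
  exact hasDerivAt_const _ _

lemma isTangentAt_stableLetter (j : Fin 6) :
    IsTangentAt (bending j) (stableLetter j) (bendTangent j) := by
  intro a b
  simp only [bending_stableLetter, Matrix.SpecialLinearGroup.coe_mul]
  have h := hasDerivAt_matrix_mul (hasDerivAt_bendMat j)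
    (B := fun _ => mat (stableLetter j)) (B' := 0) (fun _ _ => hasDerivAt_const _ _) a b
  rw [Matrix.mul_zero, add_zero] at h
  exact h

/-- The curve is `ρ(α)⁻¹ c(-t)`, so it can be differentiated without differentiating matrix
inversion. -/
lemma isTangentAt_stableLetter_inv (j : Fin 6) :
    IsTangentAt (bending j) (stableLetter j)⁻¹
      (mat (stableLetter j)⁻¹ * (-bendTangent j) * mat (stableLetter j)⁻¹⁻¹) := by
  intro a b
  rw [Matrix.mul_assoc, inv_inv, mat_mul_mat_inv, Matrix.mul_one]
  simp only [map_inv, bending_stableLetter, mul_inv_rev, Matrix.SpecialLinearGroup.coe_mul,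
    bend_inv]
  have h1 : ∀ a b, HasDerivAt (fun t => bendMat j (-t) a b) ((-bendTangent j) a b) 0 := by
    intro a b
    have := (hasDerivAt_bendMat j a b)
    rw [← neg_zero] at this
    have h := this.scomp 0 (hasDerivAt_neg 0)
    rw [neg_smul, one_smul] at h
    exact h
  have h := hasDerivAt_matrix_mul (A := fun _ => mat (stableLetter j)⁻¹) (A' := 0)
    (fun _ _ => hasDerivAt_const _ _) h1 a b
  rw [Matrix.zero_mul, zero_add] at h
  rw [coe_ρ_inv]
  exact h

/-- The homomorphisms `bending j t` are chosen separately for each `t`, so smoothness in `t` is not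
built in. On generators and their inverses the curves are explicit, and the product rule carries
differentiability to all words. -/
lemma exists_isTangentAt (j : Fin 6) (γ : Γ) : ∃ V : nu4, IsTangentAt (bending j) γ V := by
  induction γ using induction_generators with
  | one => exact ⟨0, isTangentAt_of_mem j (one_mem _)⟩
  | mul g h hg hh =>
    obtain ⟨V, hV⟩ := hg
    obtain ⟨W, hW⟩ := hh
    refine ⟨V + coeff.ρ g W, ?_⟩
    have := hV.mul (bending_zero j) hW
    rwa [← coe_coeff_ρ] at this
  | gen i =>
    rcases gen_mem_baseGroup j i with h | h
    · rw [h]; exact ⟨⟨_, bendTangent_mem j⟩, isTangentAt_stableLetter j⟩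
    · exact ⟨0, isTangentAt_of_mem j h⟩
  | inv i =>
    rcases gen_mem_baseGroup j i with h | h
    · rw [h]
      refine ⟨coeff.ρ (stableLetter j)⁻¹ ⟨_, neg_mem (bendTangent_mem j)⟩, ?_⟩
      rw [coe_coeff_ρ]
      exact isTangentAt_stableLetter_inv j
    · exact ⟨0, isTangentAt_of_mem j (inv_mem h)⟩

lemma IsTangentAt.unique {r : ℝ → Γ →* SL4} {γ : Γ} {V W : Matrix (Fin 4) (Fin 4) ℝ}
    (hV : IsTangentAt r γ V) (hW : IsTangentAt r γ W) : V = W := by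
  have h : V * mat γ = W * mat γ := by
    ext a b; exact (hV a b).unique (hW a b)
  calc V = V * mat γ * mat γ⁻¹ := by rw [Matrix.mul_assoc, mat_mul_mat_inv, Matrix.mul_one]
    _ = W := by rw [h, Matrix.mul_assoc, mat_mul_mat_inv, Matrix.mul_one]

/-- The tangent cocycle of the `j`-th bending. -/
def tangent (j : Fin 6) : cocycles₁ coeff :=
  mkCocycle (fun γ => (exists_isTangentAt j γ).choose) fun g h =>
    -- Uniqueness of the derivative turns the product rule into the cocycle identity.
    (exists_isTangentAt j (g * h)).choose_spec.unique
      ((exists_isTangentAt j g).choose_spec.mul (bending_zero j)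
        (exists_isTangentAt j h).choose_spec)

lemma isTangentCocycle (j : Fin 6) : IsTangentCocycle (bending j) (tangent j) :=
  fun γ => (exists_isTangentAt j γ).choose_spec

lemma val_tangent_of_mem (j : Fin 6) {a : Γ} (ha : a ∈ baseGroup j) : val (tangent j) a = 0 :=
  IsTangentAt.unique (isTangentCocycle j a) (isTangentAt_of_mem j ha)

lemma val_tangent_stableLetter (j : Fin 6) :
    val (tangent j) (stableLetter j) = bendTangent j :=
  IsTangentAt.unique (isTangentCocycle j _) (isTangentAt_stableLetter j)

/-! ### Derivatives of traces -/

/-- The derivative of the trace of `γ` in the direction of a cocycle. -/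
def traceDeriv (γ : Γ) : cocycles₁ coeff →ₗ[ℝ] ℝ where
  toFun c := (val c γ * mat γ).trace
  map_add' c d := by rw [val_add, Matrix.add_mul, Matrix.trace_add]
  map_smul' a c := by rw [val_smul, Matrix.smul_mul, Matrix.trace_smul, RingHom.id_apply]

lemma traceDeriv_apply (γ : Γ) (c : cocycles₁ coeff) :
    traceDeriv γ c = (val c γ * mat γ).trace := rfl

lemma hasDerivAt_trace (j : Fin 6) (γ : Γ) :
    HasDerivAt (fun t => Matrix.trace (bending j t γ : Matrix (Fin 4) (Fin 4) ℝ))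
      (traceDeriv γ (tangent j)) 0 := by
  simp only [Matrix.trace, Matrix.diag_apply, traceDeriv_apply]
  exact HasDerivAt.fun_sum fun a _ => isTangentCocycle j γ a a

/-- Traces are invariant under conjugation, so the derivatives of traces depend only on the class in
`H¹`. -/
lemma traceDeriv_principal (γ : Γ) (V : nu4) : traceDeriv γ (principal V) = 0 := by
  rw [traceDeriv_apply, val_principal, Matrix.sub_mul, Matrix.mul_assoc (mat γ * _),
    mat_inv_mul_mat, Matrix.mul_one, Matrix.trace_sub, Matrix.trace_mul_comm, sub_self]

/-! ### Coordinates on `ν₄` -/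

/-- Nine coordinates that determine an element of `ν₄`. -/
def coord : Matrix (Fin 4) (Fin 4) ℝ →ₗ[ℝ] Fin 9 → ℝ where
  toFun V := ![V 1 1, V 2 2, V 3 3, V 1 2, V 1 3, V 2 3, V 1 0, V 2 0, V 3 0]
  map_add' V W := by simp
  map_smul' a V := by simp

/-- The coordinates of an integer matrix. -/
def intCoord (V : Matrix (Fin 4) (Fin 4) ℤ) : Fin 9 → ℤ :=
  ![V 1 1, V 2 2, V 3 3, V 1 2, V 1 3, V 2 3, V 1 0, V 2 0, V 3 0]

lemma coord_map (V : Matrix (Fin 4) (Fin 4) ℤ) (k : Fin 9) :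
    coord (V.map (Int.castRingHom ℝ)) k = intCoord V k := by
  fin_cases k <;> rfl

lemma entries_of_mem {V : Matrix (Fin 4) (Fin 4) ℝ} (hV : V ∈ nu4) :
    V 0 0 = -(V 1 1 + V 2 2 + V 3 3) ∧ (V 0 1 = -V 1 0 ∧ V 0 2 = -V 2 0 ∧ V 0 3 = -V 3 0) ∧
      V 2 1 = V 1 2 ∧ V 3 1 = V 1 3 ∧ V 3 2 = V 2 3 := by
  obtain ⟨h1, h2⟩ := hV
  have h3 : ∀ i j, V j i * ![-1, 1, 1, 1] j = ![-1, 1, 1, 1] i * V i j := fun i j => by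
    have := congrFun (congrFun h2 i) j
    rwa [J, Matrix.mul_diagonal, Matrix.diagonal_mul, Matrix.transpose_apply] at this
  simp only [Matrix.trace, Fin.sum_univ_four, Matrix.diag_apply] at h1
  have h01 := h3 0 1; have h02 := h3 0 2; have h03 := h3 0 3
  have h12 := h3 1 2; have h13 := h3 1 3; have h23 := h3 2 3
  simp only [Matrix.cons_val] at h01 h02 h03 h12 h13 h23
  refine ⟨by linarith, ⟨by linarith, by linarith, by linarith⟩, by linarith, by linarith,
    by linarith⟩

lemma eq_of_coord_eq {V W : Matrix (Fin 4) (Fin 4) ℝ} (hV : V ∈ nu4) (hW : W ∈ nu4)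
    (h : coord V = coord W) : V = W := by
  obtain ⟨a0, ⟨a1, a2, a3⟩, a4, a5, a6⟩ := entries_of_mem hV
  obtain ⟨b0, ⟨b1, b2, b3⟩, b4, b5, b6⟩ := entries_of_mem hW
  have e0 : V 1 1 = W 1 1 := congrFun h 0
  have e1 : V 2 2 = W 2 2 := congrFun h 1
  have e2 : V 3 3 = W 3 3 := congrFun h 2
  have e3 : V 1 2 = W 1 2 := congrFun h 3
  have e4 : V 1 3 = W 1 3 := congrFun h 4
  have e5 : V 2 3 = W 2 3 := congrFun h 5
  have e6 : V 1 0 = W 1 0 := congrFun h 6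
  have e7 : V 2 0 = W 2 0 := congrFun h 7
  have e8 : V 3 0 = W 3 0 := congrFun h 8
  ext i j
  fin_cases i <;> fin_cases j <;> simp only [Fin.zero_eta, Fin.mk_one, Fin.reduceFinMk] <;> linarith

/-- The functional `V ↦ tr (V N)` in coordinates. -/
def pairing (N : Matrix (Fin 4) (Fin 4) ℤ) : Fin 9 → ℤ :=
  ![N 1 1 - N 0 0, N 2 2 - N 0 0, N 3 3 - N 0 0, N 1 2 + N 2 1, N 1 3 + N 3 1, N 2 3 + N 3 2,
    N 0 1 - N 1 0, N 0 2 - N 2 0, N 0 3 - N 3 0]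

lemma trace_mul_map {V : Matrix (Fin 4) (Fin 4) ℝ} (hV : V ∈ nu4) (N : Matrix (Fin 4) (Fin 4) ℤ) :
    (V * N.map (Int.castRingHom ℝ)).trace = ∑ k, coord V k * (pairing N k : ℝ) := by
  obtain ⟨a0, ⟨a1, a2, a3⟩, a4, a5, a6⟩ := entries_of_mem hV
  have h : ∀ f : Fin 9 → ℝ, ∑ k, f k = f 0 + f 1 + f 2 + f 3 + f 4 + f 5 + f 6 + f 7 + f 8 :=
    fun f => by rw [Fin.sum_univ_castSucc, Fin.sum_univ_eight]; rfl
  have h' : ∀ k, coord V k =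
    ![V 1 1, V 2 2, V 3 3, V 1 2, V 1 3, V 2 3, V 1 0, V 2 0, V 3 0] k := fun _ => rfl
  rw [h]
  simp only [h', Matrix.trace, Matrix.diag_apply, Matrix.mul_apply, Fin.sum_univ_four,
    Matrix.map_apply, pairing, Matrix.cons_val, a0, a1, a2, a3, a4, a5, a6, Int.cast_sub,
    Int.cast_add, eq_intCast]
  ring

/-! ### Fox calculus -/

/-- The integer matrices of the generators (`true`) and of their inverses (`false`). -/
def letterMat (i : Fin 3) (s : Bool) : Matrix (Fin 4) (Fin 4) ℤ :=
  if s then genMatrix i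
  else Matrix.diagonal ![-1, 1, 1, 1] * (genMatrix i)ᵀ * Matrix.diagonal ![-1, 1, 1, 1]

/-- The element of `Γ` given by a letter. -/
def letter (l : Fin 3 × Bool) : Γ :=
  if l.2 then PresentedGroup.of l.1 else (PresentedGroup.of l.1)⁻¹

/-- The element of `Γ` given by a word. -/
def wordProd (w : List (Fin 3 × Bool)) : Γ := (w.map letter).prod

/-- The integer matrix of a word. -/
def wordMat (w : List (Fin 3 × Bool)) : Matrix (Fin 4) (Fin 4) ℤ :=
  (w.map fun l => letterMat l.1 l.2).prod

lemma mat_gen (i : Fin 3) (s : Bool) :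
    mat (letter (i, s)) = (letterMat i s).map (Int.castRingHom ℝ) := by
  rw [mat_eq_map]
  cases s
  · rw [show letter (i, false) = (PresentedGroup.of i)⁻¹ from rfl, intMat_gen_inv]; rfl
  · rw [show letter (i, true) = PresentedGroup.of i from rfl, intMat_gen]; rfl

lemma mat_wordProd (w : List (Fin 3 × Bool)) :
    mat (wordProd w) = (wordMat w).map (Int.castRingHom ℝ) := by
  induction w with
  | nil => rw [wordProd, wordMat, List.map_nil, List.map_nil, List.prod_nil, List.prod_nil, mat_one,
      Matrix.map_one _ (map_zero _) (map_one _)]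
  | cons l w ih =>
    rw [wordProd, wordMat, List.map_cons, List.map_cons, List.prod_cons, List.prod_cons, mat_mul,
      Matrix.map_mul, ← mat_gen]
    exact congrArg _ ih

/-- The functional `c ↦ tr (c(w) N)` on cocycles `c`, in the coordinates of `c(x)`, `c(y)`, `c(z)`. -/
def fox : List (Fin 3 × Bool) → Matrix (Fin 4) (Fin 4) ℤ → Fin 3 → Fin 9 → ℤ
  | [], _ => 0
  | (i, true) :: w, N => Pi.single i (pairing N) + fox w (letterMat i false * N * letterMat i true)
  -- From `c(g⁻¹) = -Ad(g⁻¹) c(g)`, with the conjugation moved onto `N` by cyclicity of the trace.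
  | (i, false) :: w, N =>
    Pi.single i (-pairing (letterMat i true * N * letterMat i false)) +
      fox w (letterMat i true * N * letterMat i false)

/-- The evaluation of an integral functional on a cocycle. -/
def evalFun (c : cocycles₁ coeff) (F : Fin 3 → Fin 9 → ℤ) : ℝ :=
  ∑ i, ∑ k, coord (val c (PresentedGroup.of i)) k * (F i k : ℝ)

lemma evalFun_zero (c : cocycles₁ coeff) : evalFun c 0 = 0 := by simp [evalFun]

lemma evalFun_add (c : cocycles₁ coeff) (F G : Fin 3 → Fin 9 → ℤ) :
    evalFun c (F + G) = evalFun c F + evalFun c G := by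
  simp [evalFun, mul_add, Finset.sum_add_distrib]

lemma evalFun_smul (c : cocycles₁ coeff) (a : ℤ) (F : Fin 3 → Fin 9 → ℤ) :
    evalFun c (a • F) = a * evalFun c F := by
  simp only [evalFun, Finset.mul_sum, Pi.smul_apply, smul_eq_mul, Int.cast_mul]
  exact Finset.sum_congr rfl fun i _ => Finset.sum_congr rfl fun k _ => by ring

lemma evalFun_sum {ι : Type*} (s : Finset ι) (c : cocycles₁ coeff) (F : ι → Fin 3 → Fin 9 → ℤ) :
    evalFun c (∑ m ∈ s, F m) = ∑ m ∈ s, evalFun c (F m) := by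
  classical
  induction s using Finset.induction_on with
  | empty => simp [evalFun_zero]
  | insert m s hm ih => rw [Finset.sum_insert hm, Finset.sum_insert hm, evalFun_add, ih]

lemma evalFun_single (c : cocycles₁ coeff) (i : Fin 3) (v : Fin 9 → ℤ) :
    evalFun c (Pi.single i v) = ∑ k, coord (val c (PresentedGroup.of i)) k * (v k : ℝ) := by
  rw [evalFun, Finset.sum_eq_single i]
  · rw [Pi.single_eq_same]
  · intro b _ hb; rw [Pi.single_eq_of_ne hb]; simp
  · intro h; exact absurd (Finset.mem_univ i) h

lemma trace_val_mul (c : cocycles₁ coeff) (g h : Γ) (N : Matrix (Fin 4) (Fin 4) ℝ) :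
    (val c (g * h) * N).trace = (val c g * N).trace + (val c h * (mat g⁻¹ * N * mat g)).trace := by
  rw [val_mul, Matrix.add_mul, Matrix.trace_add, Matrix.mul_assoc (mat g), Matrix.mul_assoc (mat g),
    Matrix.trace_mul_comm (mat g)]
  simp only [Matrix.mul_assoc]

lemma trace_val_inv (c : cocycles₁ coeff) (g : Γ) (N : Matrix (Fin 4) (Fin 4) ℝ) :
    (val c g⁻¹ * N).trace = -(val c g * (mat g * N * mat g⁻¹)).trace := by
  rw [val_inv, Matrix.neg_mul, Matrix.trace_neg, Matrix.mul_assoc (mat g⁻¹),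
    Matrix.mul_assoc (mat g⁻¹), Matrix.trace_mul_comm (mat g⁻¹)]
  simp only [Matrix.mul_assoc]

/-- Peeling off the first letter `g` replaces `N` by `g⁻¹ N g` for the rest of the word, so the
induction has to run over all `N`. -/
lemma trace_val_wordProd (c : cocycles₁ coeff) (w : List (Fin 3 × Bool))
    (N : Matrix (Fin 4) (Fin 4) ℤ) :
    (val c (wordProd w) * N.map (Int.castRingHom ℝ)).trace = evalFun c (fox w N) := by
  induction w generalizing N with
  | nil => simp [wordProd, val_one, fox, evalFun_zero]
  | cons l w ih =>
    obtain ⟨i, s⟩ := l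
    have hl : wordProd ((i, s) :: w) = letter (i, s) * wordProd w := by
      rw [wordProd, List.map_cons, List.prod_cons]; rfl
    have hinv : (letter (i, s))⁻¹ = letter (i, !s) := by cases s <;> simp [letter]
    have hconj : mat (letter (i, s))⁻¹ * N.map (Int.castRingHom ℝ) * mat (letter (i, s)) =
        (letterMat i (!s) * N * letterMat i s).map (Int.castRingHom ℝ) := by
      rw [hinv, mat_gen, mat_gen, Matrix.map_mul, Matrix.map_mul]
    rw [hl, trace_val_mul, hconj, ih]
    cases s
    · have h2 : mat (PresentedGroup.of i : Γ) * N.map (Int.castRingHom ℝ) *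
          mat (PresentedGroup.of i)⁻¹ =
          (letterMat i true * N * letterMat i false).map (Int.castRingHom ℝ) := by
        rw [Matrix.map_mul, Matrix.map_mul, ← mat_gen, ← mat_gen]; rfl
      have h1 := trace_val_inv c (PresentedGroup.of i) (N.map (Int.castRingHom ℝ))
      rw [h2, trace_mul_map (val_mem c (PresentedGroup.of i)), ← Finset.sum_neg_distrib] at h1
      rw [fox, evalFun_add, evalFun_single]
      refine congrArg₂ _ (h1.trans (Finset.sum_congr rfl fun k _ => ?_)) rfl
      rw [Pi.neg_apply, Int.cast_neg, mul_neg]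
    · rw [fox, evalFun_add, evalFun_single]
      exact congrArg₂ _ (trace_mul_map (val_mem _ _) _) rfl

/-! ### The first cohomology -/

/-- The test words, as lists of letters. -/
def testList : Fin 6 → List (Fin 3 × Bool) :=
  ![[(0, false), (1, true)], [(0, true), (2, true)], [(1, true), (2, true)],
    [(0, true), (1, true), (2, true)], [(1, true), (2, true), (0, false)],
    [(2, true), (0, true), (1, false)]]

lemma wordProd_testList (i : Fin 6) : wordProd (testList i) = testWord i := by
  fin_cases i <;> simp [testList, wordProd, letter, testWord, x, y, z, mul_assoc]

lemma traceDeriv_testWord (c : cocycles₁ coeff) (i : Fin 6) :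
    traceDeriv (testWord i) c = evalFun c (fox (testList i) (wordMat (testList i))) := by
  rw [traceDeriv_apply, ← trace_val_wordProd, ← mat_wordProd, wordProd_testList]

/-- The matrix of trace derivatives. -/
def traceMatrix : Matrix (Fin 6) (Fin 6) ℤ :=
  !![4, -4, 4, -4, 0, 0; 4, -4, 0, 0, 4, -4; 0, 0, -4, 4, -4, 4; -60, -60, -60, -60, -60, -60;
    -4, -4, 4, 4, 4, 4; 4, 4, -4, -4, 4, 4]

/-- The generator number of the stable letter. -/
def stableIndex : Fin 6 → Fin 3 := ![0, 0, 1, 1, 2, 2]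

lemma of_stableIndex (j : Fin 6) : PresentedGroup.of (stableIndex j) = stableLetter j := by
  fin_cases j <;> rfl

lemma gen_mem_baseGroup_of_ne {j : Fin 6} {i : Fin 3} (h : i ≠ stableIndex j) :
    PresentedGroup.of i ∈ baseGroup j := by
  have h1 : ∀ {a b : Γ} {H K : Subgroup Γ}, a ∈ Subgroup.closure {a, b} ⊔ H ⊔ K := fun {a b H K} =>
    (le_sup_left.trans le_sup_left : Subgroup.closure {a, b} ≤ Subgroup.closure {a, b} ⊔ H ⊔ K)
      (Subgroup.subset_closure (by simp))
  have h2 : ∀ {a b : Γ} {H K : Subgroup Γ}, b ∈ Subgroup.closure {a, b} ⊔ H ⊔ K := fun {a b H K} =>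
    (le_sup_left.trans le_sup_left : Subgroup.closure {a, b} ≤ Subgroup.closure {a, b} ⊔ H ⊔ K)
      (Subgroup.subset_closure (by simp))
  fin_cases j <;> fin_cases i
  exacts [absurd rfl h, h1, h2, absurd rfl h, h1, h2,
    h2, absurd rfl h, h1, h2, absurd rfl h, h1,
    h1, h2, absurd rfl h, h1, h2, absurd rfl h]

/-- The integral tangent vector of the `j`-th bending. -/
def intTangent (j : Fin 6) : Matrix (Fin 4) (Fin 4) ℤ := 1 - Matrix.of fun a b => 4 * intProj j a b

lemma bendTangent_eq_map (j : Fin 6) :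
    bendTangent j = (intTangent j).map (Int.castRingHom ℝ) := by
  rw [bendTangent, proj_eq_map, intTangent]
  ext a b
  by_cases hab : a = b <;> simp [hab]

lemma evalFun_tangent (j : Fin 6) (F : Fin 3 → Fin 9 → ℤ) : evalFun (tangent j) F =
    ((∑ k, intCoord (intTangent j) k * F (stableIndex j) k : ℤ) : ℝ) := by
  rw [evalFun, Finset.sum_eq_single (stableIndex j)]
  · rw [of_stableIndex, val_tangent_stableLetter, bendTangent_eq_map]
    push_cast
    exact Finset.sum_congr rfl fun k _ => by rw [coord_map]
  · intro i _ hi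
    rw [val_tangent_of_mem j (gen_mem_baseGroup_of_ne hi)]
    simp
  · intro h; exact absurd (Finset.mem_univ _) h

lemma traceDeriv_tangent (i j : Fin 6) :
    traceDeriv (testWord i) (tangent j) = traceMatrix.map (Int.castRingHom ℝ) i j := by
  have h : Matrix.of (fun i j => ∑ k, intCoord (intTangent j) k *
      fox (testList i) (wordMat (testList i)) (stableIndex j) k) = traceMatrix := by
    decide +kernel
  rw [traceDeriv_testWord, evalFun_tangent]
  exact congrArg _ (congrFun (congrFun h i) j)

lemma det_traceMatrix : (traceMatrix.map (Int.castRingHom ℝ)).det ≠ 0 := by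
  -- The second factor is 240 times the inverse; with this certificate no determinant has to be
  -- expanded.
  have h : traceMatrix * !![15, 15, 15, -1, -15, 0; -15, -15, -15, -1, -15, 0;
      15, -15, -15, -1, 0, -15; -15, 15, 15, -1, 0, -15; -15, 15, -15, 0, 15, 15;
      15, -15, 15, 0, 15, 15] = (240 : ℤ) • 1 := by
    decide +kernel
  have h2 := congrArg Matrix.det h
  rw [Matrix.det_mul, Matrix.det_smul, Matrix.det_one, Fintype.card_fin] at h2
  have h3 : traceMatrix.det ≠ 0 := left_ne_zero_of_mul (h2.trans_ne (by norm_num))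
  rw [← RingHom.mapMatrix_apply, ← RingHom.map_det]
  simpa using h3

/-! ### Linear relations among the values of a cocycle on the generators -/

/-- The two relators, as lists of letters. -/
def relatorList : Fin 2 → List (Fin 3 × Bool) :=
  ![[(0, true), (1, false), (2, true), (1, true), (2, false), (0, false), (2, true), (1, false),
      (2, false), (1, true)],
    [(1, true), (2, false), (0, true), (2, true), (0, false), (1, false), (0, true), (2, false),
      (0, false), (2, true)]]

lemma wordProd_relatorList (i : Fin 2) : wordProd (relatorList i) = 1 := by
  fin_cases i
  · rw [← relation_one, commutatorElement_def, commutatorElement_def]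
    simp [relatorList, wordProd, letter, x, y, z, mul_assoc]
  · rw [← relation_two, commutatorElement_def, commutatorElement_def]
    simp [relatorList, wordProd, letter, x, y, z, mul_assoc]

/-- A cocycle vanishes on the identity, which is the value of the relator in `Γ`. -/
lemma evalFun_relator (c : cocycles₁ coeff) (i : Fin 2) (N : Matrix (Fin 4) (Fin 4) ℤ) :
    evalFun c (fox (relatorList i) N) = 0 := by
  rw [← trace_val_wordProd, wordProd_relatorList, val_one, Matrix.zero_mul, Matrix.trace_zero]

/-- Matrix entries of the two relations among the values of a cocycle on the generators. -/
def relatorEntry : Fin 12 → Fin 2 × Fin 4 × Fin 4 :=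
  ![(1, 2, 1), (1, 2, 3), (0, 2, 1), (1, 1, 1), (0, 1, 1), (1, 2, 2), (0, 3, 1), (1, 1, 3), (0, 2,
      3), (0, 3, 3), (0, 0, 3), (0, 1, 0)]

/-- The relations `relatorEntry` as functionals. -/
def relatorFun : Fin 12 → Fin 3 → Fin 9 → ℤ :=
  ![![![12, 8, -4, -12, 4, 0, 20, -12, -12], ![0, 0, 0, 0, 4, 0, 4, 0, 0], ![12, 20, 16, -8, -16,
      16, 8, -20, -24]],
    ![![24, 20, 4, -24, 12, 0, 40, -24, -12], ![-32, -36, -60, 0, 0, 24, 0, 24, -60], ![20, 36, 24,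
        -12, -20, 24, 12, -36, -32]],
    ![![-36, -60, -32, 24, 0, 0, -24, 60, 0], ![36, 24, 20, 24, 12, 20, 36, 32, 12], ![20, 4, 24,
        0, 24, -12, 24, 12, 40]],
    ![![80, 88, 56, -56, 24, -24, 80, -88, 24], 0, ![0, 0, 0, 0, -40, 48, 0, 0, -64]],
    ![![-16, -32, -16, 8, 0, 0, -8, 32, 0], 0, 0],
    ![0, ![-16, -16, -32, 0, 0, 8, 0, 8, -32], 0],
    ![![0, 0, 0, 0, 0, 4, 0, 0, -4], ![-20, -16, -12, -16, -8, -16, -20, -24, -8], ![-8, 4, -12, 0,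
        -12, 4, -12, -12, -20]],
    ![![88, 108, 44, -76, 24, -16, 104, -116, -8], ![0, 0, 0, -4, 8, 0, 8, 0, 0], ![12, 20, 16, -8,
        -44, 60, 8, -20, -76]],
    ![![0, 0, 0, 0, -4, 8, 0, 0, -8], ![-20, -16, -12, -60, -8, -44, -20, -76, -8], ![-108, -44,
        -88, 16, -76, 24, -116, -8, -104]],
    ![0, ![0, 0, 0, 48, 0, 40, 0, 64, 0], ![88, 56, 80, -24, 56, -24, 88, -24, 80]],
    ![![0, 0, 0, 0, -4, 8, 0, 0, -8], ![-20, -16, -12, -76, -8, -60, -20, -100, -8], ![-132, -60,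
        -112, 24, -92, 32, -140, 0, -128]],
    ![![40, 68, 36, -24, 0, 0, 24, -68, 0], ![-36, -24, -20, -24, -12, -20, -36, -32, -12], ![-20,
        -4, -24, 0, -24, 12, -24, -12, -40]]]

/-- Pairing with the matrix unit at `(a, b)` extracts the entry `(b, a)` of the cocycle on a
relator. Of the 32 entries only these twelve are needed: they leave 27 - 12 = 15 = 6 + 9 parameters.
-/
lemma evalFun_relatorFun (c : cocycles₁ coeff) (t : Fin 12) : evalFun c (relatorFun t) = 0 := by
  have h : relatorFun = fun t => fox (relatorList (relatorEntry t).1)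
      (Matrix.single (relatorEntry t).2.1 (relatorEntry t).2.2 1) := by
    decide +kernel
  rw [h, evalFun_relator]

/-- The derivatives of the traces of the six test words, as functionals. -/
def traceFun : Fin 6 → Fin 3 → Fin 9 → ℤ :=
  ![![![12, 14, 18, -8, 4, -8, 8, -12, 16], ![-12, -14, -18, 8, -4, 8, -8, 12, -16], 0],
    ![![-6, -2, -4, 0, 0, -4, -4, 0, 0], 0, ![-14, -18, -12, 8, 8, -4, -12, 16, 8]],
    ![0, ![-18, -12, -14, -4, -8, -8, -16, -8, -12], ![-2, -4, -6, -4, 0, 0, 0, 0, -4]],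
    ![![-60, -20, -60, 20, -20, -20, -40, 0, -40], ![-60, -60, -20, 20, 20, 20, -40, 40, 0], ![-20,
        -60, -60, -20, -20, 20, 0, 40, -40]],
    ![![68, 68, 100, -28, 36, -36, 48, -48, 96], ![-68, -68, -100, 28, -36, 36, -48, 48, -96],
        ![-12, -20, -12, 4, -12, 4, -8, 16, -8]],
    ![![-12, -12, -20, 12, -4, 4, -8, 8, -16], ![100, 68, 68, -36, 36, -28, 96, -48, 48], ![-100,
        -68, -68, 36, -36, 28, -96, 48, -48]]]

lemma evalFun_traceFun (c : cocycles₁ coeff) (i : Fin 6) :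
    evalFun c (traceFun i) = traceDeriv (testWord i) c := by
  have h : traceFun = fun i => fox (testList i) (wordMat (testList i)) := by
    decide +kernel
  rw [h, traceDeriv_testWord]

/-- A basis of `ν₄` dual to the coordinates. -/
def nuBasis (m : Fin 9) : Matrix (Fin 4) (Fin 4) ℤ :=
  (![!![-1, 0, 0, 0; 0, 1, 0, 0; 0, 0, 0, 0; 0, 0, 0, 0],
    !![-1, 0, 0, 0; 0, 0, 0, 0; 0, 0, 1, 0; 0, 0, 0, 0],
    !![-1, 0, 0, 0; 0, 0, 0, 0; 0, 0, 0, 0; 0, 0, 0, 1],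
    !![0, 0, 0, 0; 0, 0, 1, 0; 0, 1, 0, 0; 0, 0, 0, 0],
    !![0, 0, 0, 0; 0, 0, 0, 1; 0, 0, 0, 0; 0, 1, 0, 0],
    !![0, 0, 0, 0; 0, 0, 0, 0; 0, 0, 0, 1; 0, 0, 1, 0],
    !![0, -1, 0, 0; 1, 0, 0, 0; 0, 0, 0, 0; 0, 0, 0, 0],
    !![0, 0, -1, 0; 0, 0, 0, 0; 1, 0, 0, 0; 0, 0, 0, 0],
    !![0, 0, 0, -1; 0, 0, 0, 0; 0, 0, 0, 0; 1, 0, 0, 0]] : Fin 9 → Matrix (Fin 4) (Fin 4) ℤ) m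

lemma map_mem_nu4 {V : Matrix (Fin 4) (Fin 4) ℤ} (h₁ : V.trace = 0)
    (h₂ : Vᵀ * Matrix.diagonal ![-1, 1, 1, 1] = Matrix.diagonal ![-1, 1, 1, 1] * V) :
    V.map (Int.castRingHom ℝ) ∈ nu4 := by
  constructor
  · rw [← Int.cast_zero (R := ℝ), ← h₁]
    simp [Matrix.trace]
  · rw [J_eq_map, ← Matrix.transpose_map, ← Matrix.map_mul, ← Matrix.map_mul, h₂]

lemma nuBasis_mem (m : Fin 9) : (nuBasis m).map (Int.castRingHom ℝ) ∈ nu4 := by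
  apply map_mem_nu4
  · revert m; decide +kernel
  · revert m; decide +kernel

/-- The coordinates of the values of principal cocycles on the generators. -/
def principalCoord : Fin 3 → Fin 9 → Fin 9 → ℤ :=
  ![![![0, 0, 0, 0, 0, 0, 0, 0, 0],
      ![-4, -4, -8, 0, 0, -4, 0, 4, 8],
      ![-4, -8, -4, 0, 0, -4, 0, 8, 4],
      ![0, 0, 0, 2, 2, 0, -2, 0, 0],
      ![0, 0, 0, -2, 0, 0, 2, 0, 0],
      ![4, 6, 6, 0, 0, 6, 0, -6, -6],
      ![0, 0, 0, 2, 2, 0, -2, 0, 0],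
      ![-6, -8, -10, 0, 0, -6, 0, 8, 10],
      ![6, 10, 8, 0, 0, 6, 0, -10, -6]],
    ![![-4, -4, -8, 0, 4, 0, 4, 0, -8],
      ![0, 0, 0, 0, 0, 0, 0, 0, 0],
      ![-8, -4, -4, 0, 4, 0, 8, 0, -4],
      ![0, 0, 0, 0, 0, 2, 0, 2, 0],
      ![-6, -4, -6, 0, 6, 0, 6, 0, -6],
      ![0, 0, 0, -2, 0, 2, 0, 2, 0],
      ![8, 6, 10, 0, -6, 0, -6, 0, 10],
      ![0, 0, 0, 2, 0, -2, 0, -2, 0],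
      ![10, 6, 8, 0, -6, 0, -10, 0, 8]],
    ![![-4, -8, -4, -4, 0, 0, -4, -8, 0],
      ![-8, -4, -4, -4, 0, 0, -8, -4, 0],
      ![0, 0, 0, 0, 0, 0, 0, 0, 0],
      ![6, 6, 4, 6, 0, 0, 6, 6, 0],
      ![0, 0, 0, 0, 2, 2, 0, 0, 2],
      ![0, 0, 0, 0, -2, 0, 0, 0, -2],
      ![8, 10, 6, 6, 0, 0, 8, 10, 0],
      ![-10, -8, -6, -6, 0, 0, -10, -6, 0],
      ![0, 0, 0, 0, -2, -2, 0, 0, -2]]]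

lemma principalCoord_eq (i : Fin 3) (k m : Fin 9) : principalCoord i k m =
    intCoord (nuBasis m - letterMat i true * nuBasis m * letterMat i false) k := by
  revert i k m; decide +kernel

lemma coord_principal (v : Fin 9 → ℝ) (i : Fin 3) (k : Fin 9) :
    coord (val (principal (∑ m, v m • ⟨_, nuBasis_mem m⟩)) (PresentedGroup.of i)) k =
      ∑ m, v m * (principalCoord i k m : ℝ) := by
  have h : ∀ m, (nuBasis m).map (Int.castRingHom ℝ) - mat (PresentedGroup.of i) *
      (nuBasis m).map (Int.castRingHom ℝ) * mat (PresentedGroup.of i)⁻¹ =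
      (nuBasis m - letterMat i true * nuBasis m * letterMat i false).map (Int.castRingHom ℝ) := by
    intro m
    rw [Matrix.map_sub _ (map_sub _), Matrix.map_mul, Matrix.map_mul, ← mat_gen, ← mat_gen]
    rfl
  rw [val_principal]
  simp only [Submodule.coe_sum, Submodule.coe_smul, Matrix.mul_sum, Matrix.sum_mul, Matrix.mul_smul,
    Matrix.smul_mul, ← Finset.sum_sub_distrib, ← smul_sub, h, map_sum, map_smul, Finset.sum_apply,
    Pi.smul_apply, coord_map, smul_eq_mul, principalCoord_eq]

/-- The coordinates of an element of `ν₄` such that subtracting its principal cocycle kills the nine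
coordinates of a cocycle that occur here, up to a factor `8`. -/
def normalization : Fin 9 → Fin 3 → Fin 9 → ℤ :=
  ![![![0, 0, 0, 0, 12, -1, 9, 0, 0], ![3, 0, 0, 0, 0, -3, 3, 0, 0], ![0, 0, 0, 0, 0, 12, 0, 0,
      -6]],
    ![![0, 0, 0, 0, -28, 3, -23, 0, 0], ![1, 0, 0, 4, 0, 5, -1, 0, 0], ![0, 0, 0, 0, 0, -36, 0, 0,
        18]],
    ![![0, 0, 0, 0, 16, -1, 13, 0, 0], ![-3, 0, 0, 0, 0, -3, -1, 0, 0], ![0, 0, 0, 0, 0, 16, 0, 0,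
        -6]],
    ![0, ![0, 0, 0, 4, 0, -4, 0, 0, 0], 0],
    ![![0, 0, 0, 0, 4, 0, 4, 0, 0], 0, 0],
    ![0, 0, ![0, 0, 0, 0, 0, 4, 0, 0, -4]],
    ![![0, 0, 0, 0, 4, 0, 0, 0, 0], ![0, 0, 0, 4, 0, -4, 0, 0, 0], 0],
    ![0, ![0, 0, 0, 4, 0, 0, 0, 0, 0], ![0, 0, 0, 0, 0, -4, 0, 0, 4]],
    ![![0, 0, 0, 0, -4, 0, -4, 0, 0], 0, ![0, 0, 0, 0, 0, -4, 0, 0, 0]]]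

/-- The coefficients of the relations in `coordinate_identity`. -/
def relatorWeight : Fin 3 → Fin 9 → Fin 12 → ℤ :=
  ![![![-152, -252, -36, 298, -390, 666, 812, -8, 1462, -266, -1410, -408],
      ![-1470, 810, 11880, -3135, 6345, -3285, -4830, 2310, -10920, 3255, 11610, 13050],
      ![1316, -1224, -12432, 3206, -6900, 4122, 5824, -2116, 12644, -3652, -13320, -14016],
      ![0, 0, 360, 0, 90, 0, 0, 0, 0, 0, 0, 360],
      0,
      0,
      0,
      ![-888, 72, 5556, -1383, 2700, -891, -1512, 1248, -3867, 1296, 4245, 5748],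
      ![-630, 990, 7380, -2070, 4545, -3060, -4230, 1170, -8865, 2475, 9225, 8730]],
    ![0,
      ![-212, 108, 1044, -122, 330, -234, -568, 112, -1118, 394, 1290, 1032],
      ![798, 378, -4356, 483, -855, -459, 102, -858, 942, -561, -1440, -3618],
      0,
      ![368, 108, -1776, 143, -60, -99, -68, -328, 347, -226, -585, -1308],
      0,
      0,
      ![-8, 72, -24, -8, 60, -126, -112, -32, -32, -44, 0, 48],
      ![-694, -414, 3828, -424, 705, 522, 154, 794, -391, 353, 795, 3114]],
    ![![-1426, -4806, -11568, 6809, -15045, 13023, 15226, -1474, 24806, -3703, -22860, -20334],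
      ![-2972, -2052, 11244, -182, -1020, 3726, 3572, 2512, 1972, 1204, 0, 6672],
      ![432, 72, -684, -198, 270, -306, -252, -72, -72, -234, -180, -252],
      ![2242, 3582, -204, -3248, 8025, -8586, -9562, -662, -13667, 1261, 11655, 6618],
      ![-120, 0, 360, -30, 180, 0, -60, 60, -210, 150, 270, 360],
      0,
      ![2752, 5832, 6096, -6608, 15360, -14796, -16912, 208, -25802, 3166, 22950, 16968],
      ![-3176, -4176, 4872, 2809, -7770, 9423, 10436, 1696, 13801, -998, -11295, -3264],
      0]]

/-- The coefficients of the trace derivatives in `coordinate_identity`. -/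
def traceWeight : Fin 3 → Fin 9 → Fin 6 → ℤ :=
  ![![![0, 0, 0, -6, -90, 0],
      ![-540, -540, -540, 36, 810, -270],
      ![360, 360, 360, -36, -810, 270],
      0,
      0,
      0,
      0,
      ![-360, -360, -360, 15, 360, -135],
      ![-180, -180, -180, 27, 540, -135]],
    ![0,
      ![0, 0, 0, -6, 0, -90],
      ![-180, 180, 180, 18, 0, 270],
      0,
      ![0, 0, 0, 9, 0, 135],
      0,
      0,
      0,
      ![180, -180, -180, -15, 0, -225]],
    ![![-180, 900, -180, -54, -1890, -540],
      ![360, -360, -360, -36, -270, -810],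
      ![0, 0, 0, 0, 90, 90],
      ![-180, -180, 180, 45, 1080, 675],
      0,
      0,
      ![0, -720, 360, 72, 1980, 900],
      ![360, 0, -360, -63, -1080, -945],
      0]]

/-- The certificate for the upper bound. It writes every coordinate functional as a combination of
relations, of trace derivatives and of the coordinates of one principal cocycle, whose vector
depends linearly on the given cocycle. If all trace derivatives vanish, only the principal part
survives. -/
lemma coordinate_identity (i : Fin 3) (k : Fin 9) :
    (720 : ℤ) • (Pi.single i (Pi.single k 1) : Fin 3 → Fin 9 → ℤ) =
      ∑ t, relatorWeight i k t • relatorFun t + ∑ t, traceWeight i k t • traceFun t +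
      ∑ m, (90 * principalCoord i k m) • normalization m := by
  revert i k; decide +kernel

/-- A cocycle along which the traces of the six test words are constant is principal. -/
lemma H1π_eq_zero_of_traceDeriv {c : cocycles₁ coeff}
    (h : ∀ i, traceDeriv (testWord i) c = 0) : H1π coeff c = 0 := by
  -- The denominator is 8 = 720 / 90, the quotient of the two factors in `coordinate_identity`.
  set V : nu4 := ∑ m, (evalFun c (normalization m) / 8) • ⟨_, nuBasis_mem m⟩
  suffices hc : c = principal V by rw [hc, H1π_principal]
  refine ext_generators fun i => eq_of_coord_eq (val_mem _ _) (val_mem _ _) (funext fun k => ?_)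
  rw [coord_principal]
  have h1 := congrArg (evalFun c) (coordinate_identity i k)
  rw [evalFun_smul, evalFun_add, evalFun_add, evalFun_sum, evalFun_sum, evalFun_sum,
    evalFun_single] at h1
  simp only [evalFun_smul, evalFun_relatorFun, evalFun_traceFun, h, mul_zero,
      Finset.sum_const_zero, add_zero,
    zero_add, Pi.single_apply, Int.cast_ite, Int.cast_one, Int.cast_zero, mul_ite, mul_one,
    Finset.sum_ite_eq', Finset.mem_univ, if_true] at h1
  have h2 : ∑ m, evalFun c (normalization m) / 8 * (principalCoord i k m : ℝ) =
      (∑ m, ((90 * principalCoord i k m : ℤ) : ℝ) * evalFun c (normalization m)) / 720 := by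
    rw [Finset.sum_div]
    exact Finset.sum_congr rfl fun m _ => by push_cast; ring
  rw [h2, ← h1]
  push_cast
  ring

lemma H1π_eq_of_traceDeriv {c d : cocycles₁ coeff}
    (h : ∀ i, traceDeriv (testWord i) c = traceDeriv (testWord i) d) :
    H1π coeff c = H1π coeff d := by
  have h1 := H1π_eq_zero_of_traceDeriv (c := c - d) fun i =>
    (map_sub (traceDeriv (testWord i)) c d).trans (sub_eq_zero.2 (h i))
  exact sub_eq_zero.1 ((map_sub (H1π coeff).hom c d).symm.trans h1)

/-! ### The basis of `H¹` given by the bendings -/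

lemma traceDeriv_sum_smul (γ : Γ) (a : Fin 6 → ℝ) :
    traceDeriv γ (∑ j, a j • tangent j) = ∑ j, a j * traceDeriv γ (tangent j) := by
  simp [map_sum]

lemma linearIndependent_tangent :
    LinearIndependent ℝ fun j => H1π coeff (tangent j) := by
  rw [Fintype.linearIndependent_iff]
  intro a ha
  have h1 : H1π coeff (∑ j, a j • tangent j) = 0 := by
    rw [← ha, map_sum]
    exact Finset.sum_congr rfl fun j _ => map_smul (H1π coeff).hom _ _
  obtain ⟨V, hV⟩ := exists_principal_of_H1π_eq_zero h1
  have h2 : ∑ j, a j • tangent j = principal V := ext_generators fun i => hV _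
  have h3 : traceMatrix.map (Int.castRingHom ℝ) *ᵥ a = 0 := by
    ext i
    have h4 := traceDeriv_principal (testWord i) V
    rw [← h2, traceDeriv_sum_smul] at h4
    rw [Matrix.mulVec, dotProduct, Pi.zero_apply, ← h4]
    exact Finset.sum_congr rfl fun j _ => by rw [traceDeriv_tangent, mul_comm]
  exact congrFun (Matrix.eq_zero_of_mulVec_eq_zero det_traceMatrix h3)

lemma span_tangent : ⊤ ≤ Submodule.span ℝ (Set.range fun j => H1π coeff (tangent j)) := by
  intro h _
  induction h using H1_induction_on with
  | _ c =>
    set M := traceMatrix.map (Int.castRingHom ℝ)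
    set a := M⁻¹ *ᵥ fun i => traceDeriv (testWord i) c
    have hM : M *ᵥ a = fun i => traceDeriv (testWord i) c := by
      rw [Matrix.mulVec_mulVec, Matrix.mul_nonsing_inv _ (Ne.isUnit det_traceMatrix),
        Matrix.one_mulVec]
    have h1 := H1π_eq_of_traceDeriv (c := c) (d := ∑ j, a j • tangent j) fun i => by
      rw [traceDeriv_sum_smul, ← congrFun hM i, Matrix.mulVec, dotProduct]
      exact Finset.sum_congr rfl fun j _ => by rw [traceDeriv_tangent, mul_comm]
    have h2 : H1π coeff c = ∑ j, a j • H1π coeff (tangent j) := by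
      rw [h1, map_sum]
      exact Finset.sum_congr rfl fun j _ => map_smul (H1π coeff).hom _ _
    rw [h2]
    exact Submodule.sum_mem _ fun j _ =>
      Submodule.smul_mem _ _ (Submodule.subset_span ⟨j, rfl⟩)

/-- The classes of the six bendings form a basis of `H¹(Γ, ν₄)`. -/
def tangentBasis : Module.Basis (Fin 6) ℝ (H1 coeff) :=
  Module.Basis.mk linearIndependent_tangent span_tangent

lemma tangentBasis_apply (j : Fin 6) : tangentBasis j = H1π coeff (tangent j) :=
  Module.Basis.mk_apply _ _ _

lemma finrank_H1 : Module.finrank ℝ (H1 coeff) = 6 := by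
  rw [Module.finrank_eq_card_basis tangentBasis, Fintype.card_fin]

/-! ### The integral Lorentzian form -/

/-- The Lorentzian bilinear form. -/
def lor {R : Type*} [CommRing R] (u v : Fin 4 → R) : R :=
  -(u 0 * v 0) + u 1 * v 1 + u 2 * v 2 + u 3 * v 3

lemma lor_comm {R : Type*} [CommRing R] (u v : Fin 4 → R) : lor u v = lor v u := by
  simp only [lor]; ring

lemma lor_add_left {R : Type*} [CommRing R] (u v w : Fin 4 → R) :
    lor (u + v) w = lor u w + lor v w := by
  simp only [lor, Pi.add_apply]; ring

lemma lor_add_right {R : Type*} [CommRing R] (u v w : Fin 4 → R) :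
    lor u (v + w) = lor u v + lor u w := by
  simp only [lor, Pi.add_apply]; ring

lemma lor_sub_left {R : Type*} [CommRing R] (u v w : Fin 4 → R) :
    lor (u - v) w = lor u w - lor v w := by
  simp only [lor, Pi.sub_apply]; ring

lemma lor_smul_left {R : Type*} [CommRing R] (a : R) (u v : Fin 4 → R) :
    lor (a • u) v = a * lor u v := by
  simp only [lor, Pi.smul_apply, smul_eq_mul]; ring

lemma lor_smul_right {R : Type*} [CommRing R] (a : R) (u v : Fin 4 → R) :
    lor u (a • v) = a * lor u v := by
  simp only [lor, Pi.smul_apply, smul_eq_mul]; ring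

lemma lor_eq_dotProduct (u v : Fin 4 → ℝ) : lor u v = u ⬝ᵥ (J *ᵥ v) := by
  simp [lor, J, dotProduct, Fin.sum_univ_four, Matrix.mulVec_diagonal]

lemma lor_mat (γ : Γ) (u v : Fin 4 → ℝ) : lor (mat γ *ᵥ u) (mat γ *ᵥ v) = lor u v := by
  rw [lor_eq_dotProduct, lor_eq_dotProduct, Matrix.mulVec_mulVec, Matrix.dotProduct_mulVec,
    Matrix.vecMul_mulVec, ← Matrix.dotProduct_mulVec, ← Matrix.mul_assoc, mat_preserves]

/-- The real vector of an integer vector. -/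
def toReal (n : Fin 4 → ℤ) : Fin 4 → ℝ := fun i => n i

lemma lor_toReal (u v : Fin 4 → ℤ) : lor (toReal u) (toReal v) = (lor u v : ℤ) := by
  simp [lor, toReal]

lemma toReal_injective : Function.Injective toReal := fun u v h => by
  ext i; exact Int.cast_injective (congrFun h i)

lemma toReal_add (u v : Fin 4 → ℤ) : toReal (u + v) = toReal u + toReal v := by
  ext i; simp [toReal]

lemma toReal_smul (a : ℤ) (u : Fin 4 → ℤ) : toReal (a • u) = (a : ℝ) • toReal u := by
  ext i; simp [toReal]

lemma mat_mulVec_toReal (γ : Γ) (n : Fin 4 → ℤ) :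
    mat γ *ᵥ toReal n = toReal (intMat γ *ᵥ n) := mat_mulVec_cast γ n

lemma lor_intMat (γ : Γ) (u v : Fin 4 → ℤ) : lor (intMat γ *ᵥ u) (intMat γ *ᵥ v) = lor u v := by
  apply Int.cast_injective (α := ℝ)
  rw [← lor_toReal, ← lor_toReal, ← mat_mulVec_toReal, ← mat_mulVec_toReal, lor_mat]

/-- The action of `Γ` on `ℤ⁴`. -/
def act (γ : Γ) : (Fin 4 → ℤ) ≃ (Fin 4 → ℤ) where
  toFun n := intMat γ *ᵥ n
  invFun n := intMat γ⁻¹ *ᵥ n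
  left_inv n := by
    change intMat γ⁻¹ *ᵥ (intMat γ *ᵥ n) = n
    rw [Matrix.mulVec_mulVec, ← intMat_mul, inv_mul_cancel, intMat_one, Matrix.one_mulVec]
  right_inv n := by
    change intMat γ *ᵥ (intMat γ⁻¹ *ᵥ n) = n
    rw [Matrix.mulVec_mulVec, ← intMat_mul, mul_inv_cancel, intMat_one, Matrix.one_mulVec]

lemma act_apply (γ : Γ) (n : Fin 4 → ℤ) : act γ n = intMat γ *ᵥ n := rfl

lemma act_mul (g h : Γ) (n : Fin 4 → ℤ) : act (g * h) n = act g (act h n) := by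
  rw [act_apply, act_apply, act_apply, intMat_mul, Matrix.mulVec_mulVec]

lemma act_inv_act (γ : Γ) (n : Fin 4 → ℤ) : act γ⁻¹ (act γ n) = n := (act γ).left_inv n

lemma act_act_inv (γ : Γ) (n : Fin 4 → ℤ) : act γ (act γ⁻¹ n) = n := (act γ).right_inv n

lemma lor_act (γ : Γ) (u v : Fin 4 → ℤ) : lor (act γ u) (act γ v) = lor u v := lor_intMat γ u v

lemma act_add_smul {γ : Γ} {v : Fin 4 → ℤ} (hv : act γ v = v) (n : Fin 4 → ℤ) (d : ℤ) :
    act γ (n + d • v) = act γ n + d • v := by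
  rw [act_apply, act_apply] at *
  rw [Matrix.mulVec_add, Matrix.mulVec_smul, hv]

/-! ### Time orientation and finiteness -/

/-- Elements of the holonomy group preserve the time orientation. -/
lemma act_pos (γ : Γ) : ∀ u : Fin 4 → ℤ, lor u u = -1 → 0 < u 0 → 0 < act γ u 0 := by
  -- For a future unit timelike vector `b² + c² < a²`, so `2(|b| + |c|) ≤ 2√2 √(b² + c²) < 3a`. The
  -- first row of each generator and of its inverse has entry 3 in time and two entries `±2` in
  -- space.
  have key : ∀ a b c d : ℤ, -(a * a) + b * b + c * c + d * d = -1 → 0 < a →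
      0 < 3 * a + 2 * b + 2 * c ∧ 0 < 3 * a + 2 * b - 2 * c ∧ 0 < 3 * a - 2 * b + 2 * c ∧
        0 < 3 * a - 2 * b - 2 * c := by
    intro a b c d h ha
    refine ⟨?_, ?_, ?_, ?_⟩ <;>
    nlinarith [sq_nonneg (b + c), sq_nonneg (b - c), sq_nonneg d, sq_nonneg (a + b),
      sq_nonneg (a - b), sq_nonneg (a + c), sq_nonneg (a - c)]
  induction γ using induction_generators with
  | one => intro u _ hu; rwa [act_apply, intMat_one, Matrix.one_mulVec]
  | mul g h hg hh =>
    intro u hu hu0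
    rw [act_mul]
    exact hg _ (by rw [lor_act, hu]) (hh u hu hu0)
  | gen i =>
    intro u hu hu0
    have h1 := key (u 0) (u 1) (u 2) (u 3) (by simpa only [lor] using hu) hu0
    have h2 := key (u 0) (u 2) (u 3) (u 1) (by rw [← hu, lor]; ring) hu0
    have h3 := key (u 0) (u 1) (u 3) (u 2) (by rw [← hu, lor]; ring) hu0
    rw [act_apply, intMat_gen]
    fin_cases i <;> simp [genMatrix, Matrix.mulVec, dotProduct, Fin.sum_univ_four] <;> linarith
  | inv i =>
    intro u hu hu0
    have h1 := key (u 0) (u 1) (u 2) (u 3) (by simpa only [lor] using hu) hu0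
    have h2 := key (u 0) (u 2) (u 3) (u 1) (by rw [← hu, lor]; ring) hu0
    have h3 := key (u 0) (u 1) (u 3) (u 2) (by rw [← hu, lor]; ring) hu0
    rw [act_apply]
    fin_cases i
    · change 0 < (intMat x⁻¹ *ᵥ u) 0
      rw [intMat_x_inv]
      simp [Matrix.mulVec, dotProduct, Fin.sum_univ_four]; linarith
    · change 0 < (intMat y⁻¹ *ᵥ u) 0
      rw [intMat_y_inv]
      simp [Matrix.mulVec, dotProduct, Fin.sum_univ_four]; linarith
    · change 0 < (intMat z⁻¹ *ᵥ u) 0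
      rw [intMat_z_inv]
      simp [Matrix.mulVec, dotProduct, Fin.sum_univ_four]; linarith

/-- The base point of hyperbolic space. -/
def basePoint : Fin 4 → ℤ := ![1, 0, 0, 0]

lemma lor_basePoint (n : Fin 4 → ℤ) : lor basePoint n = -n 0 := by
  simp [lor, basePoint]

lemma sign_eq_of_mul_pos {a b : ℤ} (h : 0 < a * b) : a.sign = b.sign := by
  rcases pos_and_pos_or_neg_and_neg_of_mul_pos h with ⟨ha, hb⟩ | ⟨ha, hb⟩
  · rw [Int.sign_eq_one_of_pos ha, Int.sign_eq_one_of_pos hb]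
  · rw [Int.sign_eq_neg_one_of_neg ha, Int.sign_eq_neg_one_of_neg hb]

lemma cauchy_schwarz (u v : Fin 4 → ℤ) : (u 1 * v 1 + u 2 * v 2 + u 3 * v 3) ^ 2 ≤
    (u 1 ^ 2 + u 2 ^ 2 + u 3 ^ 2) * (v 1 ^ 2 + v 2 ^ 2 + v 3 ^ 2) := by
  nlinarith [sq_nonneg (u 1 * v 2 - u 2 * v 1), sq_nonneg (u 1 * v 3 - u 3 * v 1),
    sq_nonneg (u 2 * v 3 - u 3 * v 2)]

/-- Planes that separate two points of hyperbolic space have bounded normal vectors. -/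
lemma sq_le_of_sign_ne {n q : Fin 4 → ℤ} (hn : lor n n = 1) (hq : lor q q = -1) (hq0 : 0 < q 0)
    (h : (n 0).sign ≠ (-lor q n).sign) : n 0 ^ 2 ≤ q 0 ^ 2 - 1 := by
  have hcs := cauchy_schwarz q n
  set p := q 1 * n 1 + q 2 * n 2 + q 3 * n 3 with hp
  have hs : -lor q n = q 0 * n 0 - p := by rw [lor, hp]; ring
  have e1 : q 1 ^ 2 + q 2 ^ 2 + q 3 ^ 2 = q 0 ^ 2 - 1 := by
    simp only [lor] at hq; linarith
  have e2 : n 1 ^ 2 + n 2 ^ 2 + n 3 ^ 2 = 1 + n 0 ^ 2 := by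
    simp only [lor] at hn; linarith
  rw [e1, e2] at hcs
  have h1 : n 0 * (q 0 * n 0 - p) ≤ 0 := by
    by_contra hlt
    exact h (hs ▸ sign_eq_of_mul_pos (not_le.1 hlt))
  rcases eq_or_ne (n 0) 0 with h0 | h0
  · rw [h0]; nlinarith
  · have h2 : 0 < n 0 ^ 2 := by positivity
    -- Opposite sides mean `n₀(q₀n₀ - p) ≤ 0`. Squaring and Cauchy–Schwarz give `n₀²q₀² ≤ (q₀² -
    -- 1)(1 + n₀²)`, which is the claimed bound.
    have h3 : n 0 ^ 2 * q 0 ≤ n 0 * p := by nlinarith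
    have h4 : (n 0 ^ 2 * q 0) ^ 2 ≤ (n 0 * p) ^ 2 := by
      apply pow_le_pow_left₀ (by positivity) h3
    have h5 : n 0 ^ 2 * (n 0 ^ 2 * q 0 ^ 2) ≤ n 0 ^ 2 * ((q 0 ^ 2 - 1) * (1 + n 0 ^ 2)) := by
      calc n 0 ^ 2 * (n 0 ^ 2 * q 0 ^ 2) = (n 0 ^ 2 * q 0) ^ 2 := by ring
        _ ≤ (n 0 * p) ^ 2 := h4
        _ = n 0 ^ 2 * p ^ 2 := by ring
        _ ≤ _ := mul_le_mul_of_nonneg_left hcs h2.le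
    have h6 := le_of_mul_le_mul_left h5 h2
    nlinarith

/-- Planes that separate the base point from an ideal point, and do not pass through that ideal
point, have bounded normal vectors. -/
lemma abs_le_of_sign_ne {n v : Fin 4 → ℤ} (hn : lor n n = 1) (hv : lor v v = 0) (hv0 : 0 < v 0)
    (hnv : lor n v ≠ 0) (h : (n 0).sign ≠ (-lor n v).sign) : |n 0| ≤ v 0 := by
  have hcs := cauchy_schwarz n v
  set p := n 1 * v 1 + n 2 * v 2 + n 3 * v 3 with hp
  have hs : -lor n v = n 0 * v 0 - p := by rw [lor, hp]; ring
  have e1 : v 1 ^ 2 + v 2 ^ 2 + v 3 ^ 2 = v 0 ^ 2 := by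
    simp only [lor] at hv; linarith
  have e2 : n 1 ^ 2 + n 2 ^ 2 + n 3 ^ 2 = 1 + n 0 ^ 2 := by
    simp only [lor] at hn; linarith
  rw [e1, e2] at hcs
  rcases eq_or_ne (n 0) 0 with h0 | h0
  · rw [h0]; simpa using hv0.le
  · have h1 : n 0 * (n 0 * v 0 - p) < 0 := by
      rcases lt_trichotomy (n 0 * (n 0 * v 0 - p)) 0 with hlt | heq | hgt
      · exact hlt
      · rcases mul_eq_zero.1 heq with h' | h'
        · exact absurd h' h0
        · exact absurd (by linarith) hnv
      · exact absurd (hs ▸ sign_eq_of_mul_pos hgt) h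
    -- Integrality is decisive here: the strict inequality improves by 1. Together with `p² ≤ (1 +
    -- n₀²)v₀²` this bounds `n₀`.
    have h2 : |n 0| * v 0 + 1 ≤ |p| := by
      rcases lt_or_gt_of_ne h0 with hneg | hpos
      · have : 0 < n 0 * v 0 - p := by nlinarith
        rw [abs_of_neg hneg, abs_of_neg (by nlinarith)]; linarith
      · have : n 0 * v 0 - p < 0 := by nlinarith
        rw [abs_of_pos hpos, abs_of_pos (by nlinarith)]; linarith
    have h3 : (|n 0| * v 0 + 1) ^ 2 ≤ |p| ^ 2 :=
      pow_le_pow_left₀ (by positivity) h2 2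
    rw [sq_abs] at h3
    have h4 : |n 0| ^ 2 = n 0 ^ 2 := sq_abs _
    have h5 : 2 * |n 0| * v 0 ≤ v 0 * v 0 := by nlinarith
    have h6 := le_of_mul_le_mul_right h5 hv0
    linarith [abs_nonneg (n 0)]

/-- There are finitely many integral unit vectors with bounded time coordinate. -/
lemma finite_unit (C : ℤ) : {n : Fin 4 → ℤ | lor n n = 1 ∧ |n 0| ≤ C}.Finite := by
  refine (Set.finite_Icc (fun _ : Fin 4 => -(C + 1)) fun _ => C + 1).subset ?_
  rintro n ⟨hn, hC⟩
  have hC0 : 0 ≤ C := (abs_nonneg _).trans hC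
  have h0 : n 0 ^ 2 ≤ C ^ 2 := sq_le_sq' (by linarith [abs_le.1 hC]) (abs_le.1 hC).2
  simp only [lor] at hn
  have h : ∀ i, |n i| ≤ C + 1 := by
    intro i
    apply abs_le_of_sq_le_sq _ (by linarith)
    fin_cases i
    · simp only [Fin.zero_eta]; nlinarith
    · simp only [Fin.mk_one]; nlinarith [sq_nonneg (n 2), sq_nonneg (n 3)]
    · simp only [Fin.reduceFinMk]; nlinarith [sq_nonneg (n 1), sq_nonneg (n 3)]
    · simp only [Fin.reduceFinMk]; nlinarith [sq_nonneg (n 1), sq_nonneg (n 2)]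
  exact ⟨fun i => (abs_le.1 (h i)).1, fun i => (abs_le.1 (h i)).2⟩

/-! ### Weights of the planes -/

/-- The odd character of `ZMod 4`. -/
def oddChar : ZMod 4 → ℤ := ![0, 1, 0, -1]

/-- The coordinates that play the roles of `a`, `b`, `c` in the `k`-th weight. -/
def axes : Fin 3 → Fin 3 → Fin 4 := ![![3, 1, 2], ![1, 2, 3], ![2, 3, 1]]

/-- The weight of the residue class with time coordinate `t` and space coordinates `a`, `b`, `c`. -/
def baseWeight (t a b c : ZMod 4) : ℤ :=
  if 2 * b = 0 ∧ 2 * t = 0 ∧ 2 * c = 0 ∧ t + b + c = 0 then oddChar (a + b)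
  else if b = 0 ∧ 2 * t = 2 ∧ 2 * c = 2 then -oddChar a else 0

/-- The `k`-th weight of a vector modulo `4`. -/
def resWeight (k : Fin 3) (r : Fin 4 → ZMod 4) : ℤ :=
  baseWeight (r 0) (r (axes k 0)) (r (axes k 1)) (r (axes k 2))

/-- Reduction modulo `4`. -/
def res (n : Fin 4 → ℤ) : Fin 4 → ZMod 4 := fun i => n i

lemma eq_vec {α : Type*} (r : Fin 4 → α) : r = ![r 0, r 1, r 2, r 3] := by
  ext i; fin_cases i <;> rfl

lemma res_add_smul (n v : Fin 4 → ℤ) (d : ℤ) : res (n + d • v) = res n + (d : ZMod 4) • res v := by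
  ext i; simp [res]

lemma res_act (γ : Γ) (n : Fin 4 → ℤ) :
    res (act γ n) = (intMat γ).map (Int.cast : ℤ → ZMod 4) *ᵥ res n := by
  ext i; simp [res, act_apply, Matrix.mulVec, dotProduct]

lemma lor_res (u v : Fin 4 → ℤ) : lor (res u) (res v) = (lor u v : ℤ) := by
  simp [lor, res]

/-- Invariance under the generators is the first property for which `baseWeight` is designed. On the
vectors `normal j` the `k`-th weight is `±1`, with opposite signs, for the two spheres with
waistband at the `k`-th cusp, and 0 for the other four. It is odd in the normal, as is the side of
the base point, so `n` and `-n` contribute equally to a crossing sum. -/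
lemma resWeight_genMatrix : ∀ (i k : Fin 3) (p q r s : ZMod 4),
    resWeight k ((genMatrix i).map (Int.cast : ℤ → ZMod 4) *ᵥ ![p, q, r, s]) =
      resWeight k ![p, q, r, s] := by
  decide +kernel

lemma resWeight_act (k : Fin 3) (γ : Γ) :
    ∀ n : Fin 4 → ℤ, resWeight k (res (act γ n)) = resWeight k (res n) := by
  have hgen : ∀ (i : Fin 3) (n : Fin 4 → ℤ),
      resWeight k (res (act (PresentedGroup.of i) n)) = resWeight k (res n) := by
    intro i n
    rw [res_act, intMat_gen, eq_vec (res n), resWeight_genMatrix]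
  induction γ using induction_generators with
  | one => intro n; rw [act_apply, intMat_one, Matrix.one_mulVec]
  | mul g h hg hh => intro n; rw [act_mul, hg, hh]
  | gen i => exact hgen i
  | inv i => intro n; rw [← hgen i, act_act_inv]

/-- The residues modulo `4` of the primitive integral null vectors. -/
def IsNullRes (v : Fin 4 → ZMod 4) : Prop :=
  2 * v 0 = 2 ∧ (2 * v 1 = 2 ∧ 2 * v 2 = 0 ∧ v 3 = v 2 ∨ 2 * v 2 = 2 ∧ 2 * v 3 = 0 ∧ v 1 = v 3 ∨
    2 * v 3 = 2 ∧ 2 * v 1 = 0 ∧ v 2 = v 1)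

instance (v : Fin 4 → ZMod 4) : Decidable (IsNullRes v) := by unfold IsNullRes; infer_instance

/-- Modulo 4, a null vector that is not even has an odd time coordinate and exactly one odd space
coordinate. The two even space coordinates have squares summing to 0 modulo 8, so they agree modulo
4; this last fact is invisible modulo 4. -/
lemma isNullRes_of_zmod_eight : ∀ p q r s : ZMod 8, -(p * p) + q * q + r * r + s * s = 0 →
    ¬(4 * p = 0 ∧ 4 * q = 0 ∧ 4 * r = 0 ∧ 4 * s = 0) →
    IsNullRes ![ZMod.cast p, ZMod.cast q, ZMod.cast r, ZMod.cast s] := by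
  decide +kernel

/-- The second property for which the weights are designed: planes through an ideal point come with
alternating signs. The step of the alternation, 1 or 2, depends on the null vector but not on the
plane. -/
lemma resWeight_shift : ∀ k : Fin 3, ∀ p q r s : ZMod 4, IsNullRes ![p, q, r, s] →
    (∀ t a b c : ZMod 4, lor ![t, a, b, c] ![p, q, r, s] = 0 →
      resWeight k ![t + p, a + q, b + r, c + s] = -resWeight k ![t, a, b, c]) ∨
    (∀ t a b c : ZMod 4, lor ![t, a, b, c] ![p, q, r, s] = 0 →
      resWeight k ![t + 2 * p, a + 2 * q, b + 2 * r, c + 2 * s] = -resWeight k ![t, a, b, c]) := by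
  decide +kernel

lemma isNullRes_res {v : Fin 4 → ℤ} (hv : lor v v = 0) (hodd : ¬∀ i, 2 ∣ v i) :
    IsNullRes (res v) := by
  have h := isNullRes_of_zmod_eight (v 0) (v 1) (v 2) (v 3) (by
    have := congrArg (Int.cast : ℤ → ZMod 8) hv
    simpa [lor] using this) (by
    rintro ⟨h0, h1, h2, h3⟩
    have key : ∀ a : ℤ, 4 * (a : ZMod 8) = 0 → 2 ∣ a := by
      intro a ha
      have h4 : ((4 * a : ℤ) : ZMod 8) = 0 := by push_cast; exact ha
      rw [ZMod.intCast_zmod_eq_zero_iff_dvd] at h4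
      omega
    exact hodd fun i => by fin_cases i; exacts [key _ h0, key _ h1, key _ h2, key _ h3])
  have hc : ∀ a : ℤ, (ZMod.cast (a : ZMod 8) : ZMod 4) = a := fun a =>
    ZMod.cast_intCast (by norm_num : 4 ∣ 8) a
  rw [hc, hc, hc, hc] at h
  rwa [eq_vec (res v)]

/-- Translation by a small multiple of a primitive null vector changes the sign of the weights of the
vectors orthogonal to it. -/
lemma exists_resWeight_add_smul (k : Fin 3) {v : Fin 4 → ℤ} (hv : lor v v = 0)
    (hodd : ¬∀ i, 2 ∣ v i) : ∃ d : ℤ, ∀ n, lor n v = 0 →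
      resWeight k (res (n + d • v)) = -resWeight k (res n) := by
  have h := isNullRes_res hv hodd
  rw [eq_vec (res v)] at h
  have hl : ∀ n, lor n v = 0 →
      lor ![res n 0, res n 1, res n 2, res n 3] ![res v 0, res v 1, res v 2, res v 3] = 0 := by
    intro n hn
    rw [← eq_vec, ← eq_vec, lor_res, hn, Int.cast_zero]
  rcases resWeight_shift k _ _ _ _ h with h | h
  · refine ⟨1, fun n hn => ?_⟩
    rw [res_add_smul, eq_vec (res n), ← h _ _ _ _ (hl n hn)]
    congr 1; ext i; fin_cases i <;> simp
  · refine ⟨2, fun n hn => ?_⟩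
    rw [res_add_smul, eq_vec (res n), ← h _ _ _ _ (hl n hn)]
    congr 1; ext i; fin_cases i <;> simp

/-- The `k`-th weight of an integral vector; it vanishes unless the vector has norm `1`. -/
def weight (k : Fin 3) (n : Fin 4 → ℤ) : ℤ := if lor n n = 1 then resWeight k (res n) else 0

lemma weight_act (k : Fin 3) (γ : Γ) (n : Fin 4 → ℤ) : weight k (act γ n) = weight k n := by
  rw [weight, lor_act, resWeight_act, weight]

lemma weight_of_ne {k : Fin 3} {n : Fin 4 → ℤ} (h : lor n n ≠ 1) : weight k n = 0 := if_neg h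

lemma lor_add_smul_self {R : Type*} [CommRing R] (n v : Fin 4 → R) (d : R) :
    lor (n + d • v) (n + d • v) = lor n n + 2 * d * lor n v + d ^ 2 * lor v v := by
  simp only [lor_add_left, lor_add_right, lor_smul_left, lor_smul_right, lor_comm v n]; ring

lemma exists_weight_add_smul (k : Fin 3) {v : Fin 4 → ℤ} (hv : lor v v = 0)
    (hodd : ¬∀ i, 2 ∣ v i) : ∃ d : ℤ, ∀ n, lor n v = 0 → weight k (n + d • v) = -weight k n := by
  obtain ⟨d, hd⟩ := exists_resWeight_add_smul k hv hodd
  refine ⟨d, fun n hn => ?_⟩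
  have h : lor (n + d • v) (n + d • v) = lor n n := by
    rw [lor_add_smul_self, hn, hv]; ring
  rw [weight, h, hd n hn, weight]
  split_ifs <;> simp

/-! ### Weighted sums over the integral unit vectors -/

/-- A function on `ℤ⁴` is supported on finitely many unit vectors, up to non-unit vectors. -/
def FiniteUnits (s : (Fin 4 → ℤ) → ℤ) : Prop := {n | lor n n = 1 ∧ s n ≠ 0}.Finite

section WeightedSum

variable {M : Type*} [AddCommGroup M] {k : Fin 3} {f : (Fin 4 → ℤ) → M} {s t : (Fin 4 → ℤ) → ℤ}

/-- The sum of the values of `f` over the unit vectors, with the `k`-th weight and multiplicity `s`. -/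
def weightedSum (k : Fin 3) (f : (Fin 4 → ℤ) → M) (s : (Fin 4 → ℤ) → ℤ) : M :=
  ∑ᶠ n, (weight k n * s n) • f n

lemma FiniteUnits.support (hs : FiniteUnits s) :
    Function.HasFiniteSupport fun n => (weight k n * s n) • f n := by
  refine Set.Finite.subset hs fun n hn => ⟨?_, ?_⟩
  · by_contra h
    exact hn (by simp [weight_of_ne h])
  · intro h
    exact hn (by simp [h])

lemma FiniteUnits.add (hs : FiniteUnits s) (ht : FiniteUnits t) :
    FiniteUnits fun n => s n + t n := by
  refine (hs.union ht).subset ?_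
  rintro n ⟨h1, h2⟩
  by_cases h : s n = 0
  · exact Or.inr ⟨h1, fun h' => h2 (by simp [h, h'])⟩
  · exact Or.inl ⟨h1, h⟩

lemma FiniteUnits.neg (hs : FiniteUnits s) : FiniteUnits fun n => -s n := by
  simpa [FiniteUnits] using hs

lemma FiniteUnits.sub (hs : FiniteUnits s) (ht : FiniteUnits t) :
    FiniteUnits fun n => s n - t n := by
  simpa only [sub_eq_add_neg] using hs.add ht.neg

lemma FiniteUnits.comp_equiv (hs : FiniteUnits s) (e : (Fin 4 → ℤ) ≃ (Fin 4 → ℤ))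
    (he : ∀ n, s (e n) ≠ 0 → lor (e n) (e n) = lor n n) : FiniteUnits fun n => s (e n) :=
  (hs.preimage e.injective.injOn).subset fun n hn => ⟨(he n hn.2).trans hn.1, hn.2⟩

lemma weightedSum_add (hs : FiniteUnits s) (ht : FiniteUnits t) :
    weightedSum k f (fun n => s n + t n) = weightedSum k f s + weightedSum k f t := by
  rw [weightedSum, weightedSum, weightedSum, ← finsum_add_distrib hs.support ht.support]
  exact finsum_congr fun n => by rw [mul_add, add_smul]

lemma weightedSum_neg : weightedSum k f (fun n => -s n) = -weightedSum k f s := by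
  rw [weightedSum, weightedSum, ← finsum_neg_distrib]
  exact finsum_congr fun n => by rw [mul_neg, neg_smul]

lemma weightedSum_sub (hs : FiniteUnits s) (ht : FiniteUnits t) :
    weightedSum k f (fun n => s n - t n) = weightedSum k f s - weightedSum k f t := by
  simp only [sub_eq_add_neg]
  rw [weightedSum_add hs ht.neg, weightedSum_neg]

lemma map_weightedSum {N F : Type*} [AddCommGroup N] [FunLike F M N] [AddMonoidHomClass F M N]
    (φ : F) (hs : FiniteUnits s) :
    φ (weightedSum k f s) = weightedSum k (fun n => φ (f n)) s := by
  have h := map_finsum (AddMonoidHomClass.toAddMonoidHom φ) (hs.support (k := k) (f := f))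
  refine h.trans (finsum_congr fun n => ?_)
  exact map_zsmul φ _ _

lemma weightedSum_comp_act (γ : Γ) :
    weightedSum k f s = weightedSum k (fun n => f (act γ n)) fun n => s (act γ n) := by
  rw [weightedSum, ← finsum_comp_equiv (act γ)]
  exact finsum_congr fun n => by rw [weight_act]

lemma weightedSum_eq_sum (S : Finset (Fin 4 → ℤ)) (hS : ∀ n, lor n n = 1 → s n ≠ 0 → n ∈ S) :
    weightedSum k f s = ∑ n ∈ S, (weight k n * s n) • f n := by
  refine finsum_eq_finsetSum_of_support_subset _ fun n hn => ?_
  refine hS n ?_ ?_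
  · by_contra h
    exact hn (by simp [weight_of_ne h])
  · intro h
    exact hn (by simp [h])

end WeightedSum

/-! ### Crossing cocycles -/

open Classical in
/-- The infinitesimal bending along the plane with normal vector `n`; zero if `n` is not a unit
vector. -/
def planeBend (n : Fin 4 → ℤ) : nu4 :=
  if h : lor n n = 1 then
    ⟨1 - (4 : ℝ) • (Matrix.vecMulVec (toReal n) (toReal n) * J), vecMulVec_mul_J_mem _ (by
      rw [← lor_eq_dotProduct, lor_toReal, h, Int.cast_one])⟩
  else 0

lemma coe_planeBend {n : Fin 4 → ℤ} (h : lor n n = 1) : (planeBend n : Matrix (Fin 4) (Fin 4) ℝ) =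
    1 - (4 : ℝ) • (Matrix.vecMulVec (toReal n) (toReal n) * J) := by
  rw [planeBend, dif_pos h]

lemma planeBend_act (γ : Γ) (n : Fin 4 → ℤ) :
    planeBend (act γ n) = coeff.ρ γ (planeBend n) := by
  by_cases h : lor n n = 1
  · have h' : lor (act γ n) (act γ n) = 1 := (lor_act γ n n).trans h
    refine Subtype.ext ?_
    have e : Matrix.vecMulVec (mat γ *ᵥ toReal n) (mat γ *ᵥ toReal n) =
        mat γ * Matrix.vecMulVec (toReal n) (toReal n) * (mat γ)ᵀ := by
      rw [Matrix.mul_vecMulVec, Matrix.vecMulVec_mul, Matrix.vecMul_transpose]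
    rw [coe_coeff_ρ, coe_planeBend h', coe_planeBend h, Matrix.mul_sub, Matrix.sub_mul,
      Matrix.mul_one, mat_mul_mat_inv, Matrix.mul_smul, Matrix.smul_mul, act_apply,
      ← mat_mulVec_toReal, e]
    simp only [Matrix.mul_assoc, mat_transpose_mul_J]
  · have h' : lor (act γ n) (act γ n) ≠ 1 := fun e => h ((lor_act γ n n).symm.trans e)
    rw [planeBend, planeBend, dif_neg h, dif_neg h', map_zero]

/-- The side of the plane with normal vector `n` on which the base point lies. -/
def side (n : Fin 4 → ℤ) : ℤ := (n 0).sign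

lemma act_inv_apply_zero (γ : Γ) (n : Fin 4 → ℤ) : act γ⁻¹ n 0 = -lor (act γ basePoint) n := by
  rw [← lor_act γ⁻¹, act_inv_act, lor_basePoint, neg_neg]

/-- The difference vanishes unless the plane separates the base point from its image under `γ` or
contains one of them, and the integral normals of such planes are bounded. -/
lemma finiteUnits_side_sub (γ : Γ) : FiniteUnits fun n => side n - side (act γ⁻¹ n) := by
  have hq : lor (act γ basePoint) (act γ basePoint) = -1 := by
    rw [lor_act, lor_basePoint]; rfl
  have hq0 : 0 < act γ basePoint 0 := act_pos γ _ (by rw [lor_basePoint]; rfl) (by decide)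
  refine (finite_unit (act γ basePoint 0)).subset ?_
  rintro n ⟨hn, h⟩
  refine ⟨hn, abs_le_of_sq_le_sq ?_ hq0.le⟩
  have := sq_le_of_sign_ne hn hq hq0 (by
    rw [← act_inv_apply_zero]
    exact fun e => h (sub_eq_zero.2 e))
  linarith

lemma coeff_ρ_weightedSum (k : Fin 3) (γ : Γ) {s : (Fin 4 → ℤ) → ℤ} (hs : FiniteUnits s) :
    coeff.ρ γ (weightedSum k planeBend s) = weightedSum k planeBend fun n => s (act γ⁻¹ n) := by
  rw [map_weightedSum _ hs, weightedSum_comp_act γ (f := planeBend)]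
  simp only [act_inv_act, planeBend_act]

/-- The weighted sum of the infinitesimal bendings along the planes that separate the base point from
its image. -/
def crossing (k : Fin 3) : cocycles₁ coeff :=
  mkCocycle (fun γ => weightedSum k planeBend fun n => side n - side (act γ⁻¹ n)) fun g h => by
    rw [← coe_coeff_ρ, coeff_ρ_weightedSum k g (finiteUnits_side_sub h)]
    have hc : FiniteUnits fun n => side (act g⁻¹ n) - side (act h⁻¹ (act g⁻¹ n)) :=
      (finiteUnits_side_sub h).comp_equiv (act g⁻¹) fun n _ => lor_act _ _ _
    rw [← Submodule.coe_add, ← weightedSum_add (finiteUnits_side_sub g) hc]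
    -- Crossings from the base point `o` to `gho` are crossings from `o` to `go` plus those from
    -- `go` to `gho`, the latter being `g` applied to those from `o` to `ho`.
    simp only [mul_inv_rev, act_mul, sub_add_sub_cancel]

/-! ### Fixed vectors of parabolic elements -/

lemma eq_zero_of_lor_self {R : Type*} [CommRing R] [LinearOrder R] [IsStrictOrderedRing R]
    {w : Fin 4 → R} (h : lor w w = 0) (h0 : w 0 = 0) : w = 0 := by
  simp only [lor, h0] at h
  have h1 : w 1 * w 1 = 0 :=
      by nlinarith [mul_self_nonneg (w 1), mul_self_nonneg (w 2), mul_self_nonneg (w 3)]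
  have h2 : w 2 * w 2 = 0 :=
      by nlinarith [mul_self_nonneg (w 1), mul_self_nonneg (w 2), mul_self_nonneg (w 3)]
  have h3 : w 3 * w 3 = 0 :=
      by nlinarith [mul_self_nonneg (w 1), mul_self_nonneg (w 2), mul_self_nonneg (w 3)]
  ext i
  fin_cases i
  exacts [h0, mul_self_eq_zero.1 h1, mul_self_eq_zero.1 h2, mul_self_eq_zero.1 h3]

/-- A null vector orthogonal to a null vector `v` is a multiple of `v`. -/
lemma exists_eq_smul_of_null {u v : Fin 4 → ℝ} (hu : lor u u = 0) (hv : lor v v = 0)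
    (huv : lor u v = 0) (hv0 : v 0 ≠ 0) : ∃ c : ℝ, u = c • v := by
  refine ⟨u 0 / v 0, ?_⟩
  have h : u + (-(u 0 / v 0)) • v = 0 := by
    apply eq_zero_of_lor_self
    · rw [lor_add_smul_self, hu, huv, hv]; ring
    · simp [hv0]
  rw [neg_smul, ← sub_eq_add_neg] at h
  exact sub_eq_zero.1 h

lemma isNilpotent_intMat_sub_one {γ : Γ} (h : IsParabolic γ) : IsNilpotent (intMat γ - 1) := by
  obtain ⟨k, hk⟩ := h.2
  refine ⟨k, ?_⟩
  have e : mat γ - 1 = (Int.castRingHom ℝ).mapMatrix (intMat γ - 1) := by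
    rw [map_sub, map_one, mat_eq_map]; rfl
  rw [e, ← map_pow] at hk
  ext i j
  have := congrFun (congrFun hk i) j
  simpa using this

/-- A parabolic element fixes a primitive integral null vector in the future light cone. -/
lemma exists_null_fixed {γ : Γ} (h : IsParabolic γ) :
    ∃ v : Fin 4 → ℤ, act γ v = v ∧ lor v v = 0 ∧ 0 < v 0 ∧ ¬∀ i, 2 ∣ v i := by
  have hne : intMat γ - 1 ≠ 0 := by
    intro e
    refine h.1 (Subtype.ext ?_)
    change mat γ = 1
    rw [mat_eq_map, sub_eq_zero.1 e]
    exact (Int.castRingHom ℝ).mapMatrix.map_one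
  obtain ⟨w, hw, hwf, hwn⟩ : ∃ w : Fin 4 → ℤ, w ≠ 0 ∧ act γ w = w ∧ lor w w = 0 := by
    have hN := isNilpotent_intMat_sub_one h
    set N := intMat γ - 1 with hN'
    -- Since `N ≠ 0`, its last nonzero power is of the form `N · N ^ k`. Its image is fixed by `γ`
    -- and consists of vectors `γu - u`.
    obtain ⟨k, hk⟩ : ∃ k, nilpotencyClass N = k + 2 := by
      have h0 : nilpotencyClass N ≠ 0 := by
        intro e
        have := pow_nilpotencyClass hN
        rw [e, pow_zero] at this
        exact one_ne_zero this
      have h1 : nilpotencyClass N ≠ 1 := by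
        intro e
        have := pow_nilpotencyClass hN
        rw [e, pow_one] at this
        exact hne this
      exact ⟨nilpotencyClass N - 2, by omega⟩
    have hz : N ^ (k + 2) = 0 := hk ▸ pow_nilpotencyClass hN
    have hp : N ^ (k + 1) ≠ 0 := by
      have := pow_pred_nilpotencyClass hN
      rwa [hk] at this
    obtain ⟨a, ha⟩ : ∃ a, N ^ (k + 1) *ᵥ a ≠ 0 := by
      by_contra! hall
      exact hp (Matrix.ext_of_mulVec_single fun i => by rw [hall, Matrix.zero_mulVec])
    have hact : ∀ u, act γ u = N *ᵥ u + u := by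
      intro u
      rw [act_apply, hN', Matrix.sub_mulVec, Matrix.one_mulVec, sub_add_cancel]
    have hfix : act γ (N ^ (k + 1) *ᵥ a) = N ^ (k + 1) *ᵥ a := by
      rw [hact, Matrix.mulVec_mulVec, ← pow_succ', hz, Matrix.zero_mulVec, zero_add]
    refine ⟨_, ha, hfix, ?_⟩
    -- A fixed vector `w = γu - u` is null, because `lor (γu) w = lor (γu) (γw) = lor u w`.
    have e : N ^ (k + 1) *ᵥ a = act γ (N ^ k *ᵥ a) - N ^ k *ᵥ a := by
      rw [hact, add_sub_cancel_right, Matrix.mulVec_mulVec, ← pow_succ']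
    set w := N ^ (k + 1) *ᵥ a
    calc lor w w = lor (act γ (N ^ k *ᵥ a)) (act γ w) - lor (N ^ k *ᵥ a) w := by
          rw [hfix, ← lor_sub_left, ← e]
      _ = 0 := by rw [lor_act, sub_self]
  obtain ⟨u, hu⟩ : ∃ u : Fin 4 → ℤ, act γ u = u ∧ lor u u = 0 ∧ 0 < u 0 := by
    rcases lt_trichotomy (w 0) 0 with h0 | h0 | h0
    · refine ⟨-w, ?_, ?_, by simpa using h0⟩
      · rw [act_apply, Matrix.mulVec_neg, ← act_apply, hwf]
      · rw [← hwn]; simp only [lor, Pi.neg_apply]; ring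
    · exact absurd (eq_zero_of_lor_self hwn h0) hw
    · exact ⟨w, hwf, hwn, h0⟩
  -- A fixed future null vector with least time coordinate cannot be even, since its half would be
  -- another one.
  have hS : {m : ℕ | ∃ u : Fin 4 → ℤ, act γ u = u ∧ lor u u = 0 ∧ 0 < u 0 ∧ u 0 = m}.Nonempty :=
    ⟨(u 0).toNat, u, hu.1, hu.2.1, hu.2.2, (Int.toNat_of_nonneg hu.2.2.le).symm⟩
  obtain ⟨v, hvf, hvn, hv0, hvm⟩ := Nat.sInf_mem hS
  refine ⟨v, hvf, hvn, hv0, fun heven => ?_⟩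
  choose b hb using heven
  have hvb : v = (2 : ℤ) • b := by ext i; simp [hb i]
  have hb0 : 0 < b 0 := by have := hb 0; omega
  have hle : sInf _ ≤ (b 0).toNat := Nat.sInf_le (s := {m : ℕ | ∃ u : Fin 4 → ℤ,
      act γ u = u ∧ lor u u = 0 ∧ 0 < u 0 ∧ u 0 = m}) ⟨b, ?_, ?_, hb0,
      (Int.toNat_of_nonneg hb0.le).symm⟩
  · have := hb 0; omega
  · have h2 : (2 : ℤ) • act γ b = (2 : ℤ) • b := by
      rw [← hvb, ← hvf, hvb, act_apply, act_apply, Matrix.mulVec_smul]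
    exact smul_right_injective _ (two_ne_zero : (2 : ℤ) ≠ 0) h2
  · rw [hvb, lor_smul_left, lor_smul_right] at hvn
    omega

/-- A parabolic element translates the vectors orthogonal to its fixed null vector `v` along `v`. -/
lemma exists_mulVec_eq_add_smul {γ : Γ} (h : IsParabolic γ) {v : Fin 4 → ℝ} (hfix : mat γ *ᵥ v = v)
    (hv : lor v v = 0) (hv0 : v 0 ≠ 0) {n : Fin 4 → ℝ} (hn : lor n v = 0) :
    ∃ c : ℝ, mat γ *ᵥ n = n + c • v := by
  obtain ⟨k, hk⟩ := h.2
  set N := mat γ - 1 with hN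
  have hmat : ∀ u, mat γ *ᵥ u = u + N *ᵥ u := by
    intro u
    rw [hN, Matrix.sub_mulVec, Matrix.one_mulVec, add_sub_cancel]
  have horth : ∀ u, lor u v = 0 → lor (N *ᵥ u) v = 0 := by
    intro u hu
    rw [hN, Matrix.sub_mulVec, Matrix.one_mulVec, lor_sub_left, hu, sub_zero, ← hu]
    conv_lhs => rw [← hfix, lor_mat]
  -- Induction on the nilpotency order of the vector: if `N(Nn)` is a multiple of `v`, then `Nn` is
  -- null and orthogonal to `v`, hence also a multiple of `v`.
  suffices H : ∀ k, ∀ n, lor n v = 0 → N ^ k *ᵥ n = 0 → ∃ c : ℝ, N *ᵥ n = c • v by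
    obtain ⟨c, hc⟩ := H k n hn (by rw [hk, Matrix.zero_mulVec])
    exact ⟨c, by rw [hmat, hc]⟩
  intro k
  induction k with
  | zero =>
    intro n _ h0
    rw [pow_zero, Matrix.one_mulVec] at h0
    exact ⟨0, by rw [h0, Matrix.mulVec_zero, zero_smul]⟩
  | succ k ih =>
    intro n hn h0
    rw [pow_succ, ← Matrix.mulVec_mulVec] at h0
    obtain ⟨c, hc⟩ := ih _ (horth n hn) h0
    refine exists_eq_smul_of_null ?_ hv (horth n hn) hv0
    -- Expanding the invariance of the form on `n` and `Nn`, all terms containing `v` vanish and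
    -- `lor (Nn) (Nn) = 0` remains.
    have e := lor_mat γ n (N *ᵥ n)
    rw [hmat n, hmat (N *ᵥ n), hc, lor_add_left, lor_add_right, lor_add_right, lor_smul_right,
      lor_smul_right, hn, horth n hn] at e
    linarith

/-! ### The trace form -/

/-- The trace form on `ν₄`. -/
def traceForm : nu4 →ₗ[ℝ] nu4 →ₗ[ℝ] ℝ :=
  LinearMap.mk₂ ℝ (fun V W => ((V : Matrix (Fin 4) (Fin 4) ℝ) * (W : Matrix _ _ ℝ)).trace)
    (fun U V W => by simp [Matrix.add_mul]) (fun a V W => by simp)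
    (fun U V W => by simp [Matrix.mul_add]) (fun a V W => by simp)

lemma traceForm_apply (V W : nu4) :
    traceForm V W = ((V : Matrix (Fin 4) (Fin 4) ℝ) * (W : Matrix _ _ ℝ)).trace := rfl

lemma traceForm_comm (V W : nu4) : traceForm V W = traceForm W V := by
  rw [traceForm_apply, traceForm_apply, Matrix.trace_mul_comm]

lemma transpose_mem_nu4 {V : Matrix (Fin 4) (Fin 4) ℝ} (hV : V ∈ nu4) : Vᵀ ∈ nu4 := by
  refine ⟨by rw [Matrix.trace_transpose, hV.1], ?_⟩
  rw [Matrix.transpose_transpose]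
  calc V * J = J * J * V * J := by rw [J_mul_J, Matrix.one_mul]
    _ = J * (J * V) * J := by simp only [Matrix.mul_assoc]
    _ = J * (Vᵀ * J) * J := by rw [hV.2]
    _ = J * Vᵀ * (J * J) := by simp only [Matrix.mul_assoc]
    _ = J * Vᵀ := by rw [J_mul_J, Matrix.mul_one]

/-- The form is indefinite, but `Vᵀ` is again in `ν₄` and pairs with `V` to the sum of the squares
of the entries. -/
lemma traceForm_injective : Function.Injective traceForm := by
  rw [injective_iff_map_eq_zero]
  intro V hV
  have h := LinearMap.congr_fun hV ⟨_, transpose_mem_nu4 V.2⟩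
  rw [traceForm_apply, LinearMap.zero_apply] at h
  change ((V : Matrix (Fin 4) (Fin 4) ℝ) * (V : Matrix (Fin 4) (Fin 4) ℝ)ᵀ).trace = 0 at h
  rw [← Matrix.conjTranspose_eq_transpose_of_trivial,
    Matrix.trace_mul_conjTranspose_self_eq_zero_iff] at h
  exact Subtype.ext h

lemma traceForm_ρ (γ : Γ) (V W : nu4) :
    traceForm (coeff.ρ γ V) (coeff.ρ γ W) = traceForm V W := by
  rw [traceForm_apply, traceForm_apply, coe_coeff_ρ, coe_coeff_ρ]
  calc (mat γ * (V : Matrix _ _ ℝ) * mat γ⁻¹ * (mat γ * (W : Matrix _ _ ℝ) * mat γ⁻¹)).trace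
      = (mat γ * (V : Matrix _ _ ℝ) * (mat γ⁻¹ * mat γ) * (W : Matrix _ _ ℝ) * mat γ⁻¹).trace := by
        simp only [Matrix.mul_assoc]
    _ = (mat γ⁻¹ * (mat γ * ((V : Matrix _ _ ℝ) * (W : Matrix _ _ ℝ)))).trace := by
        rw [mat_inv_mul_mat, Matrix.mul_one, Matrix.trace_mul_comm]
        simp only [Matrix.mul_assoc]
    _ = _ := by rw [← Matrix.mul_assoc, mat_inv_mul_mat, Matrix.one_mul]

/-- The image of `1 - Ad γ` is the orthogonal complement of the invariants of `γ`. -/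
lemma mem_range_of_traceForm_eq_zero {γ : Γ} {X : nu4}
    (h : ∀ W : nu4, coeff.ρ γ W = W → traceForm X W = 0) :
    X ∈ LinearMap.range (LinearMap.id - coeff.ρ γ) := by
  by_contra hX
  -- A functional that kills the image but not `X` is the pairing with some `W`. Killing the image
  -- makes `W` invariant under `γ`, which contradicts `h`.
  obtain ⟨ℓ, hℓ, hR⟩ := Submodule.exists_le_ker_of_notMem hX
  have hsurj : Function.Surjective traceForm :=
    (LinearMap.injective_iff_surjective_of_finrank_eq_finrank
      (Subspace.dual_finrank_eq (K := ℝ) (V := nu4)).symm).1 traceForm_injective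
  obtain ⟨W, rfl⟩ := hsurj ℓ
  refine hℓ ?_
  rw [traceForm_comm]
  refine h W (traceForm_injective (LinearMap.ext fun V => ?_))
  have h1 := hR ⟨coeff.ρ γ⁻¹ V, rfl⟩
  rw [LinearMap.mem_ker, LinearMap.sub_apply, LinearMap.id_apply, Representation.self_inv_apply,
    map_sub, sub_eq_zero] at h1
  rw [← h1, ← traceForm_ρ γ W, Representation.self_inv_apply]

/-! ### Crossing cocycles are parabolic -/

lemma lor_mulVec {W : Matrix (Fin 4) (Fin 4) ℝ} (hW : W ∈ nu4) (a b : Fin 4 → ℝ) :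
    lor (W *ᵥ a) b = lor a (W *ᵥ b) := by
  rw [lor_eq_dotProduct, lor_eq_dotProduct, Matrix.mulVec_mulVec, ← hW.2, ← Matrix.mulVec_mulVec,
    ← Matrix.vecMul_transpose, ← Matrix.dotProduct_mulVec]

lemma traceForm_planeBend {n : Fin 4 → ℤ} (hn : lor n n = 1) (W : nu4) :
    traceForm (planeBend n) W =
      -4 * lor (toReal n) ((W : Matrix (Fin 4) (Fin 4) ℝ) *ᵥ toReal n) := by
  rw [traceForm_apply, coe_planeBend hn, Matrix.sub_mul, Matrix.one_mul, Matrix.trace_sub, W.2.1,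
    Matrix.smul_mul, Matrix.trace_smul, Matrix.mul_assoc, Matrix.vecMulVec_mul,
    Matrix.trace_vecMulVec, lor_eq_dotProduct, Matrix.mulVec_mulVec, Matrix.dotProduct_mulVec,
    dotProduct_comm, smul_eq_mul]
  ring

/-- An invariant quadratic form is unchanged when a vector moved by a parabolic element is translated
along the fixed null vector. -/
lemma lor_mulVec_add_smul {γ : Γ} {W : nu4} (hW : coeff.ρ γ W = W) {v n : Fin 4 → ℝ}
    (hfix : mat γ *ᵥ v = v) {c : ℝ} (hc : mat γ *ᵥ n = n + c • v) (hc0 : c ≠ 0) (d : ℝ) :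
    lor (n + d • v) ((W : Matrix (Fin 4) (Fin 4) ℝ) *ᵥ (n + d • v)) =
      lor n ((W : Matrix (Fin 4) (Fin 4) ℝ) *ᵥ n) := by
  set w : Matrix (Fin 4) (Fin 4) ℝ := W.1 with hw
  have hcomm : ∀ u, w *ᵥ (mat γ *ᵥ u) = mat γ *ᵥ (w *ᵥ u) := by
    intro u
    have h0 : mat γ * w * mat γ⁻¹ = w := (coe_coeff_ρ γ W).symm.trans (congrArg Subtype.val hW)
    have h : w * mat γ = mat γ * w := by
      conv_lhs => rw [← h0, Matrix.mul_assoc, mat_inv_mul_mat, Matrix.mul_one]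
    rw [Matrix.mulVec_mulVec, Matrix.mulVec_mulVec, h]
  have hinv : ∀ u, lor (mat γ *ᵥ u) (w *ᵥ (mat γ *ᵥ u)) = lor u (w *ᵥ u) := by
    intro u
    rw [hcomm, lor_mat]
  have hexp : ∀ a : ℝ, lor (n + a • v) (w *ᵥ (n + a • v)) =
      lor n (w *ᵥ n) + 2 * a * lor n (w *ᵥ v) + a ^ 2 * lor v (w *ᵥ v) := by
    intro a
    have hs : lor v (w *ᵥ n) = lor n (w *ᵥ v) := by rw [← lor_mulVec W.2, lor_comm]
    simp only [Matrix.mulVec_add, Matrix.mulVec_smul, lor_add_left, lor_add_right, lor_smul_left,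
      lor_smul_right, hs]
    ring
  -- As a function of `a`, the form at `n + a v` is a polynomial of degree at most 2. By invariance
  -- it has the same value at 0, `c` and `2c`, so it is constant.
  have h1 := hinv n
  have h2 := hinv (n + c • v)
  have e2 : mat γ *ᵥ (n + c • v) = n + (2 * c) • v := by
    rw [Matrix.mulVec_add, Matrix.mulVec_smul, hfix, hc, add_assoc, ← add_smul, two_mul]
  rw [e2, hexp, hexp] at h2
  rw [hc, hexp] at h1
  have hB : lor v (w *ᵥ v) = 0 := by
    have : c ^ 2 * lor v (w *ᵥ v) = 0 := by linarith
    exact (mul_eq_zero.1 this).resolve_left (pow_ne_zero 2 hc0)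
  have hA : lor n (w *ᵥ v) = 0 := by
    have : c * lor n (w *ᵥ v) = 0 := by rw [hB] at h1; linarith
    exact (mul_eq_zero.1 this).resolve_left hc0
  rw [hexp, hA, hB]; ring

/-- The contribution of the planes through the fixed point of a parabolic element is orthogonal to
the invariants. -/
lemma weightedSum_orthogonal_eq_zero (k : Fin 3) {γ : Γ} (h : IsParabolic γ) {v : Fin 4 → ℤ}
    (hfix : act γ v = v) (hv : lor v v = 0) (hv0 : 0 < v 0) (hodd : ¬∀ i, 2 ∣ v i) {W : nu4}
    (hW : coeff.ρ γ W = W) :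
    weightedSum k (fun n => traceForm (planeBend n) W)
      (fun n => if lor n v = 0 then side n - side (act γ⁻¹ n) else 0) = 0 := by
  obtain ⟨d, hd⟩ := exists_weight_add_smul k hv hodd
  have hfix' : act γ⁻¹ v = v := by conv_lhs => rw [← hfix, act_inv_act]
  have hfixR : mat γ *ᵥ toReal v = toReal v := by rw [mat_mulVec_toReal, ← act_apply, hfix]
  set φ : (Fin 4 → ℤ) → ℝ := fun n => traceForm (planeBend n) W with hφ
  set t : (Fin 4 → ℤ) → ℤ := fun n => if lor n v = 0 then side n - side (act γ⁻¹ n) else 0 with ht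
  -- `t` records the planes through `v` crossed on moving the base point by `γ`, and `u` is the
  -- change of side under the translation `n ↦ n + d v`. Both have finite support on unit vectors,
  -- so the sums may be rearranged.
  set u : (Fin 4 → ℤ) → ℤ := fun n => if lor n v = 0 then side n - side (n + d • v) else 0 with hu
  have hperp : ∀ n, lor (n + d • v) v = lor n v := by
    intro n
    rw [lor_add_left, lor_smul_left, hv, mul_zero, add_zero]
  have hnorm : ∀ n, lor n v = 0 → lor (n + d • v) (n + d • v) = lor n n := by
    intro n hn
    rw [lor_add_smul_self, hn, hv]; ring
  have hfin_t : FiniteUnits t := by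
    refine (finiteUnits_side_sub γ).subset ?_
    rintro n ⟨h1, h2⟩
    refine ⟨h1, fun e => h2 ?_⟩
    simp only [ht]
    split_ifs
    exacts [e, rfl]
  have hfin_tτ : FiniteUnits fun n => t (n + d • v) := by
    refine hfin_t.comp_equiv (Equiv.addRight (d • v)) fun n hn => hnorm n ?_
    by_contra h0
    refine hn (if_neg ?_)
    rwa [Equiv.coe_addRight, hperp]
  have hfin_u : FiniteUnits u := by
    refine (finite_unit (|d| * v 0)).subset ?_
    rintro n ⟨h1, h2⟩
    refine ⟨h1, ?_⟩
    have h3 : side n ≠ side (n + d • v) := by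
      intro e
      refine h2 ?_
      simp only [hu, e, sub_self, ite_self]
    by_contra! hlt
    refine h3 ?_
    have h4 : |d * v 0| < |n 0| := by rwa [abs_mul, abs_of_pos hv0]
    have h5 : (n + d • v) 0 = n 0 + d * v 0 := by simp
    rw [side, side, h5]
    rcases le_or_gt 0 (n 0) with h0 | h0
    · rw [abs_of_nonneg h0] at h4
      have := (abs_lt.1 h4)
      rw [Int.sign_eq_one_of_pos (by linarith), Int.sign_eq_one_of_pos (by linarith)]
    · rw [abs_of_neg h0] at h4
      have := (abs_lt.1 h4)
      rw [Int.sign_eq_neg_one_of_neg h0, Int.sign_eq_neg_one_of_neg (by linarith)]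
  -- Reindexing by the translation reverses the weights and leaves `φ` unchanged. The invariance of
  -- `φ` needs `γ` to move `n`; if `γ` fixes `n`, the translate is fixed too and its multiplicity
  -- `t` is 0.
  have hanti : weightedSum k φ t = -weightedSum k φ fun n => t (n + d • v) := by
    rw [weightedSum, ← finsum_comp_equiv (Equiv.addRight (d • v)), weightedSum,
      ← finsum_neg_distrib]
    refine finsum_congr fun n => ?_
    rw [Equiv.coe_addRight]
    by_cases hn : lor n v = 0
    · rw [hd n hn, neg_mul, neg_smul]
      congr 1
      by_cases hu1 : lor n n = 1
      · by_cases hm : act γ n = n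
        · have : t (n + d • v) = 0 := by
            have e : act γ⁻¹ (n + d • v) = n + d • v := by
              conv_lhs => rw [← hm, ← act_add_smul hfix, act_inv_act]
            simp only [ht, e, sub_self, ite_self]
          rw [this, mul_zero, zero_smul, zero_smul]
        · congr 1
          obtain ⟨c, hc⟩ :=
              exists_mulVec_eq_add_smul h hfixR (by rw [lor_toReal, hv, Int.cast_zero])
            (by simpa [toReal] using hv0.ne') (n :=
                toReal n) (by rw [lor_toReal, hn, Int.cast_zero])
          have hc0 : c ≠ 0 := by
            rintro rfl
            rw [zero_smul, add_zero, mat_mulVec_toReal] at hc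
            exact hm (toReal_injective hc)
          simp only [hφ]
          rw [traceForm_planeBend hu1, traceForm_planeBend ((hnorm n hn).trans hu1), toReal_add,
            toReal_smul, lor_mulVec_add_smul hW hfixR hc hc0]
      · rw [weight_of_ne hu1, zero_mul, zero_smul, zero_smul]
    · have : t (n + d • v) = 0 := if_neg (by rwa [hperp])
      rw [this, mul_zero, mul_zero, zero_smul, zero_smul, neg_zero]
  have hfin_uγ : FiniteUnits fun n => u (act γ⁻¹ n) :=
    hfin_u.comp_equiv (act γ⁻¹) fun n _ => lor_act _ _ _
  -- `γ` commutes with the translation, so the difference of `t` and its translate telescopes to `u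
  -- - u ∘ γ⁻¹`. Its sum against the invariant `φ` is 0, which with `hanti` gives that the sum over
  -- `t` equals its own negative.
  have hdiff : (fun n => t n - t (n + d • v)) = fun n => u n - u (act γ⁻¹ n) := by
    funext n
    have h1 : lor (act γ⁻¹ n) v = lor n v := by conv_lhs => rw [← hfix', lor_act]
    simp only [ht, hu, hperp, h1, act_add_smul hfix']
    split_ifs <;> ring
  have hinv : weightedSum k φ (fun n => u (act γ⁻¹ n)) = weightedSum k φ u := by
    rw [weightedSum_comp_act γ]
    simp only [act_inv_act]
    congr 1
    funext n
    simp only [hφ]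
    rw [planeBend_act]
    conv_lhs => rw [← hW, traceForm_ρ]
  have h2 : weightedSum k φ t - weightedSum k φ (fun n => t (n + d • v)) = 0 := by
    rw [← weightedSum_sub hfin_t hfin_tτ, hdiff, weightedSum_sub hfin_u hfin_uγ, hinv, sub_self]
  linarith

/-- The base point is pushed to the ideal point fixed by `γ`, whose side of a plane missing it does
not change under `γ`. The planes through the ideal point are left over and are handled by
`weightedSum_orthogonal_eq_zero`. -/
lemma crossing_mem_PZ1 (k : Fin 3) : crossing k ∈ PZ1 := by
  intro γ h
  obtain ⟨v, hfix, hv, hv0, hodd⟩ := exists_null_fixed h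
  -- The change of side between the base point and the ideal point `v`. It has finite support on
  -- unit vectors because planes through `v` are left out.
  set g : (Fin 4 → ℤ) → ℤ := fun n => if lor n v = 0 then 0 else side n - (-lor n v).sign with hg
  set t : (Fin 4 → ℤ) → ℤ := fun n => if lor n v = 0 then side n - side (act γ⁻¹ n) else 0 with ht
  have hfix' : act γ⁻¹ v = v := by conv_lhs => rw [← hfix, act_inv_act]
  have hfin_g : FiniteUnits g := by
    refine (finite_unit (v 0)).subset ?_
    rintro n ⟨h1, h2⟩
    refine ⟨h1, abs_le_of_sign_ne h1 hv hv0 ?_ ?_⟩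
    · exact fun e => h2 (if_pos e)
    · intro e
      refine h2 ?_
      simp only [hg, side, e, sub_self, ite_self]
  have hfin_gγ : FiniteUnits fun n => g (act γ⁻¹ n) :=
    hfin_g.comp_equiv (act γ⁻¹) fun n _ => lor_act _ _ _
  have hfin_t : FiniteUnits t := by
    refine (finiteUnits_side_sub γ).subset ?_
    rintro n ⟨h1, h2⟩
    refine ⟨h1, fun e => h2 ?_⟩
    simp only [ht]
    split_ifs
    exacts [e, rfl]
  have hsplit : (fun n => side n - side (act γ⁻¹ n)) =
      fun n => t n + (g n - g (act γ⁻¹ n)) := by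
    funext n
    have h1 : lor (act γ⁻¹ n) v = lor n v := by conv_lhs => rw [← hfix', lor_act]
    simp only [ht, hg, h1]
    split_ifs <;> ring
  have hval : (crossing k) γ = weightedSum k planeBend t +
      (LinearMap.id - coeff.ρ γ : nu4 →ₗ[ℝ] nu4) (weightedSum k planeBend g) := by
    change weightedSum k planeBend (fun n => side n - side (act γ⁻¹ n)) = _
    rw [hsplit, weightedSum_add hfin_t (hfin_g.sub hfin_gγ), weightedSum_sub hfin_g hfin_gγ,
      LinearMap.sub_apply, LinearMap.id_apply, coeff_ρ_weightedSum k γ hfin_g]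
  rw [hval]
  refine Submodule.add_mem _ (mem_range_of_traceForm_eq_zero fun W hW => ?_) ⟨_, rfl⟩
  rw [traceForm_comm, map_weightedSum _ hfin_t]
  simp only [fun n => traceForm_comm W (planeBend n)]
  exact weightedSum_orthogonal_eq_zero k h hfix hv hv0 hodd hW

/-! ### Crossing cocycles in terms of bendings -/

/-- The unit vectors that the `i`-th generator moves to another side of the base point. -/
def crossed : Fin 3 → Finset (Fin 4 → ℤ) :=
  ![{![-2, 0, 1, -2], ![-2, 0, 2, -1], ![-1, 0, 1, -1], ![0, 0, -1, 0], ![0, 0, 0, -1],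
      ![0, 0, 0, 1], ![0, 0, 1, 0], ![1, 0, -1, 1], ![2, 0, -2, 1], ![2, 0, -1, 2]},
    {![-2, -2, 0, -1], ![-2, -1, 0, -2], ![-1, -1, 0, -1], ![0, -1, 0, 0], ![0, 0, 0, -1],
      ![0, 0, 0, 1], ![0, 1, 0, 0], ![1, 1, 0, 1], ![2, 1, 0, 2], ![2, 2, 0, 1]},
    {![-2, -2, 1, 0], ![-2, -1, 2, 0], ![-1, -1, 1, 0], ![0, -1, 0, 0], ![0, 0, -1, 0],
      ![0, 0, 1, 0], ![0, 1, 0, 0], ![1, 1, -1, 0], ![2, 1, -2, 0], ![2, 2, -1, 0]}]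

/-- The sides of `n` and of its translate by the inverse of the `i`-th generator, subtracted. -/
def sideChange (i : Fin 3) (n : Fin 4 → ℤ) : ℤ := side n - side (letterMat i false *ᵥ n)

lemma mem_crossed_of_small : ∀ (i : Fin 3) (p q r s : Fin 5),
    lor ![(p : ℤ) - 2, (q : ℤ) - 2, (r : ℤ) - 2, (s : ℤ) - 2]
      ![(p : ℤ) - 2, (q : ℤ) - 2, (r : ℤ) - 2, (s : ℤ) - 2] = 1 →
    sideChange i ![(p : ℤ) - 2, (q : ℤ) - 2, (r : ℤ) - 2, (s : ℤ) - 2] ≠ 0 →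
    ![(p : ℤ) - 2, (q : ℤ) - 2, (r : ℤ) - 2, (s : ℤ) - 2] ∈ crossed i := by
  decide +kernel

lemma lor_crossed : ∀ i : Fin 3, ∀ n ∈ crossed i, lor n n = 1 := by
  decide +kernel

lemma act_gen_inv (i : Fin 3) (n : Fin 4 → ℤ) :
    act (PresentedGroup.of i)⁻¹ n = letterMat i false *ᵥ n := by
  rw [act_apply, intMat_gen_inv]; rfl

/-- A generator moves the base point to a point with time coordinate 3, so `n₀² ≤ 3² - 1` and `|n₀|
≤ 2`. The space coordinates then satisfy `nⱼ² ≤ 1 + n₀² ≤ 5`, which leaves entries between -2 and 2.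
-/
lemma mem_crossed {i : Fin 3} {n : Fin 4 → ℤ} (hn : lor n n = 1) (h : sideChange i n ≠ 0) :
    n ∈ crossed i := by
  have hq : lor (act (PresentedGroup.of i) basePoint) (act (PresentedGroup.of i) basePoint) = -1 := by
    rw [lor_act, lor_basePoint]; rfl
  have hq0 : act (PresentedGroup.of i) basePoint 0 = 3 := by
    have h3 : ∀ i, (genMatrix i *ᵥ basePoint) 0 = 3 := by decide
    rw [act_apply, intMat_gen, h3]
  have h0 := sq_le_of_sign_ne hn hq (by rw [hq0]; norm_num) (by
    rw [← act_inv_apply_zero, act_gen_inv]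
    exact fun e => h (sub_eq_zero.2 e))
  rw [hq0] at h0
  have hn' := hn
  simp only [lor] at hn'
  have h0' : n 0 ^ 2 ≤ 4 := by
    have h1 : |n 0| < 3 := abs_lt_of_sq_lt_sq (by linarith) (by norm_num)
    have h2 : |n 0| ≤ 2 := by omega
    calc n 0 ^ 2 = |n 0| ^ 2 := (sq_abs _).symm
      _ ≤ 2 ^ 2 := pow_le_pow_left₀ (abs_nonneg _) h2 2
      _ = 4 := by norm_num
  have hb : ∀ j, n j ^ 2 < 3 ^ 2 := by
    intro j
    fin_cases j
    · simp only [Fin.zero_eta]; linarith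
    · simp only [Fin.mk_one]; nlinarith [sq_nonneg (n 2), sq_nonneg (n 3)]
    · simp only [Fin.reduceFinMk]; nlinarith [sq_nonneg (n 1), sq_nonneg (n 3)]
    · simp only [Fin.reduceFinMk]; nlinarith [sq_nonneg (n 1), sq_nonneg (n 2)]
  have hp : ∀ j, ∃ p : Fin 5, n j = (p : ℤ) - 2 := by
    intro j
    have h1 := abs_lt.1 (abs_lt_of_sq_lt_sq (hb j) (by norm_num))
    exact ⟨⟨(n j + 2).toNat, by omega⟩, by simp only; omega⟩
  choose p hp using hp
  have e : n = ![(p 0 : ℤ) - 2, (p 1 : ℤ) - 2, (p 2 : ℤ) - 2, (p 3 : ℤ) - 2] := by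
    rw [eq_vec n, hp 0, hp 1, hp 2, hp 3]
  rw [e] at hn h ⊢
  exact mem_crossed_of_small i _ _ _ _ hn h

/-- The integer matrix of the infinitesimal bending along the plane with normal vector `n`. -/
def intPlaneBend (n : Fin 4 → ℤ) : Matrix (Fin 4) (Fin 4) ℤ :=
  1 - Matrix.of fun a b => 4 * (n a * n b * (![-1, 1, 1, 1] : Fin 4 → ℤ) b)

lemma coe_planeBend_eq_map {n : Fin 4 → ℤ} (hn : lor n n = 1) :
    (planeBend n : Matrix (Fin 4) (Fin 4) ℝ) = (intPlaneBend n).map (Int.castRingHom ℝ) := by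
  rw [coe_planeBend hn]
  ext a b
  rw [J, Matrix.sub_apply, Matrix.smul_apply, Matrix.mul_diagonal, Matrix.vecMulVec_apply]
  have hb : (![-1, 1, 1, 1] : Fin 4 → ℝ) b = ((![-1, 1, 1, 1] : Fin 4 → ℤ) b : ℝ) := by
    fin_cases b <;> simp
  rw [hb]
  rcases eq_or_ne a b with rfl | hab <;> simp_all [intPlaneBend, toReal]

/-- The value of the `k`-th crossing cocycle on the `i`-th generator. -/
def intCrossing (k i : Fin 3) : Matrix (Fin 4) (Fin 4) ℤ :=
  ∑ n ∈ crossed i, (weight k n * sideChange i n) • intPlaneBend n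

lemma val_crossing (k i : Fin 3) : val (crossing k) (PresentedGroup.of i) =
    (intCrossing k i).map (Int.castRingHom ℝ) := by
  have h : val (crossing k) (PresentedGroup.of i) =
      ((weightedSum k planeBend (sideChange i) : nu4) : Matrix (Fin 4) (Fin 4) ℝ) := by
    rw [crossing, val_mkCocycle]
    simp only [act_gen_inv]
    rfl
  rw [h, weightedSum_eq_sum (crossed i) fun n => mem_crossed, intCrossing,
    ← RingHom.mapMatrix_apply, map_sum, Submodule.coe_sum]
  refine Finset.sum_congr rfl fun n hn => ?_
  rw [map_zsmul, RingHom.mapMatrix_apply, ← coe_planeBend_eq_map (lor_crossed i n hn)]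
  rfl

/-- The two spheres with waistband at the `k`-th cusp. -/
def waistSphere : Fin 3 → Fin 2 → Fin 6 := ![![0, 1], ![2, 3], ![4, 5]]

/-- The element of `ν₄` whose principal cocycle occurs in `crossing_eq`. -/
def correction (k : Fin 3) : Matrix (Fin 4) (Fin 4) ℤ :=
  Matrix.diagonal (![![2, 2, 2, -6], ![2, -6, 2, 2], ![-2, -2, 6, -2]] k)

lemma correction_mem (k : Fin 3) : (correction k).map (Int.castRingHom ℝ) ∈ nu4 := by
  apply map_mem_nu4
  · revert k; decide +kernel
  · revert k; decide +kernel

/-- The base point lies on one plane of nonzero `k`-th weight, a coordinate plane, and `correction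
k` is `±2` times the infinitesimal bending along it: the principal cocycle accounts for moving the
base point off that plane. The factor 4 arises because a crossed plane has two unit normals and
crossing it changes the sign by 2. -/
lemma intCrossing_eq : ∀ k i : Fin 3, intCrossing k i =
    (4 : ℤ) • (if i = k then intTangent (waistSphere k 0) - intTangent (waistSphere k 1) else 0) +
      (correction k - letterMat i true * correction k * letterMat i false) := by
  decide +kernel

lemma val_tangent_gen (j : Fin 6) (i : Fin 3) : val (tangent j) (PresentedGroup.of i) =
    (if i = stableIndex j then intTangent j else 0).map (Int.castRingHom ℝ) := by
  split_ifs with h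
  · rw [h, of_stableIndex, val_tangent_stableLetter, bendTangent_eq_map]
  · rw [val_tangent_of_mem j (gen_mem_baseGroup_of_ne h)]
    simp

lemma stableIndex_waistSphere : ∀ (k : Fin 3) (e : Fin 2), stableIndex (waistSphere k e) = k := by
  decide

lemma crossing_eq (k : Fin 3) : crossing k =
    (4 : ℝ) • (tangent (waistSphere k 0) - tangent (waistSphere k 1)) +
      principal ⟨_, correction_mem k⟩ := by
  refine ext_generators fun i => ?_
  have h : ∀ s, mat (letter (i, s)) = (letterMat i s).map (Int.castRingHom ℝ) := mat_gen i
  rw [val_add, val_smul, val_sub, val_crossing, intCrossing_eq, val_tangent_gen, val_tangent_gen,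
    stableIndex_waistSphere, stableIndex_waistSphere, val_principal]
  change _ = _ + (_ - mat (letter (i, true)) * _ * mat (letter (i, false)))
  rw [h, h, ← Matrix.map_mul, ← Matrix.map_mul]
  ext a b
  split_ifs <;> simp [-zsmul_eq_mul]

lemma principal_mem_PZ1 (V : nu4) : principal V ∈ PZ1 := fun _ _ => ⟨V, rfl⟩

lemma tangent_sub_mem_PZ1 (k : Fin 3) :
    tangent (waistSphere k 0) - tangent (waistSphere k 1) ∈ PZ1 := by
  have h := PZ1.smul_mem (4⁻¹ : ℝ) (PZ1.add_mem (crossing_mem_PZ1 k)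
    (PZ1.smul_mem (-1 : ℝ) (principal_mem_PZ1 ⟨_, correction_mem k⟩)))
  convert h using 1
  refine ext_generators fun i => ?_
  have e := congrArg (fun c => val c (PresentedGroup.of i)) (crossing_eq k)
  simp only [val_add, val_smul] at e
  refine Eq.trans ?_ (val_smul _ _ _).symm
  refine Eq.trans ?_ (congrArg _ (val_add _ _ _).symm)
  refine Eq.trans ?_ (congrArg (fun M => (4⁻¹ : ℝ) • (_ + M)) (val_smul _ _ _).symm)
  rw [e]
  module

/-! ### The parabolic cohomology -/

/-- The space axis fixed by the `i`-th generator. -/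
def fixedAxis : Fin 3 → Fin 4 := ![1, 2, 3]

lemma isParabolic_gen (i : Fin 3) : IsParabolic (PresentedGroup.of i) := by
  apply isParabolic_of_intMat
  · rw [intMat_gen]; revert i; decide +kernel
  · rw [intMat_gen]; revert i; decide +kernel

/-- The row of the generator and the column of its inverse at this axis are unit vectors, so
conjugation preserves this diagonal entry. It therefore vanishes on the image of `1 - Ad`. -/
lemma conj_fixedAxis (i : Fin 3) (V : Matrix (Fin 4) (Fin 4) ℝ) :
    (mat (PresentedGroup.of i) * V * mat (PresentedGroup.of i)⁻¹) (fixedAxis i) (fixedAxis i) =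
      V (fixedAxis i) (fixedAxis i) := by
  have h : ∀ s, mat (letter (i, s)) = (letterMat i s).map (Int.castRingHom ℝ) := mat_gen i
  have hr : ∀ i, (letterMat i true) (fixedAxis i) = Pi.single (fixedAxis i) 1 := by
    decide +kernel
  have hc : ∀ i, (fun a => letterMat i false a (fixedAxis i)) = Pi.single (fixedAxis i) 1 := by
    decide +kernel
  change (mat (letter (i, true)) * V * mat (letter (i, false))) _ _ = _
  rw [h, h, Matrix.mul_apply, Finset.sum_eq_single (fixedAxis i), Matrix.mul_apply,
    Finset.sum_eq_single (fixedAxis i)]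
  · simp [hr, congrFun (hc i) (fixedAxis i)]
  · intro b _ hb
    simp [hr, hb]
  · intro h; exact absurd (Finset.mem_univ _) h
  · intro b _ hb
    have := congrFun (hc i) b
    simp only [Pi.single_eq_of_ne hb] at this
    simp [this]
  · intro h; exact absurd (Finset.mem_univ _) h

lemma val_fixedAxis_of_mem_PZ1 {c : cocycles₁ coeff} (hc : c ∈ PZ1) (i : Fin 3) :
    val c (PresentedGroup.of i) (fixedAxis i) (fixedAxis i) = 0 := by
  obtain ⟨V, hV⟩ := hc _ (isParabolic_gen i)
  have h : val c (PresentedGroup.of i) = val (principal V) (PresentedGroup.of i) :=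
    congrArg Subtype.val hV.symm
  rw [h, val_principal, Matrix.sub_apply, conj_fixedAxis, sub_self]

/-- The normal of a sphere has coordinate 0 at the axis fixed by its stable letter, so the entry of
`1 - 4 proj` there is 1. -/
lemma val_tangent_fixedAxis (j : Fin 6) (i : Fin 3) :
    val (tangent j) (PresentedGroup.of i) (fixedAxis i) (fixedAxis i) =
      if i = stableIndex j then 1 else 0 := by
  have h : ∀ j, intTangent j (fixedAxis (stableIndex j)) (fixedAxis (stableIndex j)) = 1 := by
    decide +kernel
  rw [val_tangent_gen]
  split_ifs with hi
  · rw [hi, Matrix.map_apply, h, map_one]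
  · simp

lemma val_sum_smul (a : Fin 6 → ℝ) (γ : Γ) :
    val (∑ j, a j • tangent j) γ = ∑ j, a j • val (tangent j) γ := by
  simp only [Fin.sum_univ_six, val_add, val_smul]

/-- The differences of the bendings along the two spheres with the same waistband. -/
def bendDifference (k : Fin 3) : H1 coeff :=
  H1π coeff (tangent (waistSphere k 0) - tangent (waistSphere k 1))

lemma bendDifference_eq (k : Fin 3) : bendDifference k =
    H1π coeff (tangent (waistSphere k 0)) - H1π coeff (tangent (waistSphere k 1)) :=
  map_sub (H1π coeff).hom _ _

lemma span_bendDifference : Submodule.span ℝ (Set.range bendDifference) = PH1 := by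
  apply le_antisymm
  · rw [Submodule.span_le]
    rintro _ ⟨k, rfl⟩
    exact ⟨_, tangent_sub_mem_PZ1 k, rfl⟩
  · rintro _ ⟨c, hc, rfl⟩
    set a : Fin 6 → ℝ := fun j => tangentBasis.repr (H1π coeff c) j with ha
    have hsum : ∑ j, a j • H1π coeff (tangent j) = H1π coeff c := by
      simpa only [tangentBasis_apply] using tangentBasis.sum_repr (H1π coeff c)
    have h1 : H1π coeff (∑ j, a j • tangent j) = H1π coeff c := by
      rw [← hsum, map_sum]
      exact Finset.sum_congr rfl fun j _ => map_smul (H1π coeff).hom _ _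
    have h2 : H1π coeff (c - ∑ j, a j • tangent j) = 0 :=
      (map_sub (H1π coeff).hom _ _).trans (sub_eq_zero.2 h1.symm)
    obtain ⟨V, hV⟩ := exists_principal_of_H1π_eq_zero h2
    have h3 : ∀ i, ∑ j, a j * (if i = stableIndex j then 1 else 0) = 0 := by
      intro i
      have h4 := congrFun (congrFun (hV (PresentedGroup.of i)) (fixedAxis i)) (fixedAxis i)
      rw [val_sub, val_sum_smul, val_principal, Matrix.sub_apply, Matrix.sub_apply, conj_fixedAxis,
        sub_self, val_fixedAxis_of_mem_PZ1 hc, Matrix.sum_apply, zero_sub, neg_eq_zero] at h4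
      refine Eq.trans (Finset.sum_congr rfl fun j _ => ?_) h4
      rw [Matrix.smul_apply, val_tangent_fixedAxis, smul_eq_mul]
    -- The vanishing of the diagonal entry on the `k`-th generator involves only the two spheres
    -- with that stable letter, each with entry 1.
    have h5 : ∀ k, a (waistSphere k 1) = -a (waistSphere k 0) := by
      intro k
      have := h3 k
      rw [Fin.sum_univ_six] at this
      fin_cases k <;> simp [stableIndex, waistSphere] at this ⊢ <;> linarith
    have h6 : H1π coeff c = ∑ k, a (waistSphere k 0) • bendDifference k := by
      have e0 := h5 0
      have e1 := h5 1
      have e2 := h5 2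
      simp only [waistSphere, Matrix.cons_val] at e0 e1 e2
      rw [← hsum, Fin.sum_univ_six, Fin.sum_univ_three]
      simp only [bendDifference_eq, waistSphere, Matrix.cons_val, e0, e1, e2]
      module
    change H1π coeff c ∈ _
    rw [h6]
    exact Submodule.sum_mem _ fun k _ =>
      Submodule.smul_mem _ _ (Submodule.subset_span ⟨k, rfl⟩)

lemma linearIndependent_bendDifference : LinearIndependent ℝ bendDifference := by
  rw [Fintype.linearIndependent_iff]
  intro a ha
  have h := Fintype.linearIndependent_iff.1 linearIndependent_tangent
    ![a 0, -a 0, a 1, -a 1, a 2, -a 2] (by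
      rw [← ha, Fin.sum_univ_six, Fin.sum_univ_three]
      simp only [bendDifference_eq, waistSphere, Matrix.cons_val]
      module)
  intro k
  fin_cases k
  exacts [h 0, h 2, h 4]

lemma finrank_PH1 : Module.finrank ℝ PH1 = 3 := by
  rw [← span_bendDifference, finrank_span_eq_card linearIndependent_bendDifference,
    Fintype.card_fin]

end Borromean

end

theorem theorem1p6 :
    (∀ j : Fin 6, Borromean.IsThricePuncturedSphereGroup (Borromean.sphereGroup j) ∧
      Borromean.IsHNNSplitting (Borromean.baseGroup j) (Borromean.sphereGroup j)
        (Borromean.stableLetter j)) ∧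
    Module.finrank ℝ (groupCohomology.H1 Borromean.coeff) = 6 ∧
    Module.finrank ℝ Borromean.PH1 = 3 ∧
    ∃ (r : Fin 6 → ℝ → Borromean.Γ →* Borromean.SL4)
      (ξ : Fin 6 → groupCohomology.cocycles₁ Borromean.coeff),
      (∀ j, Borromean.IsBending (Borromean.baseGroup j) (Borromean.sphereGroup j)
        (Borromean.stableLetter j) (r j)) ∧
      (∀ j, Borromean.IsTangentCocycle (r j) (ξ j)) ∧
      (∃ b : Module.Basis (Fin 6) ℝ (groupCohomology.H1 Borromean.coeff),
        ∀ j, b j = groupCohomology.H1π Borromean.coeff (ξ j)) ∧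
      (∃ D : Matrix (Fin 6) (Fin 6) ℝ,
        (∀ i j, HasDerivAt (fun t : ℝ =>
          Matrix.trace ((r j t (Borromean.testWord i) : Borromean.SL4) :
            Matrix (Fin 4) (Fin 4) ℝ)) (D i j) 0) ∧
        D.det ≠ 0) ∧
      Submodule.span ℝ
        {groupCohomology.H1π Borromean.coeff (ξ 0 - ξ 1),
         groupCohomology.H1π Borromean.coeff (ξ 2 - ξ 3),
         groupCohomology.H1π Borromean.coeff (ξ 4 - ξ 5)} = Borromean.PH1 := by
  refine ⟨fun j => ⟨Borromean.isThricePuncturedSphereGroup j, Borromean.isHNNSplitting j⟩,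
    Borromean.finrank_H1, Borromean.finrank_PH1, Borromean.bending, Borromean.tangent,
    Borromean.isBending, Borromean.isTangentCocycle,
    ⟨Borromean.tangentBasis, Borromean.tangentBasis_apply⟩,
    ⟨Borromean.traceMatrix.map (Int.castRingHom ℝ), fun i j => ?_, Borromean.det_traceMatrix⟩, ?_⟩
  · rw [← Borromean.traceDeriv_tangent]
    exact Borromean.hasDerivAt_trace j _
  · rw [← Borromean.span_bendDifference]
    congr 1
    ext h
    simp only [Set.mem_range, Fin.exists_fin_succ, Set.mem_insert_iff, Set.mem_singleton_iff,
      IsEmpty.exists_iff, or_false]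
    simp only [eq_comm (a := h)]
    rfl
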